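/- Let $\Omega \subset \mathbb R^3$ be a connected, bounded open set with smooth boundary and outward unit normal $\mathbf n$. For an integrable function $f$ on $\Omega$ write $\overline f = \frac{1}{|\Omega|}\int_\Omega f\,dx$. Let $$V = \{\xi \in H^2(\Omega) : \partial \xi/\partial \mathbf n = 0 \text{ on } \partial\Omega\}, \qquad \widetilde V = \{\eta \in V : \overline \eta = 0\},$$ where $\partial\xi/\partial\mathbf n$ is understood in the sense of traces, and both spaces carry the norm of $H^2(\Omega)$. For $w \in L^{6/5}(\Omega)$ consider the problem $$\Delta^2 \varphi - \Delta \varphi - w + \overline w = 0 \ \text{ in } \Omega, \qquad \frac{\partial \varphi}{\partial \mathbf n} = \frac{\partial \Delta\varphi}{\partial \mathbf n} = 0 \ \text{ on } \partial\Omega, \qquad \int_\Omega \varphi\,dx = 0. \qquad (*)$$ A weak solution of $(*)$ is a function $\varphi \in \widetilde V$ such that for every $v \in \widetilde V$ the function $wv$ is integrable on $\Omega$ and $$\int_\Omega \Delta\varphi\,\Delta v\,dx + \int_\Omega \nabla\varphi\cdot\nabla v\,dx - \int_\Omega w v\,dx = 0.$$ Then for every $w \in L^{6/5}(\Omega)$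 there is a unique weak solution $L(w) \in \widetilde V$ of $(*)$. It satisfies moreover, for every $v \in V$, $(w-\overline w)v \in L^1(\Omega)$ and $$\int_\Omega \Delta L(w)\,\Delta v\,dx + \int_\Omega \nabla L(w)\cdot\nabla v\,dx = \int_\Omega (w - \overline w)\, v\,dx.$$ The map $L : L^{6/5}(\Omega) \to \widetilde V$ is linear and continuous, hence of class $C^\infty$. -/

import Mathlib

open MeasureTheory Filter Topology
open scoped ENNReal ContDiff

/-- Euclidean three-space. -/
abbrev E3 : Type := EuclideanSpace ℝ (Fin 3)

/-- The exponent `6/5` is at least `1`, so that `L^{6/5}` is a normed space. -/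
instance fact_one_le_six_fifths : Fact ((1 : ℝ≥0∞) ≤ 6 / 5) :=
  ⟨by
    rw [ENNReal.le_div_iff_mul_le (by norm_num) (by norm_num)]
    norm_num⟩

/-! ### Smooth domains and their outward unit normal -/

/-- `ρ` is a smooth defining function of `Ω` near the point `x`: near `x` the set `Ω` is
`{ρ < 0}`, and the gradient of `ρ` does not vanish at `x`. -/
structure IsLocalDefiningFunction (Ω : Set E3) (x : E3) (ρ : E3 → ℝ) : Prop where
  contDiff : ContDiff ℝ ∞ ρ
  gradient_ne_zero : gradient ρ x ≠ 0
  mem_iff : ∀ᶠ y in 𝓝 x, (y ∈ Ω ↔ ρ y < 0)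

/-- A connected, bounded open set of `ℝ³` with smooth boundary, lying locally on one side of
its boundary. -/
structure SmoothBoundedDomain where
  carrier : Set E3
  isOpen : IsOpen carrier
  isConnected : IsConnected carrier
  isBounded : Bornology.IsBounded carrier
  smooth_boundary : ∀ x ∈ frontier carrier, ∃ ρ, IsLocalDefiningFunction carrier x ρ

open Classical in
/-- The outward unit normal at a boundary point: the normalized gradient of any local defining
function (it does not depend on the choice, see `outwardNormal_eq`); `0` where there is no local
defining function. -/
noncomputable def outwardNormal (Ω : Set E3) (x : E3) : E3 :=
  if h : ∃ ρ, IsLocalDefiningFunction Ω x ρ then ‖gradient h.choose x‖⁻¹ • gradient h.choose x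
  else 0

/-- Along a direction in which the derivative is negative, a function that vanishes at the base
point becomes negative. -/
theorem eventually_neg_of_inner_neg {ρ : E3 → ℝ} {x τ : E3} (hρ : ContDiff ℝ ∞ ρ)
    (h0 : ρ x = 0) (hτ : inner ℝ (gradient ρ x) τ < 0) :
    ∀ᶠ t in 𝓝[>] (0 : ℝ), ρ (x + t • τ) < 0 := by
  have hd : DifferentiableAt ℝ ρ x := (hρ.differentiable (by simp)) x
  have h1 : HasDerivAt (fun t : ℝ => ρ (x + t • τ)) (inner ℝ (gradient ρ x) τ) 0 := by
    have hg : HasFDerivAt ρ (InnerProductSpace.toDual ℝ E3 (gradient ρ x)) (x + (0 : ℝ) • τ) := by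
      simpa using hd.hasGradientAt.hasFDerivAt
    have hl : HasDerivAt (fun t : ℝ => x + t • τ) τ 0 := by
      simpa using ((hasDerivAt_id (0 : ℝ)).smul_const τ).const_add x
    have h := hg.comp_hasDerivAt (0 : ℝ) hl
    rw [InnerProductSpace.toDual_apply_apply] at h
    exact h
  have h2 := h1.hasDerivWithinAt (s := Set.Ioi 0)
  rw [hasDerivWithinAt_iff_tendsto_slope' (by simp)] at h2
  filter_upwards [h2.eventually (gt_mem_nhds hτ), self_mem_nhdsWithin] with t ht htpos
  have htpos' : (0 : ℝ) < t := htpos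
  simp only [slope_def_field, zero_smul, add_zero, h0, sub_zero] at ht
  by_contra hcon
  exact absurd ht (not_lt.mpr (div_nonneg (not_lt.mp hcon) htpos'.le))

/-- A local defining function vanishes at a boundary point. -/
theorem IsLocalDefiningFunction.eq_zero {Ω : Set E3} {x : E3} {ρ : E3 → ℝ}
    (h : IsLocalDefiningFunction Ω x ρ) (hx : x ∈ frontier Ω) : ρ x = 0 := by
  have hc : ContinuousAt ρ x := h.contDiff.continuous.continuousAt
  rcases lt_trichotomy (ρ x) 0 with hlt | heq | hgt
  · exfalso
    have : Ω ∈ 𝓝 x := by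
      filter_upwards [h.mem_iff, hc.eventually (gt_mem_nhds hlt)] with y h1 h2 using h1.2 h2
    exact hx.2 (mem_interior_iff_mem_nhds.2 this)
  · exact heq
  · exfalso
    have : ∀ᶠ y in 𝓝 x, y ∉ Ω := by
      filter_upwards [h.mem_iff, hc.eventually (lt_mem_nhds hgt)] with y h1 h2
      rw [h1]
      exact not_lt.2 h2.le
    exact (mem_closure_iff_frequently.1 hx.1) this

/-- Any two local defining functions have the same normalized gradient at a boundary point. -/
theorem IsLocalDefiningFunction.normalized_gradient_eq {Ω : Set E3} {x : E3} {ρ σ : E3 → ℝ}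
    (hρ : IsLocalDefiningFunction Ω x ρ) (hσ : IsLocalDefiningFunction Ω x σ)
    (hx : x ∈ frontier Ω) :
    ‖gradient ρ x‖⁻¹ • gradient ρ x = ‖gradient σ x‖⁻¹ • gradient σ x := by
  by_contra hne
  set a := ‖gradient ρ x‖⁻¹ • gradient ρ x with ha
  set b := ‖gradient σ x‖⁻¹ • gradient σ x with hb
  have hpa : 0 < ‖gradient ρ x‖ := norm_pos_iff.2 hρ.gradient_ne_zero
  have hpb : 0 < ‖gradient σ x‖ := norm_pos_iff.2 hσ.gradient_ne_zero
  have hna : ‖a‖ = 1 := by simp [ha, norm_smul, hpa.ne']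
  have hnb : ‖b‖ = 1 := by simp [hb, norm_smul, hpb.ne']
  have hab : inner ℝ a b < 1 := (inner_lt_one_iff_real_of_norm_eq_one hna hnb).2 hne
  have hga : gradient ρ x = ‖gradient ρ x‖ • a := by
    rw [ha, smul_smul, mul_inv_cancel₀ hpa.ne', one_smul]
  have hgb : gradient σ x = ‖gradient σ x‖ • b := by
    rw [hb, smul_smul, mul_inv_cancel₀ hpb.ne', one_smul]
  have h1 : inner ℝ (gradient ρ x) (b - a) < 0 := by
    rw [hga, real_inner_smul_left, inner_sub_right, real_inner_self_eq_norm_sq, hna]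
    nlinarith
  have hgn : gradient (fun y => -σ y) x = -gradient σ x := by
    have : fderiv ℝ (fun y => -σ y) x = -fderiv ℝ σ x := fderiv_fun_neg
    simp [gradient, this]
  have h2 : inner ℝ (gradient (fun y => -σ y) x) (b - a) < 0 := by
    rw [hgn, inner_neg_left, hgb, real_inner_smul_left, inner_sub_right,
      real_inner_self_eq_norm_sq, hnb, real_inner_comm]
    nlinarith
  have e1 := eventually_neg_of_inner_neg hρ.contDiff (hρ.eq_zero hx) h1
  have e2 := eventually_neg_of_inner_neg hσ.contDiff.neg (by simp [hσ.eq_zero hx]) h2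
  have hl : Tendsto (fun t : ℝ => x + t • (b - a)) (𝓝[>] 0) (𝓝 x) := by
    have : Continuous (fun t : ℝ => x + t • (b - a)) := by fun_prop
    have h := (this.tendsto 0).mono_left (nhdsWithin_le_nhds (s := Set.Ioi 0))
    simpa using h
  obtain ⟨t, t1, t2, t3, t4⟩ :=
    (e1.and (e2.and ((hl.eventually hρ.mem_iff).and (hl.eventually hσ.mem_iff)))).exists
  have := t4.1 (t3.2 t1)
  linarith

/-- The outward unit normal may be computed from any local defining function. -/
theorem outwardNormal_eq {Ω : Set E3} {x : E3} {ρ : E3 → ℝ}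
    (h : IsLocalDefiningFunction Ω x ρ) (hx : x ∈ frontier Ω) :
    outwardNormal Ω x = ‖gradient ρ x‖⁻¹ • gradient ρ x := by
  have hex : ∃ ρ, IsLocalDefiningFunction Ω x ρ := ⟨ρ, h⟩
  rw [outwardNormal, dif_pos hex]
  exact hex.choose_spec.normalized_gradient_eq h hx

/-- The normal derivative `∂f/∂n` at a boundary point. -/
noncomputable def normalDeriv (Ω : Set E3) (f : E3 → ℝ) (x : E3) : ℝ :=
  fderiv ℝ f x (outwardNormal Ω x)

/-! ### Weak derivatives -/

/-- `g` is the weak partial derivative `∂ᵢ u` in the open set `Ω`. -/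
def HasWeakPartial (Ω : Set E3) (i : Fin 3) (u g : E3 → ℝ) : Prop :=
  ∀ η : E3 → ℝ, ContDiff ℝ ∞ η → HasCompactSupport η → tsupport η ⊆ Ω →
    ∫ x in Ω, u x * fderiv ℝ η x (EuclideanSpace.single i 1) = -∫ x in Ω, g x * η x

namespace SmoothBoundedDomain

variable (Ω : SmoothBoundedDomain)

/-- Lebesgue measure on the domain. -/
noncomputable abbrev vol : Measure E3 := volume.restrict Ω.carrier

instance : IsFiniteMeasure Ω.vol :=
  ⟨by simpa using Ω.isBounded.measure_lt_top⟩

/-- Surface measure on the boundary. -/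
noncomputable abbrev surface : Measure E3 := (μHE[2] : Measure E3).restrict (frontier Ω.carrier)

/-- `L^p(Ω)`. -/
noncomputable abbrev L (p : ℝ≥0∞) : Type := Lp ℝ p Ω.vol

theorem continuousOn_outwardNormal :
    ContinuousOn (outwardNormal Ω.carrier) (frontier Ω.carrier) := by
  intro x hx
  obtain ⟨ρ, hρ⟩ := Ω.smooth_boundary x hx
  have hg : Continuous (gradient ρ) :=
    (InnerProductSpace.toDual ℝ E3).symm.continuous.comp (hρ.contDiff.continuous_fderiv (by simp))
  have hev : ∀ᶠ y in 𝓝 x, IsLocalDefiningFunction Ω.carrier y ρ := by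
    filter_upwards [hg.continuousAt.eventually_ne hρ.gradient_ne_zero,
      hρ.mem_iff.eventually_nhds] with y h1 h2 using ⟨hρ.contDiff, h1, h2⟩
  have hc : ContinuousAt (fun y => ‖gradient ρ y‖⁻¹ • gradient ρ y) x :=
    (hg.norm.continuousAt.inv₀ (norm_ne_zero_iff.2 hρ.gradient_ne_zero)).smul hg.continuousAt
  refine hc.continuousWithinAt.congr_of_eventuallyEq ?_ (outwardNormal_eq hρ hx)
  filter_upwards [self_mem_nhdsWithin, nhdsWithin_le_nhds hev] with y hy h using
    outwardNormal_eq h hy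

theorem aestronglyMeasurable_normalDeriv {f : E3 → ℝ} (hf : ContDiff ℝ ∞ f) :
    AEStronglyMeasurable (normalDeriv Ω.carrier f) Ω.surface :=
  ContinuousOn.aestronglyMeasurable
    ((hf.continuous_fderiv (by simp)).continuousOn.clm_apply Ω.continuousOn_outwardNormal)
    isClosed_frontier.measurableSet

theorem integrable_mul_of_L2 (u : Ω.L 2) {η : E3 → ℝ} (hη : Continuous η)
    (hc : HasCompactSupport η) : Integrable (fun x => u x * η x) Ω.vol :=
  MemLp.integrable_mul (p := 2) (q := 2) (Lp.memLp u) (hη.memLp_of_hasCompactSupport hc)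

/-- The index set of the derivatives of order at most two: the function itself, the first
derivatives `∂ᵢ` and the second derivatives `∂ⱼ∂ᵢ`. -/
abbrev Jet : Type := Unit ⊕ Fin 3 ⊕ (Fin 3 × Fin 3)

/-- The product Hilbert space in which the function and its derivatives live. -/
noncomputable abbrev JetSpace : Type := PiLp 2 (fun _ : Jet => Ω.L 2)

theorem hasWeakPartial_add {i : Fin 3} {u u' g g' : Ω.L 2}
    (h : HasWeakPartial Ω.carrier i u g) (h' : HasWeakPartial Ω.carrier i u' g') :
    HasWeakPartial Ω.carrier i (u + u' : Ω.L 2) (g + g' : Ω.L 2) := by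
  intro η h1 h2 h3
  have hd : Continuous fun x => fderiv ℝ η x (EuclideanSpace.single i 1) :=
    (h1.continuous_fderiv (by simp)).clm_apply continuous_const
  have hdc : HasCompactSupport fun x => fderiv ℝ η x (EuclideanSpace.single i 1) :=
    h2.fderiv_apply ℝ _
  have e1 : (fun x => (u + u' : Ω.L 2) x * fderiv ℝ η x (EuclideanSpace.single i 1)) =ᵐ[Ω.vol]
      fun x => u x * fderiv ℝ η x (EuclideanSpace.single i 1) +
        u' x * fderiv ℝ η x (EuclideanSpace.single i 1) := by
    filter_upwards [Lp.coeFn_add u u'] with x hx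
    rw [hx, Pi.add_apply, add_mul]
  have e2 : (fun x => (g + g' : Ω.L 2) x * η x) =ᵐ[Ω.vol] fun x => g x * η x + g' x * η x := by
    filter_upwards [Lp.coeFn_add g g'] with x hx
    rw [hx, Pi.add_apply, add_mul]
  rw [integral_congr_ae e1, integral_congr_ae e2,
    integral_add (Ω.integrable_mul_of_L2 u hd hdc) (Ω.integrable_mul_of_L2 u' hd hdc),
    integral_add (Ω.integrable_mul_of_L2 g h1.continuous h2)
      (Ω.integrable_mul_of_L2 g' h1.continuous h2), h η h1 h2 h3, h' η h1 h2 h3]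
  ring

theorem hasWeakPartial_smul {i : Fin 3} {u g : Ω.L 2} (c : ℝ)
    (h : HasWeakPartial Ω.carrier i u g) :
    HasWeakPartial Ω.carrier i (c • u : Ω.L 2) (c • g : Ω.L 2) := by
  intro η h1 h2 h3
  have e1 : (fun x => (c • u : Ω.L 2) x * fderiv ℝ η x (EuclideanSpace.single i 1)) =ᵐ[Ω.vol]
      fun x => c * (u x * fderiv ℝ η x (EuclideanSpace.single i 1)) := by
    filter_upwards [Lp.coeFn_smul c u] with x hx
    rw [hx, Pi.smul_apply, smul_eq_mul, mul_assoc]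
  have e2 : (fun x => (c • g : Ω.L 2) x * η x) =ᵐ[Ω.vol] fun x => c * (g x * η x) := by
    filter_upwards [Lp.coeFn_smul c g] with x hx
    rw [hx, Pi.smul_apply, smul_eq_mul, mul_assoc]
  rw [integral_congr_ae e1, integral_congr_ae e2, integral_const_mul, integral_const_mul,
    h η h1 h2 h3]
  ring

theorem hasWeakPartial_zero (i : Fin 3) :
    HasWeakPartial Ω.carrier i (0 : Ω.L 2) (0 : Ω.L 2) := by
  simpa using Ω.hasWeakPartial_smul (i := i) (u := 0) (g := 0) 0 (by
    intro η _ _ _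
    have e : ∀ ζ : E3 → ℝ, ∫ x in Ω.carrier, (0 : Ω.L 2) x * ζ x = 0 := by
      intro ζ
      refine integral_eq_zero_of_ae ?_
      filter_upwards [Lp.coeFn_zero ℝ 2 Ω.vol] with x hx
      simp only [hx, Pi.zero_apply, zero_mul]
    rw [e, e, neg_zero])

/-! ### The Sobolev space `H²(Ω)` -/

/-- The Sobolev space `H²(Ω)`: an element is a function `u ∈ L²(Ω)` together with its (unique)
weak derivatives `∂ᵢu` and `∂ⱼ∂ᵢu`, all in `L²(Ω)`. The norm inherited from the product is the
usual one, `‖u‖² = ‖u‖₂² + ∑ᵢ ‖∂ᵢu‖₂² + ∑ᵢⱼ ‖∂ⱼ∂ᵢu‖₂²`. -/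
def H2 : Submodule ℝ Ω.JetSpace where
  carrier := {u | (∀ i, HasWeakPartial Ω.carrier i (u (.inl ())) (u (.inr (.inl i)))) ∧
    ∀ i j, HasWeakPartial Ω.carrier j (u (.inr (.inl i))) (u (.inr (.inr (i, j))))}
  add_mem' ha hb := ⟨fun i => Ω.hasWeakPartial_add (ha.1 i) (hb.1 i),
    fun i j => Ω.hasWeakPartial_add (ha.2 i j) (hb.2 i j)⟩
  zero_mem' := ⟨fun i => Ω.hasWeakPartial_zero i, fun _ j => Ω.hasWeakPartial_zero j⟩
  smul_mem' c _ ha := ⟨fun i => Ω.hasWeakPartial_smul c (ha.1 i),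
    fun i j => Ω.hasWeakPartial_smul c (ha.2 i j)⟩

/-- The function underlying an element of `H²(Ω)`. -/
def fn (u : Ω.H2) : Ω.L 2 := u.1 (.inl ())

/-- The weak partial derivative `∂ᵢu`. -/
def pd (u : Ω.H2) (i : Fin 3) : Ω.L 2 := u.1 (.inr (.inl i))

/-- The weak second partial derivative `∂ⱼ∂ᵢu`. -/
def pdd (u : Ω.H2) (i j : Fin 3) : Ω.L 2 := u.1 (.inr (.inr (i, j)))

/-- The weak Laplacian `Δu`. -/
noncomputable def lap (u : Ω.H2) : Ω.L 2 := ∑ i, Ω.pdd u i i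

/-- `g` is the normal trace `γ₁ u` of `u ∈ H²(Ω)` in `L²(∂Ω)`: the trace operator `γ₁` is the
continuous extension to `H²(Ω)` of `ξ ↦ ∂ξ/∂n`, defined on functions smooth up to the boundary. -/
def HasNormalTrace (u : Ω.H2) (g : E3 → ℝ) : Prop :=
  ∃ (ξ : ℕ → E3 → ℝ) (f : ℕ → Ω.H2), (∀ k, ContDiff ℝ ∞ (ξ k)) ∧
    (∀ k, (Ω.fn (f k)) =ᵐ[Ω.vol] ξ k) ∧ Tendsto f atTop (𝓝 u) ∧
    Tendsto (fun k => eLpNorm (fun x => normalDeriv Ω.carrier (ξ k) x - g x) 2 Ω.surface)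
      atTop (𝓝 0)

/-- The space `V` of the functions `ξ ∈ H²(Ω)` with `∂ξ/∂n = 0` on `∂Ω`. -/
def V : Submodule ℝ Ω.H2 where
  carrier := {u | Ω.HasNormalTrace u 0}
  add_mem' := by
    rintro u v ⟨ξ, f, h1, h2, h3, h4⟩ ⟨ζ, g, k1, k2, k3, k4⟩
    refine ⟨fun k => ξ k + ζ k, fun k => f k + g k, fun k => (h1 k).add (k1 k), fun k => ?_,
      h3.add k3, ?_⟩
    · filter_upwards [h2 k, k2 k, Lp.coeFn_add (Ω.fn (f k)) (Ω.fn (g k))] with x a b c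
      have : (Ω.fn (f k + g k)) = (Ω.fn (f k)) + (Ω.fn (g k)) := rfl
      rw [this, c, Pi.add_apply, Pi.add_apply, a, b]
    · simp only [Pi.zero_apply, sub_zero] at h4 k4 ⊢
      refine tendsto_of_tendsto_of_tendsto_of_le_of_le tendsto_const_nhds
        (by simpa using h4.add k4) (fun _ => zero_le) fun k => ?_
      have e : (fun x => normalDeriv Ω.carrier (ξ k + ζ k) x) =
          normalDeriv Ω.carrier (ξ k) + normalDeriv Ω.carrier (ζ k) := by
        funext x
        simp only [normalDeriv, Pi.add_apply]
        rw [fderiv_add ((h1 k).differentiable (by simp) x) ((k1 k).differentiable (by simp) x)]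
        rfl
      rw [e]
      exact eLpNorm_add_le (Ω.aestronglyMeasurable_normalDeriv (h1 k))
        (Ω.aestronglyMeasurable_normalDeriv (k1 k)) (by norm_num)
  zero_mem' := by
    refine ⟨fun _ _ => 0, fun _ => 0, fun _ => contDiff_const, fun _ => ?_, tendsto_const_nhds, ?_⟩
    · exact Lp.coeFn_zero ℝ 2 Ω.vol
    · have e : (fun x => normalDeriv Ω.carrier (fun _ : E3 => (0 : ℝ)) x - (0 : E3 → ℝ) x) = 0 := by
        funext x
        simp [normalDeriv]
      simp only [e, eLpNorm_zero]
      exact tendsto_const_nhds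
  smul_mem' := by
    rintro c u ⟨ξ, f, h1, h2, h3, h4⟩
    refine ⟨fun k => c • ξ k, fun k => c • f k, fun k => (h1 k).const_smul c, fun k => ?_,
      h3.const_smul c, ?_⟩
    · filter_upwards [h2 k, Lp.coeFn_smul c (Ω.fn (f k))] with x a b
      have : (Ω.fn (c • f k)) = c • (Ω.fn (f k)) := rfl
      rw [this, b, Pi.smul_apply, Pi.smul_apply, a]
    · simp only [Pi.zero_apply, sub_zero] at h4 ⊢
      have e : ∀ k, (fun x => normalDeriv Ω.carrier (c • ξ k) x) =
          c • fun x => normalDeriv Ω.carrier (ξ k) x := by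
        intro k
        funext x
        simp only [normalDeriv, Pi.smul_apply]
        rw [fderiv_const_smul ((h1 k).differentiable (by simp) x)]
        rfl
      simp only [e, eLpNorm_const_smul]
      simpa using ENNReal.Tendsto.const_mul h4 (Or.inr (enorm_ne_top (x := c)))

/-- The space `Ṽ` of the functions in `V` with zero average over `Ω`. -/
noncomputable def Vtilde : Submodule ℝ Ω.H2 where
  carrier := {u | u ∈ Ω.V ∧ ⨍ x in Ω.carrier, Ω.fn u x = 0}
  add_mem' := by
    rintro u v ⟨h1, h2⟩ ⟨k1, k2⟩
    refine ⟨Ω.V.add_mem h1 k1, ?_⟩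
    have e : ((Ω.fn (u + v)) : E3 → ℝ) =ᵐ[Ω.vol] fun x => Ω.fn u x + Ω.fn v x :=
      Lp.coeFn_add (Ω.fn u) (Ω.fn v)
    have hu : Integrable (Ω.fn u) Ω.vol := (Lp.memLp (Ω.fn u)).integrable (by norm_num)
    have hv : Integrable (Ω.fn v) Ω.vol := (Lp.memLp (Ω.fn v)).integrable (by norm_num)
    rw [average_eq] at h2 k2 ⊢
    rw [integral_congr_ae e, integral_add hu hv, smul_add, h2, k2, add_zero]
  zero_mem' := by
    refine ⟨Ω.V.zero_mem, ?_⟩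
    have e : ((Ω.fn (0 : Ω.H2)) : E3 → ℝ) =ᵐ[Ω.vol] 0 := Lp.coeFn_zero ℝ 2 Ω.vol
    rw [average_eq, integral_congr_ae e]
    simp
  smul_mem' := by
    rintro c u ⟨h1, h2⟩
    refine ⟨Ω.V.smul_mem c h1, ?_⟩
    have e : ((Ω.fn (c • u)) : E3 → ℝ) =ᵐ[Ω.vol] fun x => c • Ω.fn u x := Lp.coeFn_smul c (Ω.fn u)
    rw [average_eq] at h2 ⊢
    rw [integral_congr_ae e, integral_smul, smul_comm, h2, smul_zero]

/-- The bilinear form `b(φ, v) = ∫_Ω Δφ Δv dx + ∫_Ω ∇φ · ∇v dx`. -/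
noncomputable def form (φ v : Ω.H2) : ℝ :=
  (∫ x in Ω.carrier, Ω.lap φ x * Ω.lap v x) + ∫ x in Ω.carrier, ∑ i, Ω.pd φ i x * Ω.pd v i x

/-- `φ ∈ Ṽ` is a weak solution of `Δ²φ - Δφ - w + w̄ = 0` in `Ω`, `∂φ/∂n = ∂Δφ/∂n = 0` on `∂Ω`,
`∫_Ω φ dx = 0`: for all `v ∈ Ṽ` the integral of `w v` exists and
`∫ Δφ Δv + ∫ ∇φ · ∇v - ∫ w v = 0`. -/
def IsWeakSolution (w : Ω.L (6 / 5)) (φ : Ω.Vtilde) : Prop :=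
  ∀ v : Ω.Vtilde, IntegrableOn (fun x => w x * Ω.fn v x) Ω.carrier ∧
    Ω.form φ v - ∫ x in Ω.carrier, w x * Ω.fn v x = 0

end SmoothBoundedDomain

/-! The weak problem is solved by the Lax–Milgram theorem on the Hilbert space `Ω.Vtilde`.
Coercivity (`exists_norm_sq_le_form`) is the sum of the Poincaré inequality for functions of mean
zero (`exists_norm_sq_fn_le`) and the second order Neumann estimate `‖D²u‖² ≤ C (‖Δu‖² + ‖∇u‖²)`
(`exists_sum_norm_sq_pdd_le`). The load `v ↦ ∫ w v` is bounded because `6/5` and `6` are conjugate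
exponents and `H¹ ⊂ L⁶` in dimension three (`exists_eLpNorm_fn_le`). Uniqueness and the bound on the
solution follow from coercivity, linearity from uniqueness. Test functions in `V` are reduced to
mean zero ones by subtracting a constant, which the form does not see.

Elements of `V` are `H²` limits of smooth functions `ξ_k` whose normal derivatives tend to zero in
`L²(∂Ω)`. All inequalities are therefore proved for smooth functions and passed to the limit; only
the second order estimate uses the boundary condition.

For that estimate, `|D²ξ|² - (Δξ)²` is a divergence. Let `N` extend the unit normal smoothly and let
`h` be the derivative of `ξ` along `N`. Correcting the field by terms linear in `h` or its
derivatives, and by a form quadratic in `∇ξ` times `N`, makes it tangent to the boundary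
(`tangent_identity`), so its divergence has integral zero. This gives `hessSq_eq`: `‖D²ξ‖² = ‖Δξ‖² +
2b - q`. The term `q` is at most `C ‖∇ξ‖ (‖∇ξ‖² + ‖D²ξ‖²)^{1/2}` and is absorbed by Young's
inequality. The term `b` is the flux of `h` times a field made of derivatives of `ξ`. With that
field frozen at some `ξ_M` the flux tends to zero with `h`; the Cauchy property in `H²` pays for the
freezing (`tendsto_boundaryForm_self`).

The Gauss–Green formula with a surface integral is never needed. Two weaker facts suffice:
divergences of tangent fields integrate to zero (`integral_divergence_eq_zero_of_tangent`), and `|∫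
∂_j (a h)| ≤ K ‖h‖_{L²(∂Ω)}` (`exists_integral_dcoord_mul_le`). The second is obtained by slicing
along a coordinate transversal to the boundary; projecting the boundary along that coordinate is
1-Lipschitz and so does not increase its area.

The Sobolev inequality is Gagliardo's argument run along half-lines pointing into the domain, so
that no extension operator is used. The Poincaré inequality starts from one ball and is propagated
by translations, using connectedness inside and compactness up to the boundary. -/

/-- The partial derivative of a function in the coordinate direction `i`. -/
noncomputable def dcoord (i : Fin 3) (f : E3 → ℝ) (x : E3) : ℝ :=
  fderiv ℝ f x (EuclideanSpace.single i 1)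

/-! ### Calculus of coordinate derivatives. -/

section dcoord

variable {f g : E3 → ℝ} {i j : Fin 3}

theorem smooth_differentiable (hf : ContDiff ℝ ∞ f) : Differentiable ℝ f :=
  hf.differentiable (by simp)

theorem ContDiff.dcoord (hf : ContDiff ℝ ∞ f) (i : Fin 3) : ContDiff ℝ ∞ (dcoord i f) :=
  (hf.fderiv_right (m := ∞) (by simp)).clm_apply contDiff_const

theorem HasCompactSupport.dcoord (hf : HasCompactSupport f) (i : Fin 3) :
    HasCompactSupport (dcoord i f) := hf.fderiv_apply ℝ _

theorem dcoord_add (hf : ContDiff ℝ ∞ f) (hg : ContDiff ℝ ∞ g) (x : E3) :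
    dcoord i (fun y => f y + g y) x = dcoord i f x + dcoord i g x := by
  simp only [dcoord]
  rw [fderiv_fun_add (smooth_differentiable hf x) (smooth_differentiable hg x)]; rfl

theorem dcoord_sub (hf : ContDiff ℝ ∞ f) (hg : ContDiff ℝ ∞ g) (x : E3) :
    dcoord i (fun y => f y - g y) x = dcoord i f x - dcoord i g x := by
  simp only [dcoord]
  rw [fderiv_fun_sub (smooth_differentiable hf x) (smooth_differentiable hg x)]; rfl

theorem dcoord_neg (x : E3) : dcoord i (fun y => - f y) x = - dcoord i f x := by
  simp only [dcoord]
  rw [fderiv_fun_neg]; rfl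

theorem dcoord_mul (hf : ContDiff ℝ ∞ f) (hg : ContDiff ℝ ∞ g) (x : E3) :
    dcoord i (fun y => f y * g y) x = dcoord i f x * g x + f x * dcoord i g x := by
  simp only [dcoord]
  rw [fderiv_fun_mul (smooth_differentiable hf x) (smooth_differentiable hg x)]
  simp; ring

theorem dcoord_const (c : ℝ) (x : E3) : dcoord i (fun _ => c) x = 0 := by
  simp [dcoord]

theorem dcoord_sum {ι : Type*} (s : Finset ι) {f : ι → E3 → ℝ} (hf : ∀ a, ContDiff ℝ ∞ (f a))
    (x : E3) : dcoord i (fun y => ∑ a ∈ s, f a y) x = ∑ a ∈ s, dcoord i (f a) x := by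
  simp only [dcoord]
  rw [fderiv_fun_sum (fun a _ => smooth_differentiable (hf a) x)]
  simp

theorem dcoord_comm (hf : ContDiff ℝ ∞ f) (x : E3) :
    dcoord i (dcoord j f) x = dcoord j (dcoord i f) x := by
  have h1 : ContDiffAt ℝ 2 f x := (hf.of_le (by norm_cast)).contDiffAt
  have hs := h1.isSymmSndFDerivAt (by simp)
  have hd : DifferentiableAt ℝ (fderiv ℝ f) x :=
    (hf.fderiv_right (m := ∞) (by simp)).differentiable (by simp) x
  have e : ∀ i j : Fin 3, dcoord i (dcoord j f) x =
      fderiv ℝ (fderiv ℝ f) x (EuclideanSpace.single i 1) (EuclideanSpace.single j 1) := by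
    intro i j
    unfold dcoord
    rw [fderiv_clm_apply hd (differentiableAt_const _)]
    simp
  rw [e, e]
  exact hs _ _

theorem fderiv_apply_eq_sum_dcoord (f : E3 → ℝ) (x v : E3) :
    fderiv ℝ f x v = ∑ i, v i * dcoord i f x := by
  have hv : v = ∑ i, v i • (EuclideanSpace.single i (1 : ℝ) : E3) := by
    ext j
    simp [Fin.sum_univ_three]
    fin_cases j <;> simp
  conv_lhs => rw [hv]
  simp [dcoord]

theorem gradient_apply (f : E3 → ℝ) (x : E3) (i : Fin 3) : gradient f x i = dcoord i f x := by
  have : inner ℝ (gradient f x) (EuclideanSpace.single i (1 : ℝ) : E3) = dcoord i f x := by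
    rw [gradient, InnerProductSpace.toDual_symm_apply]; rfl
  rw [← this, EuclideanSpace.inner_single_right]
  simp

/-- Integration by parts against the constant function one. -/
theorem integral_dcoord_eq_zero (hf : ContDiff ℝ ∞ f) (hc : HasCompactSupport f) :
    ∫ x, dcoord i f x = 0 := by
  have h := integral_mul_fderiv_eq_neg_fderiv_mul_of_integrable (𝕜 := ℝ) (μ := volume)
    (f := fun _ : E3 => (1 : ℝ)) (g := f) (v := (EuclideanSpace.single i (1 : ℝ) : E3))
    (by simp) ?_ ?_ (by fun_prop) (fun x _ => smooth_differentiable hf x)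
  · simpa [dcoord] using h
  · simp only [one_mul]
    exact (hf.dcoord i).continuous.integrable_of_hasCompactSupport (hc.dcoord i)
  · simp only [one_mul]
    exact hf.continuous.integrable_of_hasCompactSupport hc

end dcoord

/-! ### A global defining function. -/

namespace SmoothBoundedDomain

variable (Ω : SmoothBoundedDomain)

theorem isCompact_closure : IsCompact (closure Ω.carrier) := Ω.isBounded.isCompact_closure

theorem isCompact_frontier : IsCompact (frontier Ω.carrier) :=
  Ω.isCompact_closure.of_isClosed_subset isClosed_frontier frontier_subset_closure

theorem exists_bound {f : E3 → ℝ} (hf : Continuous f) :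
    ∃ C, 0 ≤ C ∧ ∀ x ∈ closure Ω.carrier, |f x| ≤ C := by
  obtain ⟨C, hC⟩ := Ω.isCompact_closure.exists_bound_of_continuousOn hf.continuousOn
  exact ⟨max C 0, le_max_right _ _, fun x hx => (hC x hx).trans (le_max_left _ _)⟩

theorem memLp_of_continuous {f : E3 → ℝ} (hf : Continuous f) (p : ℝ≥0∞) : MemLp f p Ω.vol := by
  obtain ⟨C, _, hC⟩ := Ω.exists_bound hf
  refine MemLp.of_bound hf.aestronglyMeasurable C ?_
  filter_upwards [ae_restrict_mem Ω.isOpen.measurableSet] with x hx using hC x (subset_closure hx)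

theorem integrable_of_continuous {f : E3 → ℝ} (hf : Continuous f) : Integrable f Ω.vol :=
  memLp_one_iff_integrable.1 (Ω.memLp_of_continuous hf 1)

theorem notMem_of_mem_frontier {x : E3} (hx : x ∈ frontier Ω.carrier) : x ∉ Ω.carrier := by
  rw [Ω.isOpen.frontier_eq] at hx
  exact hx.2

/-- A defining function valid on the whole space. -/
structure IsGlobalDefiningFunction (ρ : E3 → ℝ) : Prop where
  contDiff : ContDiff ℝ ∞ ρ
  mem_iff : ∀ y, y ∈ Ω.carrier ↔ ρ y < 0
  gradient_ne_zero : ∀ y ∈ frontier Ω.carrier, gradient ρ y ≠ 0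

theorem IsGlobalDefiningFunction.isLocal {Ω : SmoothBoundedDomain} {ρ : E3 → ℝ}
    (h : Ω.IsGlobalDefiningFunction ρ) {x : E3} (hx : x ∈ frontier Ω.carrier) :
    IsLocalDefiningFunction Ω.carrier x ρ :=
  ⟨h.contDiff, h.gradient_ne_zero x hx, Eventually.of_forall h.mem_iff⟩

/-- Local defining functions are glued with bumps `b x`, without normalizing the weights, and a
function `β ≥ 0` with support exactly `Ω` is subtracted. The glued sum already has the correct weak
sign; `β` makes it strict on `Ω`, also where no bump is active. The gradient survives on the
frontier because all local gradients there are positive multiples of the same outward normal, so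
they cannot cancel. -/
theorem exists_isGlobalDefiningFunction : ∃ ρ, Ω.IsGlobalDefiningFunction ρ := by
  classical
  have H : ∀ x ∈ frontier Ω.carrier, ∃ (ρ : E3 → ℝ) (b : E3 → ℝ), ContDiff ℝ ∞ ρ ∧
      ContDiff ℝ ∞ b ∧ (∀ y, 0 ≤ b y) ∧ (∀ᶠ y in 𝓝 x, 0 < b y) ∧
      ∀ y, 0 < b y → (y ∈ Ω.carrier ↔ ρ y < 0) ∧
        (y ∈ frontier Ω.carrier → IsLocalDefiningFunction Ω.carrier y ρ) := by
    intro x hx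
    obtain ⟨ρ, hρ⟩ := Ω.smooth_boundary x hx
    have hg : Continuous (gradient ρ) :=
      (InnerProductSpace.toDual ℝ E3).symm.continuous.comp
        (hρ.contDiff.continuous_fderiv (by simp))
    have hev : ∀ᶠ y in 𝓝 x, (y ∈ Ω.carrier ↔ ρ y < 0) ∧
        IsLocalDefiningFunction Ω.carrier y ρ := by
      filter_upwards [hg.continuousAt.eventually_ne hρ.gradient_ne_zero,
        hρ.mem_iff.eventually_nhds] with y h1 h2 using ⟨h2.self_of_nhds, hρ.contDiff, h1, h2⟩
    obtain ⟨r, hr, hb⟩ := Metric.eventually_nhds_iff_ball.1 hev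
    let b : ContDiffBump x := ⟨r / 2, r, by positivity, by linarith⟩
    refine ⟨ρ, b, hρ.contDiff, b.contDiff, fun y => b.nonneg, ?_, fun y hy => ?_⟩
    · filter_upwards [Metric.ball_mem_nhds x hr] with y hy using b.pos_of_mem_ball hy
    · have : y ∈ Metric.ball x r := by
        have : y ∈ Function.support b := hy.ne'
        rwa [b.support_eq] at this
      exact ⟨(hb y this).1, fun _ => (hb y this).2⟩
  choose! ρ b hρ hb hb0 hbx hby using H
  obtain ⟨t, ht, htc⟩ := Ω.isCompact_frontier.elim_nhds_subcover (fun x => {y | 0 < b x y})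
    (fun x hx => hbx x hx)
  obtain ⟨β, hβs, hβ, hβ01⟩ := Ω.isOpen.exists_contDiff_support_eq (n := ⊤)
  have hβ0 : ∀ y, 0 ≤ β y := fun y => (hβ01 (Set.mem_range_self y)).1
  have hβpos : ∀ y, y ∈ Ω.carrier ↔ 0 < β y := by
    intro y
    rw [← hβs, Function.mem_support]
    exact ⟨fun h => lt_of_le_of_ne (hβ0 y) h.symm, fun h => h.ne'⟩
  have hsm : ∀ x ∈ t, ContDiff ℝ ∞ (fun y => b x y * ρ x y) :=
    fun x hx => (hb x (ht x hx)).mul (hρ x (ht x hx))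
  refine ⟨fun y => ∑ x ∈ t, b x y * ρ x y - β y, ?_, ?_, ?_⟩
  · exact (ContDiff.sum hsm).sub hβ
  · intro y
    constructor
    · intro hy
      have h1 : ∑ x ∈ t, b x y * ρ x y ≤ 0 := by
        refine Finset.sum_nonpos fun x hx => ?_
        rcases (hb0 x (ht x hx) y).eq_or_lt with h | h
        · rw [← h, zero_mul]
        · exact mul_nonpos_of_nonneg_of_nonpos h.le (((hby x (ht x hx) y h).1.1 hy).le)
      have := (hβpos y).1 hy
      linarith
    · intro h
      by_contra hy
      have h1 : 0 ≤ ∑ x ∈ t, b x y * ρ x y := by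
        refine Finset.sum_nonneg fun x hx => ?_
        rcases (hb0 x (ht x hx) y).eq_or_lt with h | h
        · rw [← h, zero_mul]
        · exact mul_nonneg h.le (not_lt.1 fun h' => hy ((hby x (ht x hx) y h).1.2 h'))
      have h2 : β y = 0 := by
        by_contra h2
        exact hy ((hβpos y).2 (lt_of_le_of_ne (hβ0 y) (Ne.symm h2)))
      rw [h2] at h
      linarith
  · intro y hy
    have hyΩ := Ω.notMem_of_mem_frontier hy
    have hβy : β y = 0 := by
      by_contra h2
      exact hyΩ ((hβpos y).2 (lt_of_le_of_ne (hβ0 y) (Ne.symm h2)))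
    -- The point `y` is a minimum of `β`, so the subtracted function does not affect the gradient.
    have dβ : fderiv ℝ β y = 0 := by
      refine IsLocalMin.fderiv_eq_zero (Eventually.of_forall fun z => ?_)
      rw [hβy]; exact hβ0 z
    set n := outwardNormal Ω.carrier y with hn
    -- Each term has normal derivative `b x y * ‖∇ρ_x‖ ≥ 0`: the derivative of the bump drops out,
    -- since either the bump has a minimum at `y` or its factor `ρ x` vanishes there.
    have key : ∀ x ∈ t, fderiv ℝ (fun y => b x y * ρ x y) y n = b x y * ‖gradient (ρ x) y‖ ∧
        (0 < b x y → 0 < ‖gradient (ρ x) y‖) := by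
      intro x hx
      have hx' := ht x hx
      have d1 := (smooth_differentiable (hb x hx')) y
      have d2 := (smooth_differentiable (hρ x hx')) y
      rw [fderiv_fun_mul d1 d2]
      rcases (hb0 x hx' y).eq_or_lt with h | h
      · have : fderiv ℝ (b x) y = 0 := by
          refine IsLocalMin.fderiv_eq_zero (Eventually.of_forall fun z => ?_)
          rw [← h]; exact hb0 x hx' z
        simp [this, ← h]
      · have hl := (hby x hx' y h).2 hy
        have hpos : 0 < ‖gradient (ρ x) y‖ := norm_pos_iff.2 hl.gradient_ne_zero
        have e : fderiv ℝ (ρ x) y n = ‖gradient (ρ x) y‖ := by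
          have : fderiv ℝ (ρ x) y n = inner ℝ (gradient (ρ x) y) n := by
            rw [gradient, InnerProductSpace.toDual_symm_apply]
          rw [this, hn, outwardNormal_eq hl hy, real_inner_smul_right, real_inner_self_eq_norm_sq]
          field_simp
        simp [hl.eq_zero hy, e, hpos]
    intro hzero
    have hd : fderiv ℝ (fun y => ∑ x ∈ t, b x y * ρ x y - β y) y = 0 := by
      have := congrArg (InnerProductSpace.toDual ℝ E3) hzero
      simpa [gradient] using this
    rw [fderiv_fun_sub ((smooth_differentiable (ContDiff.sum hsm)) y)
      ((smooth_differentiable hβ) y), dβ, sub_zero,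
      fderiv_fun_sum fun x hx => (smooth_differentiable (hsm x hx)) y] at hd
    have hs := congrArg (fun l : E3 →L[ℝ] ℝ => l n) hd
    simp only [FunLike.coe_sum, Finset.sum_apply, zero_apply] at hs
    rw [Finset.sum_congr rfl fun x hx => (key x hx).1] at hs
    have h0 := (Finset.sum_eq_zero_iff_of_nonneg fun x hx =>
      mul_nonneg (hb0 x (ht x hx) y) (norm_nonneg _)).1 hs
    obtain ⟨x, hx, hxy⟩ := Set.mem_iUnion₂.1 (htc hy)
    have hxy' : 0 < b x y := hxy
    exact absurd (h0 x hx) (mul_pos hxy' ((key x hx).2 hxy')).ne'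

end SmoothBoundedDomain

/-! ### Extension of the normal, and the divergence theorem for tangent fields. -/

theorem deriv_smoothTransition_of_notMem {s : ℝ} (hs : s ∉ Set.Icc (0 : ℝ) 1) :
    deriv Real.smoothTransition s = 0 := by
  rcases not_and_or.1 hs with h | h
  · have : Real.smoothTransition =ᶠ[𝓝 s] fun _ => (0 : ℝ) := by
      filter_upwards [gt_mem_nhds (not_le.1 h)] with t ht
        using Real.smoothTransition.zero_of_nonpos (le_of_lt ht)
    rw [this.deriv_eq, deriv_const]
  · have : Real.smoothTransition =ᶠ[𝓝 s] fun _ => (1 : ℝ) := by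
      filter_upwards [lt_mem_nhds (not_le.1 h)] with t ht
        using Real.smoothTransition.one_of_one_le (le_of_lt ht)
    rw [this.deriv_eq, deriv_const]

theorem exists_bound_deriv_smoothTransition : ∃ M, 0 ≤ M ∧ ∀ s,
    |deriv Real.smoothTransition s| ≤ M := by
  have hc : Continuous (deriv Real.smoothTransition) :=
    (Real.smoothTransition.contDiff (n := 1)).continuous_deriv (by simp)
  obtain ⟨M, hM⟩ := (isCompact_Icc (a := (0 : ℝ)) (b := 1)).exists_bound_of_continuousOn
    hc.continuousOn
  refine ⟨max M 0, le_max_right _ _, fun s => ?_⟩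
  by_cases hs : s ∈ Set.Icc (0 : ℝ) 1
  · exact (hM s hs).trans (le_max_left _ _)
  · rw [deriv_smoothTransition_of_notMem hs]; simp

namespace SmoothBoundedDomain

variable {Ω : SmoothBoundedDomain}

theorem IsGlobalDefiningFunction.eq_zero {ρ : E3 → ℝ}
    (h : Ω.IsGlobalDefiningFunction ρ) {x : E3} (hx : x ∈ frontier Ω.carrier) : ρ x = 0 :=
  (h.isLocal hx).eq_zero hx

theorem IsGlobalDefiningFunction.outwardNormal_apply {ρ : E3 → ℝ}
    (h : Ω.IsGlobalDefiningFunction ρ) {x : E3} (hx : x ∈ frontier Ω.carrier) (i : Fin 3) :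
    outwardNormal Ω.carrier x i = ‖gradient ρ x‖⁻¹ * dcoord i ρ x := by
  rw [outwardNormal_eq (h.isLocal hx) hx, ← gradient_apply]; rfl

/-- There is a smooth vector field extending the outward unit normal. -/
theorem exists_normal_field (Ω : SmoothBoundedDomain) : ∃ N : Fin 3 → E3 → ℝ,
    (∀ i, ContDiff ℝ ∞ (N i)) ∧
    ∀ x ∈ frontier Ω.carrier, ∀ i, N i x = outwardNormal Ω.carrier x i := by
  obtain ⟨ρ, hρ⟩ := Ω.exists_isGlobalDefiningFunction
  set s : E3 → ℝ := fun x => ∑ i, dcoord i ρ x ^ 2 with hs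
  have hsm : ContDiff ℝ ∞ s := ContDiff.sum fun i _ => (hρ.contDiff.dcoord i).pow 2
  have hsn : ∀ x, s x = ‖gradient ρ x‖ ^ 2 := by
    intro x
    rw [EuclideanSpace.norm_sq_eq]
    exact Finset.sum_congr rfl fun i _ => by rw [gradient_apply, Real.norm_eq_abs, sq_abs]
  have hpos : ∀ x ∈ frontier Ω.carrier, 0 < s x := by
    intro x hx
    rw [hsn]
    have := norm_pos_iff.2 (hρ.gradient_ne_zero x hx)
    positivity
  obtain ⟨c, hc, hcs⟩ : ∃ c, 0 < c ∧ ∀ x ∈ frontier Ω.carrier, c ≤ s x := by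
    rcases (frontier Ω.carrier).eq_empty_or_nonempty with h | h
    · exact ⟨1, one_pos, by simp [h]⟩
    · obtain ⟨x, hx, hm⟩ := Ω.isCompact_frontier.exists_isMinOn h hsm.continuous.continuousOn
      exact ⟨s x, hpos x hx, fun y hy => hm hy⟩
  -- This equals `1 / ‖∇ρ‖` where `s ≥ c`, in particular on the frontier, and vanishes where `s ≤ c
  -- / 2`, so it is smooth even at critical points of `ρ`.
  set κ : E3 → ℝ := fun x => Real.smoothTransition (2 * s x / c - 1) / √(s x) with hκ
  have hκsm : ContDiff ℝ ∞ κ := by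
    rw [contDiff_iff_contDiffAt]
    intro x
    by_cases hx : 0 < s x
    · refine ContDiffAt.div ?_ (ContDiffAt.sqrt hsm.contDiffAt hx.ne') (Real.sqrt_pos.2 hx).ne'
      exact (Real.smoothTransition.contDiff.comp
        (((contDiff_const.mul hsm).div_const c).sub contDiff_const)).contDiffAt
    · have : κ =ᶠ[𝓝 x] fun _ => 0 := by
        filter_upwards [hsm.continuous.continuousAt.eventually
          (gt_mem_nhds (show s x < c / 2 by linarith))] with y hy
        rw [hκ]
        simp only
        rw [Real.smoothTransition.zero_of_nonpos, zero_div]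
        have : 2 * s y / c ≤ 1 := by
          rw [div_le_one hc]; linarith
        linarith
      exact contDiffAt_const.congr_of_eventuallyEq this
  refine ⟨fun i x => κ x * dcoord i ρ x, fun i => hκsm.mul (hρ.contDiff.dcoord i), ?_⟩
  intro x hx i
  rw [hρ.outwardNormal_apply hx]
  rw [hκ]
  simp only
  rw [Real.smoothTransition.one_of_one_le, hsn, Real.sqrt_sq (norm_nonneg _), one_div]
  have := hcs x hx
  rw [le_sub_iff_add_le, le_div_iff₀ hc]
  linarith

/-- From a point `p` of `Ω` near the boundary one moves in the direction of a fixed nearby boundary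
gradient, along which `ρ` grows at rate at least `c`. After time at most `-ρ p / c` the path has met
the frontier, where `f` vanishes, and `f` is Lipschitz. Away from the frontier `-ρ` is bounded
below; compactness of the closure joins the local bounds. -/
theorem IsGlobalDefiningFunction.abs_le_mul_of_eq_zero {ρ f : E3 → ℝ}
    (h : Ω.IsGlobalDefiningFunction ρ) (hf : ContDiff ℝ ∞ f)
    (hf0 : ∀ x ∈ frontier Ω.carrier, f x = 0) :
    ∃ C, 0 ≤ C ∧ ∀ x ∈ Ω.carrier, |f x| ≤ C * (-ρ x) := by
  have hρc := h.contDiff.continuous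
  suffices H : ∃ C, 0 ≤ C ∧ ∀ x ∈ closure Ω.carrier, x ∈ Ω.carrier → |f x| ≤ C * (-ρ x) by
    obtain ⟨C, h0, hC⟩ := H
    exact ⟨C, h0, fun x hx => hC x (subset_closure hx) hx⟩
  refine Ω.isCompact_closure.induction_on
    (p := fun s => ∃ C, 0 ≤ C ∧ ∀ x ∈ s, x ∈ Ω.carrier → |f x| ≤ C * (-ρ x)) ?_ ?_ ?_ ?_
  · exact ⟨0, le_rfl, by simp⟩
  · rintro s t hst ⟨C, h0, hC⟩
    exact ⟨C, h0, fun x hx => hC x (hst hx)⟩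
  · rintro s t ⟨C, h0, hC⟩ ⟨D, k0, hD⟩
    refine ⟨C + D, by positivity, ?_⟩
    rintro x (hx | hx) hxΩ
    all_goals have := (h.mem_iff x).1 hxΩ
    · have := hC x hx hxΩ
      nlinarith
    · have := hD x hx hxΩ
      nlinarith
  · intro x hx
    by_cases hxΩ : x ∈ Ω.carrier
    · have hneg := (h.mem_iff x).1 hxΩ
      refine ⟨_, mem_nhdsWithin_of_mem_nhds (((hf.continuous.abs.continuousAt.eventually
        (gt_mem_nhds (lt_add_one |f x|))).and (hρc.continuousAt.eventually
        (gt_mem_nhds (show ρ x < ρ x / 2 by linarith))))), (|f x| + 1) / (-ρ x / 2),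
        div_nonneg (by positivity) (by linarith), ?_⟩
      rintro y ⟨h1, h2⟩ -
      have : (|f x| + 1) / (-ρ x / 2) * (-ρ x / 2) ≤ (|f x| + 1) / (-ρ x / 2) * (-ρ y) :=
        mul_le_mul_of_nonneg_left (by linarith) (div_nonneg (by positivity) (by linarith))
      rw [div_mul_cancel₀ _ (by linarith)] at this
      linarith
    · have hxf : x ∈ frontier Ω.carrier := by
        rw [Ω.isOpen.frontier_eq]; exact ⟨hx, hxΩ⟩
      set v := gradient ρ x with hv
      have hv0 : 0 < ‖v‖ := norm_pos_iff.2 (h.gradient_ne_zero x hxf)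
      have e : fderiv ℝ ρ x v = ‖v‖ ^ 2 := by
        have : fderiv ℝ ρ x v = inner ℝ (gradient ρ x) v := by
          rw [gradient, InnerProductSpace.toDual_symm_apply]
        rw [this, ← hv, real_inner_self_eq_norm_sq]
      set c := ‖v‖ ^ 2 / 2 with hc
      have hc0 : 0 < c := by positivity
      have c1 : Continuous fun y => fderiv ℝ ρ y v :=
        (h.contDiff.continuous_fderiv (by simp)).clm_apply continuous_const
      have c2 : Continuous fun y => ‖fderiv ℝ f y‖ := (hf.continuous_fderiv (by simp)).norm
      set M := ‖fderiv ℝ f x‖ + 1 with hM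
      have hM0 : 0 < M := by positivity
      obtain ⟨R, hR, hB⟩ := Metric.eventually_nhds_iff_ball.1
        ((c1.continuousAt.eventually (lt_mem_nhds (show c < fderiv ℝ ρ x v by
          rw [e]; linarith))).and
          (c2.continuousAt.eventually (gt_mem_nhds (lt_add_one ‖fderiv ℝ f x‖))))
      have hρx : ρ x = 0 := h.eq_zero hxf
      -- Half the radius is reserved for `p`; the condition on `ρ p` makes the exit path shorter
      -- than the other half, so the derivative bounds hold along all of it.
      refine ⟨_, mem_nhdsWithin_of_mem_nhds ((eventually_mem_set.2 (Metric.ball_mem_nhds x (half_pos hR))).and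
        (hρc.continuousAt.eventually (lt_mem_nhds
          (show -(c * (R / (2 * ‖v‖))) < ρ x by rw [hρx]; simp; positivity)))),
        M * ‖v‖ / c, by positivity, ?_⟩
      rintro p ⟨hp, hpρ⟩ hpΩ
      have hpneg := (h.mem_iff p).1 hpΩ
      set T := -ρ p / c with hT
      have hT0 : 0 < T := div_pos (by linarith) hc0
      have hTR : T * ‖v‖ < R / 2 := by
        have : T < R / (2 * ‖v‖) := by
          rw [hT, div_lt_iff₀ hc0]; linarith
        calc T * ‖v‖ < R / (2 * ‖v‖) * ‖v‖ := by gcongr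
          _ = R / 2 := by field_simp
      have hseg : ∀ t ∈ Set.Icc 0 T, p + t • v ∈ Metric.ball x R := by
        intro t ht
        rw [Metric.mem_ball, dist_eq_norm]
        rw [Metric.mem_ball, dist_eq_norm] at hp
        calc ‖p + t • v - x‖ = ‖(p - x) + t • v‖ := by congr 1; abel
          _ ≤ ‖p - x‖ + ‖t • v‖ := norm_add_le _ _
          _ = ‖p - x‖ + t * ‖v‖ := by rw [norm_smul, Real.norm_eq_abs, abs_of_nonneg ht.1]
          _ ≤ ‖p - x‖ + T * ‖v‖ := by gcongr; exact ht.2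
          _ < R := by linarith
      have hder : ∀ t, HasDerivAt (fun t : ℝ => ρ (p + t • v)) (fderiv ℝ ρ (p + t • v) v) t := by
        intro t
        have hl : HasDerivAt (fun t : ℝ => p + t • v) v t := by
          simpa using ((hasDerivAt_id t).smul_const v).const_add p
        exact ((smooth_differentiable h.contDiff) _).hasFDerivAt.comp_hasDerivAt t hl
      have hend : p + T • v ∉ Ω.carrier := by
        rw [h.mem_iff, not_lt]
        have := (convex_Icc (0 : ℝ) T).mul_sub_le_image_sub_of_le_deriv
          (f := fun t : ℝ => ρ (p + t • v)) (C := c)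
          (fun t _ => (hder t).continuousAt.continuousWithinAt)
          (fun t _ => (hder t).differentiableAt.differentiableWithinAt) (fun t ht => by
            rw [(hder t).deriv]
            exact (hB _ (hseg t (interior_subset ht))).1.le)
          0 (by simp [hT0.le]) T (by simp [hT0.le]) hT0.le
        have hcT : c * T = -ρ p := by rw [hT]; field_simp
        simp only [zero_smul, add_zero, sub_zero] at this
        linarith
      have hpre : IsPreconnected ((fun t : ℝ => p + t • v) '' Set.Icc 0 T) :=
        isPreconnected_Icc.image _ (by fun_prop)
      -- A segment from `Ω` to its complement that avoids the frontier would be split by `Ω` and the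
      -- complement of its closure.
      obtain ⟨q, ⟨t, ht, rfl⟩, hq⟩ : (((fun t : ℝ => p + t • v) '' Set.Icc 0 T) ∩
          frontier Ω.carrier).Nonempty := by
        by_contra hne
        have hcl : ∀ y ∈ (fun t : ℝ => p + t • v) '' Set.Icc 0 T, y ∉ Ω.carrier →
            y ∉ closure Ω.carrier := fun y hy hyΩ hyc =>
          hne ⟨y, hy, by rw [Ω.isOpen.frontier_eq]; exact ⟨hyc, hyΩ⟩⟩
        have hp0 : p ∈ (fun t : ℝ => p + t • v) '' Set.Icc 0 T := ⟨0, ⟨le_rfl, hT0.le⟩, by simp⟩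
        have hpT : p + T • v ∈ (fun t : ℝ => p + t • v) '' Set.Icc 0 T :=
          ⟨T, ⟨hT0.le, le_rfl⟩, rfl⟩
        obtain ⟨z, -, hz1, hz2⟩ := hpre Ω.carrier (closure Ω.carrier)ᶜ Ω.isOpen
          isClosed_closure.isOpen_compl (fun y hy => (em (y ∈ Ω.carrier)).imp id (hcl y hy))
          ⟨p, hp0, hpΩ⟩ ⟨_, hpT, hcl _ hpT hend⟩
        exact hz2 (subset_closure hz1)
      have := (convex_ball x R).norm_image_sub_le_of_norm_fderiv_le (f := f) (𝕜 := ℝ) (C := M)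
        (fun y _ => smooth_differentiable hf y) (fun y hy => (hB y hy).2.le)
        (hseg t ht) (by simpa using hseg 0 ⟨le_rfl, hT0.le⟩)
      rw [hf0 _ hq, sub_zero, Real.norm_eq_abs] at this
      calc |f p| ≤ _ := this
        _ = M * (t * ‖v‖) := by
          rw [sub_add_cancel_left, norm_neg, norm_smul, Real.norm_eq_abs, abs_of_nonneg ht.1]
        _ ≤ M * (T * ‖v‖) := by gcongr; exact ht.2
        _ = M * ‖v‖ / c * (-ρ p) := by rw [hT]; ring

/-- The divergence theorem for a field tangent to the boundary. -/
theorem integral_divergence_eq_zero_of_tangent {G : Fin 3 → E3 → ℝ}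
    (hG : ∀ i, ContDiff ℝ ∞ (G i))
    (hGn : ∀ x ∈ frontier Ω.carrier, ∑ i, G i x * outwardNormal Ω.carrier x i = 0) :
    ∫ x in Ω.carrier, ∑ i, dcoord i (G i) x = 0 := by
  obtain ⟨ρ, hρ⟩ := Ω.exists_isGlobalDefiningFunction
  have hρc := hρ.contDiff.continuous
  have hf : ContDiff ℝ ∞ fun x => ∑ i, G i x * dcoord i ρ x :=
    ContDiff.sum fun i _ => (hG i).mul (hρ.contDiff.dcoord i)
  -- Tangency says that `G · ∇ρ` vanishes on the frontier, hence is `O(-ρ)` inside. This offsets the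
  -- growth of the gradient of the cutoffs below.
  obtain ⟨C, hC0, hC⟩ := hρ.abs_le_mul_of_eq_zero hf (fun x hx => by
    have h1 := hGn x hx
    simp only [hρ.outwardNormal_apply hx] at h1
    have hpos := norm_pos_iff.2 (hρ.gradient_ne_zero x hx)
    have h2 : ‖gradient ρ x‖⁻¹ * ∑ i, G i x * dcoord i ρ x = 0 := by
      rw [← h1, Finset.mul_sum]
      exact Finset.sum_congr rfl fun i _ => by ring
    exact (mul_eq_zero.1 h2).resolve_left (inv_ne_zero hpos.ne'))
  obtain ⟨M, hM0, hM⟩ := exists_bound_deriv_smoothTransition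
  set θ := Real.smoothTransition with hθ
  have hθsm : ContDiff ℝ ∞ θ := Real.smoothTransition.contDiff
  -- The cutoff `θ ∘ a n` vanishes where `-ρ ≤ 1/(n+1)` and is one where `-ρ ≥ 2/(n+1)`. The shift
  -- by one is what keeps its closed support inside the open set `Ω`.
  set a : ℕ → E3 → ℝ := fun n x => -((n + 1 : ℝ) * ρ x) - 1 with ha
  have hasm : ∀ n, ContDiff ℝ ∞ (a n) := fun n =>
    ((contDiff_const.mul hρ.contDiff).neg).sub contDiff_const
  set η : ℕ → E3 → ℝ := fun n x => θ (a n x) with hη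
  have hηsm : ∀ n, ContDiff ℝ ∞ (η n) := fun n => hθsm.comp (hasm n)
  have hdη : ∀ n i x, dcoord i (η n) x = -((n + 1 : ℝ) * (deriv θ (a n x) * dcoord i ρ x)) := by
    intro n i x
    have h1 : HasFDerivAt (η n) (deriv θ (a n x) • fderiv ℝ (a n) x) x :=
      ((hθsm.differentiable (by simp)) _).hasDerivAt.comp_hasFDerivAt x
        ((smooth_differentiable (hasm n)) x).hasFDerivAt
    have h2 : dcoord i (a n) x = -((n + 1 : ℝ) * dcoord i ρ x) := by
      rw [ha]
      simp only
      rw [dcoord_sub (contDiff_const.mul hρ.contDiff).neg contDiff_const, dcoord_neg,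
        dcoord_mul contDiff_const hρ.contDiff, dcoord_const, dcoord_const]
      ring
    have h3 : dcoord i (η n) x = deriv θ (a n x) * dcoord i (a n) x := by
      rw [dcoord, h1.fderiv]; rfl
    rw [h3, h2]; ring
  have hηzero : ∀ n x, x ∉ Ω.carrier → η n x = 0 := by
    intro n x hx
    rw [hρ.mem_iff, not_lt] at hx
    refine Real.smoothTransition.zero_of_nonpos ?_
    have : 0 ≤ (n + 1 : ℝ) * ρ x := by positivity
    simp only [ha]; linarith
  have hts : ∀ n, tsupport (η n) ⊆ Ω.carrier := by
    intro n x hx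
    have hcl : IsClosed {x | 0 ≤ a n x} := isClosed_le continuous_const (hasm n).continuous
    have hsub : tsupport (η n) ⊆ {x | 0 ≤ a n x} := by
      refine closure_minimal (fun y hy => ?_) hcl
      by_contra h
      exact hy (Real.smoothTransition.zero_of_nonpos (le_of_not_ge h))
    have h1 : 0 ≤ -((n + 1 : ℝ) * ρ x) - 1 := hsub hx
    rw [hρ.mem_iff]
    by_contra h
    have : 0 ≤ (n + 1 : ℝ) * ρ x := mul_nonneg (by positivity) (not_lt.1 h)
    linarith
  have hcs : ∀ n, HasCompactSupport (η n) := fun n =>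
    Ω.isCompact_closure.of_isClosed_subset (isClosed_tsupport _)
      ((hts n).trans subset_closure)
  have hprod : ∀ n i x, dcoord i (fun y => η n y * G i y) x =
      dcoord i (η n) x * G i x + η n x * dcoord i (G i) x := fun n i x =>
    dcoord_mul (hηsm n) (hG i) x
  have hint : ∀ n, ∫ x in Ω.carrier, ∑ i, dcoord i (fun y => η n y * G i y) x = 0 := by
    intro n
    rw [setIntegral_eq_integral_of_forall_compl_eq_zero, integral_finsetSum]
    · exact Finset.sum_eq_zero fun i _ =>
        integral_dcoord_eq_zero ((hηsm n).mul (hG i)) (hcs n).mul_right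
    · intro i _
      exact (((hηsm n).mul (hG i)).dcoord i).continuous.integrable_of_hasCompactSupport
        ((hcs n).mul_right.dcoord i)
    · intro x hx
      refine Finset.sum_eq_zero fun i _ => ?_
      have hx' : x ∉ tsupport (fun y => η n y * G i y) := fun h =>
        hx (hts n (tsupport_mul_subset_left h))
      have : fderiv ℝ (fun y => η n y * G i y) x = 0 := by
        by_contra h
        exact hx' (support_fderiv_subset ℝ h)
      simp [dcoord, this]
  have hdiv : Continuous fun x => ∑ i, dcoord i (G i) x :=
    continuous_finsetSum _ fun i _ => ((hG i).dcoord i).continuous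
  obtain ⟨D, hD0, hD⟩ := Ω.exists_bound hdiv
  have hexp : ∀ n x, ∑ i, dcoord i (fun y => η n y * G i y) x =
      -((n + 1 : ℝ) * (deriv θ (a n x) * ∑ i, G i x * dcoord i ρ x)) +
        η n x * ∑ i, dcoord i (G i) x := by
    intro n x
    simp only [hprod, hdη, Fin.sum_univ_three]
    ring
  have hlim : Tendsto (fun n : ℕ => ∫ x in Ω.carrier, ∑ i, dcoord i (fun y => η n y * G i y) x)
      atTop (𝓝 (∫ x in Ω.carrier, ∑ i, dcoord i (G i) x)) := by
    refine tendsto_integral_of_dominated_convergence (fun _ => M * C * 2 + D) ?_ ?_ ?_ ?_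
    · intro n
      exact (continuous_finsetSum _ fun i _ =>
        (((hηsm n).mul (hG i)).dcoord i).continuous).aestronglyMeasurable
    · exact integrable_const _
    · intro n
      filter_upwards [ae_restrict_mem Ω.isOpen.measurableSet] with x hx
      rw [hexp, Real.norm_eq_abs]
      refine (abs_add_le _ _).trans (add_le_add ?_ ?_)
      · rw [abs_neg, abs_mul, abs_mul, abs_of_nonneg (by positivity : (0 : ℝ) ≤ n + 1)]
        have hneg := (hρ.mem_iff x).1 hx
        by_cases hs : a n x ∈ Set.Icc (0 : ℝ) 1
        · have h1 : (n + 1 : ℝ) * (-ρ x) ≤ 2 := by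
            have := hs.2
            simp only [ha] at this
            linarith
          calc (n + 1 : ℝ) * (|deriv θ (a n x)| * |∑ i, G i x * dcoord i ρ x|)
              ≤ (n + 1 : ℝ) * (M * (C * (-ρ x))) := by
                gcongr
                · exact hM _
                · exact hC x hx
            _ = M * C * ((n + 1 : ℝ) * (-ρ x)) := by ring
            _ ≤ M * C * 2 := by gcongr
        · rw [deriv_smoothTransition_of_notMem hs]
          simp; positivity
      · rw [abs_mul]
        have h1 : |η n x| ≤ 1 := by
          rw [abs_of_nonneg (Real.smoothTransition.nonneg _)]
          exact Real.smoothTransition.le_one _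
        calc _ ≤ 1 * D := mul_le_mul h1 (hD x (subset_closure hx)) (abs_nonneg _) zero_le_one
          _ = D := one_mul D
    · filter_upwards [ae_restrict_mem Ω.isOpen.measurableSet] with x hx
      have hneg := (hρ.mem_iff x).1 hx
      have ht : Tendsto (fun n : ℕ => a n x) atTop atTop := by
        have h1 : Tendsto (fun n : ℕ => ((n : ℝ) + 1) * (-ρ x) - 1) atTop atTop :=
          tendsto_atTop_add_const_right _ _ ((tendsto_natCast_atTop_atTop.atTop_add
            tendsto_const_nhds).atTop_mul_const (by linarith))
        refine h1.congr fun n => ?_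
        simp only [ha]; ring
      refine tendsto_const_nhds.congr' ?_
      filter_upwards [ht.eventually_gt_atTop 1] with n hn
      rw [hexp, deriv_smoothTransition_of_notMem (fun h => absurd h.2 (not_le.2 hn))]
      have : η n x = 1 := Real.smoothTransition.one_of_one_le hn.le
      rw [this]; ring
  simp only [hint] at hlim
  exact (tendsto_nhds_unique hlim tendsto_const_nhds)

end SmoothBoundedDomain

/-! ### Slicing: boundary control of integrals of derivatives. -/

/-- Within `I` monotonicity makes the sublevel set a half-line ending at `t₀`, up to that one point,
and outside `I` the integrand vanishes. The fundamental theorem of calculus leaves only the value at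
`t₀`; the absolute value hides which side is kept. -/
theorem integral_sublevel_deriv_of_zero {g r : ℝ → ℝ} {I : Set ℝ} {t₀ : ℝ} (hg : ContDiff ℝ 1 g)
    (hgc : HasCompactSupport g) (hgI : tsupport g ⊆ I)
    (hmono : StrictMonoOn r I ∨ StrictAntiOn r I) (ht : t₀ ∈ I) (hr : r t₀ = 0) :
    |∫ t, Set.indicator {t | r t < 0} (deriv g) t| = |g t₀| := by
  have hd : ∀ t, t ∉ I → deriv g t = 0 := fun t ht => by
    by_contra h
    exact ht (hgI (support_deriv_subset h))
  rcases hmono with h | h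
  · have : Set.indicator {t | r t < 0} (deriv g) =ᵐ[volume] Set.indicator (Set.Iic t₀) (deriv g) := by
      have hne : ∀ᵐ t : ℝ, t ≠ t₀ := by simp [ae_iff]
      filter_upwards [hne] with t hne
      by_cases htI : t ∈ I
      · have : r t < 0 ↔ t ≤ t₀ := by
          rw [← hr, h.lt_iff_lt htI ht]
          exact ⟨le_of_lt, fun h => lt_of_le_of_ne h hne⟩
        simp [Set.indicator, this]
      · simp [Set.indicator, hd t htI]
    rw [integral_congr_ae this, integral_indicator measurableSet_Iic,
      hgc.integral_Iic_deriv_eq hg]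
  · have : Set.indicator {t | r t < 0} (deriv g) =ᵐ[volume] Set.indicator (Set.Ioi t₀) (deriv g) := by
      refine Eventually.of_forall fun t => ?_
      by_cases htI : t ∈ I
      · have : r t < 0 ↔ t₀ < t := by
          rw [← hr, h.lt_iff_gt htI ht]
        simp [Set.indicator, this]
      · simp [Set.indicator, hd t htI]
    rw [integral_congr_ae this, integral_indicator measurableSet_Ioi,
      hgc.integral_Ioi_deriv_eq hg, abs_neg]

/-- By the intermediate value theorem `r` has constant sign on `I`, so the sublevel set keeps either
all of the derivative, with total integral zero, or none of it. -/
theorem integral_sublevel_deriv_of_ne_zero {g r : ℝ → ℝ} {I : Set ℝ} (hg : ContDiff ℝ 1 g)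
    (hgc : HasCompactSupport g) (hgI : tsupport g ⊆ I) (hI : IsPreconnected I)
    (hrc : Continuous r) (hr : ∀ t ∈ I, r t ≠ 0) :
    ∫ t, Set.indicator {t | r t < 0} (deriv g) t = 0 := by
  have hd : ∀ t, t ∉ I → deriv g t = 0 := fun t ht => by
    by_contra h
    exact ht (hgI (support_deriv_subset h))
  have htot : ∫ t, deriv g t = 0 := by
    rw [← integral_add_compl (s := Set.Iic 0) measurableSet_Iic
      ((hg.continuous_deriv (by simp)).integrable_of_hasCompactSupport hgc.deriv),
      hgc.integral_Iic_deriv_eq hg, Set.compl_Iic, hgc.integral_Ioi_deriv_eq hg]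
    ring
  by_cases hneg : ∃ t ∈ I, r t < 0
  · obtain ⟨t₁, ht₁, hr₁⟩ := hneg
    have hall : ∀ t ∈ I, r t < 0 := by
      intro t ht
      by_contra h
      obtain ⟨s, hs, hs0⟩ := hI.intermediate_value ht₁ ht hrc.continuousOn
        (show (0 : ℝ) ∈ Set.Icc (r t₁) (r t) from ⟨hr₁.le, not_lt.1 h⟩)
      exact hr s hs hs0
    refine Eq.trans (integral_congr_ae (Eventually.of_forall fun t => ?_)) htot
    by_cases htI : t ∈ I
    · simp [Set.indicator, hall t htI]
    · simp [Set.indicator, hd t htI]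
  · push Not at hneg
    rw [← integral_zero ℝ ℝ]
    refine integral_congr_ae (Eventually.of_forall fun t => ?_)
    by_cases htI : t ∈ I
    · simp [Set.indicator, hneg t htI]
    · simp [Set.indicator, hd t htI]

/-- The plane of the two coordinates other than the chosen one. -/
abbrev E2 : Type := EuclideanSpace ℝ (Fin 2)

/-- The point with `i`-th coordinate `t` and other coordinates `y`. -/
noncomputable def insertCoord (i : Fin 3) (t : ℝ) (y : E2) : E3 :=
  WithLp.toLp 2 (i.insertNth t y.ofLp : Fin 3 → ℝ)

/-- The projection that forgets the `i`-th coordinate. -/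
noncomputable def removeCoord (i : Fin 3) (p : E3) : E2 :=
  WithLp.toLp 2 (i.removeNth p.ofLp : Fin 2 → ℝ)

@[simp] theorem removeCoord_insertCoord (i : Fin 3) (t : ℝ) (y : E2) :
    removeCoord i (insertCoord i t y) = y := by
  simp [removeCoord, insertCoord]

@[simp] theorem insertCoord_removeCoord (i : Fin 3) (p : E3) :
    insertCoord i (p i) (removeCoord i p) = p := by
  simp [removeCoord, insertCoord]

theorem insertCoord_eq (i : Fin 3) (t : ℝ) (y : E2) :
    insertCoord i t y = insertCoord i 0 y + t • EuclideanSpace.single i 1 := by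
  ext j
  rcases Fin.eq_self_or_eq_succAbove i j with rfl | ⟨k, rfl⟩
  · simp [insertCoord]
  · simp [insertCoord, Fin.succAbove_ne]

theorem continuous_insertCoord (i : Fin 3) :
    Continuous fun z : E2 × ℝ => insertCoord i z.2 z.1 := by
  refine (PiLp.continuous_toLp 2 _).comp (continuous_pi fun j => ?_)
  rcases Fin.eq_self_or_eq_succAbove i j with rfl | ⟨k, rfl⟩
  · simpa using continuous_snd
  · simp only [Fin.insertNth_apply_succAbove]
    fun_prop

theorem removeCoord_lipschitz (i : Fin 3) : LipschitzWith 1 (removeCoord i) := by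
  refine LipschitzWith.of_dist_le_mul fun p q => ?_
  rw [NNReal.coe_one, one_mul, EuclideanSpace.dist_eq, EuclideanSpace.dist_eq]
  refine Real.sqrt_le_sqrt ?_
  rw [Fin.sum_univ_succAbove _ i]
  simp only [removeCoord, Fin.removeNth_apply]
  have := sq_nonneg (dist (p i) (q i))
  linarith

/-- A 1-Lipschitz map does not increase Hausdorff measure, and the normalization of `μHE[2]` turns
it into Lebesgue measure in the plane. This is the only property of surface measure that the flux
estimates need. -/
theorem euclideanHausdorffMeasure_image_removeCoord_le (i : Fin 3) (s : Set E3) :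
    volume (removeCoord i '' s) ≤ (μHE[2] : Measure E3) s := by
  rw [← EuclideanSpace.euclideanHausdorffMeasure_eq_volume 2,
    Measure.euclideanHausdorffMeasure_def, Measure.euclideanHausdorffMeasure_def,
    Measure.smul_apply, Measure.smul_apply]
  have := (removeCoord_lipschitz i).hausdorffMeasure_image_le (d := ((2 : ℕ) : ℝ)) (by simp) s
  simp only [ENNReal.coe_one, ENNReal.one_rpow, one_mul] at this
  gcongr

theorem measurePreserving_removeCoord (i : Fin 3) :
    MeasurePreserving (fun p : E3 => (p i, removeCoord i p)) volume (volume.prod volume) := by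
  have h1 := PiLp.volume_preserving_ofLp (Fin 3)
  have h2 := volume_preserving_piFinSuccAbove (fun _ : Fin 3 => ℝ) i
  have h3 := (MeasurePreserving.id (volume : Measure ℝ)).prod
    (PiLp.volume_preserving_toLp (Fin 2))
  exact h3.comp (h2.comp h1)

theorem integral_eq_integral_insertCoord (i : Fin 3) {f : E3 → ℝ} (hf : Integrable f) :
    ∫ x, f x = ∫ y : E2, ∫ t : ℝ, f (insertCoord i t y) := by
  have hmp := measurePreserving_removeCoord i
  have hm : Measurable fun z : ℝ × E2 => insertCoord i z.1 z.2 := by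
    have : Continuous fun z : ℝ × E2 => insertCoord i z.1 z.2 :=
      (continuous_insertCoord i).comp continuous_swap
    exact this.measurable
  let e : E3 ≃ᵐ ℝ × E2 :=
    { toFun := fun p => (p i, removeCoord i p)
      invFun := fun z => insertCoord i z.1 z.2
      left_inv := fun p => by simp
      right_inv := fun z => by simp; simp [insertCoord]
      measurable_toFun := hmp.measurable
      measurable_invFun := hm }
  have hmp' : MeasurePreserving e volume (volume.prod volume) := hmp
  have h1 : ∫ z, f (e.symm z) ∂(volume.prod volume) = ∫ x, f x := by
    rw [← hmp'.symm.integral_comp e.symm.measurableEmbedding]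
  rw [← h1, integral_prod_symm]
  · rfl
  · exact (hmp'.symm.integrable_comp_emb e.symm.measurableEmbedding).2 hf

theorem hasDerivAt_insertCoord {f : E3 → ℝ} (hf : ContDiff ℝ ∞ f) (i : Fin 3) (t : ℝ) (y : E2) :
    HasDerivAt (fun t => f (insertCoord i t y)) (dcoord i f (insertCoord i t y)) t := by
  have hl : HasDerivAt (fun t : ℝ => insertCoord i t y) (EuclideanSpace.single i 1) t := by
    have e : (fun t : ℝ => insertCoord i t y) =
      fun t => insertCoord i 0 y + t • EuclideanSpace.single i 1 := funext fun t =>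
        insertCoord_eq i t y
    rw [e]
    simpa using ((hasDerivAt_id t).smul_const (EuclideanSpace.single i (1 : ℝ) : E3)).const_add
      (insertCoord i 0 y)
  exact ((smooth_differentiable hf) _).hasFDerivAt.comp_hasDerivAt t hl

theorem convex_insertCoord_ball (i : Fin 3) (R : ℝ) (x : E3) (y : E2) :
    Convex ℝ {t | insertCoord i t y ∈ Metric.ball x R} := by
  have e : {t | insertCoord i t y ∈ Metric.ball x R} =
      (AffineMap.lineMap (insertCoord i 0 y) (insertCoord i 1 y) : ℝ →ᵃ[ℝ] E3) ⁻¹'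
        (Metric.ball x R) := by
    ext t
    simp only [Set.mem_ofPred_eq, Set.mem_preimage, AffineMap.lineMap_apply]
    rw [insertCoord_eq i t, insertCoord_eq i 1]
    simp [add_comm]
  rw [e]
  exact (convex_ball x R).affine_preimage _

namespace SmoothBoundedDomain

variable {Ω : SmoothBoundedDomain}

/-- Where the normal has a nonzero `i`-th component, the integral of an `i`-th derivative is
controlled by the values on the boundary. -/
theorem IsGlobalDefiningFunction.exists_integral_dcoord_le {ρ : E3 → ℝ}
    (h : Ω.IsGlobalDefiningFunction ρ) {x : E3} {i : Fin 3} (hx : dcoord i ρ x ≠ 0) :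
    ∃ R > 0, ∃ K : ℝ≥0∞, K ≠ ⊤ ∧ ∀ φ : E3 → ℝ, ContDiff ℝ ∞ φ → tsupport φ ⊆ Metric.ball x R →
      ‖∫ p in Ω.carrier, dcoord i φ p‖ₑ ≤ K * eLpNorm φ 2 Ω.surface := by
  have hdc : Continuous (dcoord i ρ) := (h.contDiff.dcoord i).continuous
  -- In a small ball `∂_i ρ` keeps its sign, so every line in direction `i` crosses the zero set of
  -- `ρ` there at most once.
  obtain ⟨R, hR, hmono⟩ : ∃ R > 0, ∀ y : E2,
      StrictMonoOn (fun t => ρ (insertCoord i t y)) {t | insertCoord i t y ∈ Metric.ball x R} ∨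
      StrictAntiOn (fun t => ρ (insertCoord i t y)) {t | insertCoord i t y ∈ Metric.ball x R} := by
    rcases lt_or_gt_of_ne hx with hlt | hgt
    · obtain ⟨R, hR, hB⟩ := Metric.eventually_nhds_iff_ball.1
        (hdc.continuousAt.eventually (gt_mem_nhds hlt))
      refine ⟨R, hR, fun y => Or.inr (strictAntiOn_of_deriv_neg (convex_insertCoord_ball i R x y) ?_ ?_)⟩
      · exact fun t _ => (hasDerivAt_insertCoord h.contDiff i t y).continuousAt.continuousWithinAt
      · intro t ht
        rw [(hasDerivAt_insertCoord h.contDiff i t y).deriv]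
        exact hB _ (interior_subset ht :)
    · obtain ⟨R, hR, hB⟩ := Metric.eventually_nhds_iff_ball.1
        (hdc.continuousAt.eventually (lt_mem_nhds hgt))
      refine ⟨R, hR, fun y => Or.inl (strictMonoOn_of_deriv_pos (convex_insertCoord_ball i R x y) ?_ ?_)⟩
      · exact fun t _ => (hasDerivAt_insertCoord h.contDiff i t y).continuousAt.continuousWithinAt
      · intro t ht
        rw [(hasDerivAt_insertCoord h.contDiff i t y).deriv]
        exact hB _ (interior_subset ht :)
  -- A bounded set carrying the slice integrals; its area is the price of passing from the `L¹` to
  -- the `L²` norm in the plane.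
  set Q : Set E2 := Metric.closedBall (removeCoord i x) R with hQ
  refine ⟨R, hR, volume Q ^ (1 / (1 : ℝ≥0∞).toReal - 1 / (2 : ℝ≥0∞).toReal),
    ENNReal.rpow_ne_top_of_nonneg (by norm_num) (isCompact_closedBall _ _).measure_lt_top.ne, ?_⟩
  intro φ hφ hsupp
  have hφc : HasCompactSupport φ := (isCompact_closedBall x R).of_isClosed_subset
    (isClosed_tsupport _) (hsupp.trans Metric.ball_subset_closedBall)
  have hmeas : StronglyMeasurable (Ω.carrier.indicator (dcoord i φ)) :=
    (hφ.dcoord i).continuous.stronglyMeasurable.indicator Ω.isOpen.measurableSet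
  have hint : Integrable (Ω.carrier.indicator (dcoord i φ)) :=
    ((hφ.dcoord i).continuous.integrable_of_hasCompactSupport (hφc.dcoord i)).indicator
      Ω.isOpen.measurableSet
  set J : E2 → ℝ := fun y => ∫ t, Ω.carrier.indicator (dcoord i φ) (insertCoord i t y) with hJ
  have hins := continuous_insertCoord i
  have hJm : StronglyMeasurable J :=
    StronglyMeasurable.integral_prod_right' (f := fun z : E2 × ℝ =>
      Ω.carrier.indicator (dcoord i φ) (insertCoord i z.2 z.1))
      (hmeas.comp_measurable hins.measurable)
  have hJy : ∀ y, J y = ∫ t, Set.indicator {t | ρ (insertCoord i t y) < 0}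
      (deriv fun t => φ (insertCoord i t y)) t := by
    intro y
    refine integral_congr_ae (Eventually.of_forall fun t => ?_)
    simp only [Set.indicator, h.mem_iff, Set.mem_ofPred_eq,
      (hasDerivAt_insertCoord hφ i t y).deriv]
  have hcont : ∀ y, Continuous fun t => insertCoord i t y := fun y =>
    hins.comp (Continuous.prodMk_right y)
  have hslice_smooth : ∀ y, ContDiff ℝ 1 fun t => φ (insertCoord i t y) := by
    intro y
    have e : (fun t : ℝ => insertCoord i t y) =
      fun t => insertCoord i 0 y + t • EuclideanSpace.single i 1 := funext fun t =>
        insertCoord_eq i t y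
    have : ContDiff ℝ 1 fun t : ℝ => insertCoord i t y := by
      rw [e]; fun_prop
    exact (hφ.of_le (by norm_cast)).comp this
  have hslice_tsupp : ∀ y, tsupport (fun t => φ (insertCoord i t y)) ⊆
      {t | insertCoord i t y ∈ tsupport φ} := fun y =>
    closure_minimal (fun t ht => subset_tsupport φ ht)
      ((isClosed_tsupport φ).preimage (hcont y))
  have hslice_cpt : ∀ y, HasCompactSupport fun t => φ (insertCoord i t y) := by
    intro y
    obtain ⟨B, hB⟩ := hφc.isBounded.exists_norm_le
    refine HasCompactSupport.of_support_subset_isCompact (isCompact_Icc (a := -B) (b := B)) ?_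
    intro t ht
    have h1 := hB _ (subset_tsupport φ ht)
    have h2 : |t| ≤ ‖insertCoord i t y‖ := by
      have := PiLp.norm_apply_le (insertCoord i t y) i
      simpa [insertCoord] using this
    exact abs_le.1 (h2.trans h1)
  have hpre : ∀ y, IsPreconnected {t | insertCoord i t y ∈ Metric.ball x R} :=
    fun y => (convex_insertCoord_ball i R x y).isPreconnected
  -- On a line crossing the boundary inside the ball, the slice integral is, up to sign, the value
  -- of `φ` at the crossing.
  have hJ1 : ∀ p ∈ frontier Ω.carrier, p ∈ Metric.ball x R → |J (removeCoord i p)| = |φ p| := by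
    intro p hp hpB
    rw [hJy, integral_sublevel_deriv_of_zero (t₀ := p i) (hslice_smooth _) (hslice_cpt _)
      ((hslice_tsupp _).trans fun t ht => hsupp ht) (hmono _)
      (show insertCoord i (p i) (removeCoord i p) ∈ Metric.ball x R by simpa using hpB)
      (by simpa using h.eq_zero hp)]
    simp
  have hJ2 : ∀ y, J y ≠ 0 → y ∈ removeCoord i '' (frontier Ω.carrier ∩ Metric.ball x R) := by
    intro y hy
    by_contra hcon
    refine hy ?_
    rw [hJy]
    refine integral_sublevel_deriv_of_ne_zero (hslice_smooth _) (hslice_cpt _)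
      ((hslice_tsupp _).trans fun t ht => hsupp ht) (hpre y)
      (h.contDiff.continuous.comp (hcont y)) fun t ht h0 => hcon ?_
    set q := insertCoord i t y with hq
    have hopen : IsOpen {t | insertCoord i t y ∈ Metric.ball x R} :=
      Metric.isOpen_ball.preimage (hcont y)
    -- A zero of `ρ` is not on the frontier by definition; strict monotonicity along the line
    -- supplies points with `ρ < 0` arbitrarily near it.
    have hqc : q ∈ closure Ω.carrier := by
      rcases hmono y with hm | hm
      · refine mem_closure_of_tendsto (((hcont y).tendsto t).mono_left nhdsWithin_le_nhds :
          Tendsto _ (𝓝[<] t) _) ?_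
        filter_upwards [self_mem_nhdsWithin, nhdsWithin_le_nhds (hopen.mem_nhds ht)] with s hs hsI
        rw [h.mem_iff, ← h0]
        exact hm hsI ht hs
      · refine mem_closure_of_tendsto (((hcont y).tendsto t).mono_left nhdsWithin_le_nhds :
          Tendsto _ (𝓝[>] t) _) ?_
        filter_upwards [self_mem_nhdsWithin, nhdsWithin_le_nhds (hopen.mem_nhds ht)] with s hs hsI
        rw [h.mem_iff, ← h0]
        exact hm ht hsI hs
    refine ⟨q, ⟨?_, ht⟩, by simp [hq]⟩
    rw [Ω.isOpen.frontier_eq]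
    exact ⟨hqc, fun h' => by
      have := (h.mem_iff q).1 h'
      exact absurd h0 this.ne⟩
  have hmain : ∫ p in Ω.carrier, dcoord i φ p = ∫ y, J y := by
    rw [← integral_indicator Ω.isOpen.measurableSet, integral_eq_integral_insertCoord i hint]
  have hJQ : ∀ y, y ∉ Q → J y = 0 := by
    intro y hy
    by_contra hne
    obtain ⟨p, ⟨-, hp⟩, rfl⟩ := hJ2 y hne
    refine hy ?_
    rw [hQ, Metric.mem_closedBall]
    exact ((removeCoord_lipschitz i).dist_le_mul p x).trans (by simpa using (Metric.mem_ball.1 hp).le)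
  have hL2 : eLpNorm J 2 volume ≤ eLpNorm φ 2 Ω.surface := by
    set T : Set E2 := {y | J y ≠ 0} with hT
    have hTm : MeasurableSet T := (hJm.measurable (measurableSet_singleton 0)).compl
    set B := Metric.ball x R
    -- Every `y` with `J y ≠ 0` lies under a frontier point, so projected surface measure dominates
    -- Lebesgue measure on `T`. Hence the `L²` norm of `J` is bounded by that of `φ` on the surface.
    have hle : volume.restrict T ≤ Measure.map (removeCoord i) (Ω.surface.restrict B) := by
      refine Measure.le_iff.2 fun A hA => ?_
      have hpA := (removeCoord_lipschitz i).continuous.measurable hA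
      rw [Measure.restrict_apply hA,
        Measure.map_apply (removeCoord_lipschitz i).continuous.measurable hA,
        Measure.restrict_apply hpA,
        Measure.restrict_apply (hpA.inter Metric.isOpen_ball.measurableSet)]
      refine le_trans (measure_mono ?_) (euclideanHausdorffMeasure_image_removeCoord_le i _)
      rintro y ⟨hyA, hyT⟩
      obtain ⟨p, ⟨hp1, hp2⟩, rfl⟩ := hJ2 y hyT
      exact ⟨p, ⟨⟨hyA, hp2⟩, hp1⟩, rfl⟩
    have h1 : eLpNorm J 2 volume = eLpNorm J 2 (volume.restrict T) := by
      rw [← eLpNorm_indicator_eq_eLpNorm_restrict hTm]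
      congr 1
      exact (Set.indicator_eq_self.2 fun y hy => hy).symm
    rw [h1]
    refine (eLpNorm_mono_measure J hle).trans ?_
    rw [eLpNorm_map_measure hJm.aestronglyMeasurable
      (removeCoord_lipschitz i).continuous.measurable.aemeasurable]
    refine le_trans (eLpNorm_mono_ae ?_) (eLpNorm_mono_measure φ Measure.restrict_le_self)
    have hf : ∀ᵐ p ∂(Ω.surface.restrict B), p ∈ frontier Ω.carrier :=
      ae_restrict_of_ae (ae_restrict_mem isClosed_frontier.measurableSet)
    filter_upwards [hf, ae_restrict_mem Metric.isOpen_ball.measurableSet] with p hp1 hp2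
    exact (hJ1 p hp1 hp2).le
  have h1 : eLpNorm J 1 volume = eLpNorm J 1 (volume.restrict Q) := by
    rw [← eLpNorm_indicator_eq_eLpNorm_restrict measurableSet_closedBall]
    congr 1
    exact (Set.indicator_eq_self.2 fun y hy => by_contra fun hn => hy (hJQ y hn)).symm
  calc ‖∫ p in Ω.carrier, dcoord i φ p‖ₑ = ‖∫ y, J y‖ₑ := by rw [hmain]
    _ ≤ ∫⁻ y, ‖J y‖ₑ := enorm_integral_le_lintegral_enorm _
    _ = eLpNorm J 1 (volume.restrict Q) := by rw [← h1, eLpNorm_one_eq_lintegral_enorm]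
    _ ≤ eLpNorm J 2 (volume.restrict Q) * volume.restrict Q Set.univ ^
        (1 / (1 : ℝ≥0∞).toReal - 1 / (2 : ℝ≥0∞).toReal) :=
      eLpNorm_le_eLpNorm_mul_rpow_measure_univ (by norm_num) hJm.aestronglyMeasurable
    _ ≤ _ := by
      rw [Measure.restrict_apply_univ, mul_comm]
      gcongr
      exact (eLpNorm_mono_measure J Measure.restrict_le_self).trans hL2

/-- The local form of the boundary estimate, for all directions. -/
theorem exists_local_integral_dcoord_mul_le (Ω : SmoothBoundedDomain) (x : E3)
    (hx : x ∈ closure Ω.carrier) :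
    ∃ R > 0, ∀ a : E3 → ℝ, ContDiff ℝ ∞ a → tsupport a ⊆ Metric.ball x R → ∀ j,
      ∃ K : ℝ≥0∞, K ≠ ⊤ ∧ ∀ h : E3 → ℝ, ContDiff ℝ ∞ h →
        ‖∫ p in Ω.carrier, dcoord j (fun y => a y * h y) p‖ₑ ≤ K * eLpNorm h 2 Ω.surface := by
  by_cases hxΩ : x ∈ Ω.carrier
  · obtain ⟨R, hR, hB⟩ := Metric.isOpen_iff.1 Ω.isOpen x hxΩ
    -- Near an interior point the product has compact support in `Ω` and the integral vanishes.
    refine ⟨R, hR, fun a ha hsupp j => ⟨0, by simp, fun h hh => ?_⟩⟩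
    have hac : HasCompactSupport a := (isCompact_closedBall x R).of_isClosed_subset
      (isClosed_tsupport _) (hsupp.trans Metric.ball_subset_closedBall)
    rw [setIntegral_eq_integral_of_forall_compl_eq_zero,
      integral_dcoord_eq_zero (ha.mul hh) hac.mul_right]
    · simp
    · intro p hp
      have hp' : p ∉ tsupport (fun y => a y * h y) := fun h' =>
        hp (hB (hsupp (tsupport_mul_subset_left h')))
      have : fderiv ℝ (fun y => a y * h y) p = 0 := by
        by_contra h
        exact hp' (support_fderiv_subset ℝ h)
      simp [dcoord, this]
  · have hxf : x ∈ frontier Ω.carrier := by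
      rw [Ω.isOpen.frontier_eq]; exact ⟨hx, hxΩ⟩
    obtain ⟨ρ, hρ⟩ := Ω.exists_isGlobalDefiningFunction
    obtain ⟨i, hi⟩ : ∃ i, dcoord i ρ x ≠ 0 := by
      by_contra! hcon
      refine hρ.gradient_ne_zero x hxf ?_
      ext i
      rw [gradient_apply, hcon i]; rfl
    obtain ⟨R₁, hR₁, K, hK, hKb⟩ := hρ.exists_integral_dcoord_le hi
    obtain ⟨R₂, hR₂, hne⟩ := Metric.eventually_nhds_iff_ball.1
      ((hρ.contDiff.dcoord i).continuous.continuousAt.eventually_ne hi)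
    refine ⟨min R₁ R₂, lt_min hR₁ hR₂, fun a ha hsupp j => ?_⟩
    have hsupp1 := hsupp.trans (Metric.ball_subset_ball (min_le_left R₁ R₂))
    have hsupp2 := hsupp.trans (Metric.ball_subset_ball (min_le_right R₁ R₂))
    -- Chosen so that `a ∂_jρ = b ∂_iρ`: the field `a h e_j - b h e_i` is then tangent to the
    -- boundary, and the derivative in an arbitrary direction `j` is traded for one in the
    -- transversal direction `i`.
    set b : E3 → ℝ := fun y => a y * (dcoord j ρ y / dcoord i ρ y) with hb
    have hbsupp : tsupport b ⊆ tsupport a := tsupport_mul_subset_left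
    have hbsm : ContDiff ℝ ∞ b := contDiff_iff_contDiffAt.2 fun y => by
      by_cases hy : y ∈ tsupport b
      swap
      · exact contDiffAt_const.congr_of_eventuallyEq (notMem_tsupport_iff_eventuallyEq.1 hy)
      exact ha.contDiffAt.mul ((hρ.contDiff.dcoord j).contDiffAt.div (hρ.contDiff.dcoord i).contDiffAt
        (hne y (hsupp2 (hbsupp hy))))
    obtain ⟨C, hC0, hC⟩ := Ω.exists_bound hbsm.continuous
    refine ⟨K * ENNReal.ofReal C, ENNReal.mul_ne_top hK ENNReal.ofReal_ne_top, fun h hh => ?_⟩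
    have hsm1 : ContDiff ℝ ∞ fun y => a y * h y := ha.mul hh
    have hsm2 : ContDiff ℝ ∞ fun y => b y * h y := hbsm.mul hh
    have heq : ∫ p in Ω.carrier, dcoord j (fun y => a y * h y) p =
        ∫ p in Ω.carrier, dcoord i (fun y => b y * h y) p := by
      have hsmG : ∀ k : Fin 3, ContDiff ℝ ∞ fun y =>
          (if k = j then 1 else 0) * (a y * h y) - (if k = i then 1 else 0) * (b y * h y) :=
        fun k => (contDiff_const.mul hsm1).sub (contDiff_const.mul hsm2)
      have hdiv := integral_divergence_eq_zero_of_tangent (Ω := Ω) hsmG (fun y hy => by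
        have hab : a y * dcoord j ρ y = b y * dcoord i ρ y := by
          by_cases hay : a y = 0
          · simp [hb, hay]
          · have := hne y (hsupp2 (subset_tsupport a hay))
            simp only [hb]
            field_simp
        simp only [sub_mul, Finset.sum_sub_distrib, ite_mul, one_mul, zero_mul,
          Finset.sum_ite_eq', Finset.mem_univ, if_true, hρ.outwardNormal_apply hy]
        linear_combination h y * ‖gradient ρ y‖⁻¹ * hab)
      have hexp : ∀ p, ∑ k : Fin 3, dcoord k (fun y => (if k = j then 1 else 0) * (a y * h y) -
          (if k = i then 1 else 0) * (b y * h y)) p =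
          dcoord j (fun y => a y * h y) p - dcoord i (fun y => b y * h y) p := by
        intro p
        have : ∀ k : Fin 3, dcoord k (fun y => (if k = j then 1 else 0) * (a y * h y) -
          (if k = i then 1 else 0) * (b y * h y)) p =
          (if k = j then 1 else 0) * dcoord k (fun y => a y * h y) p -
          (if k = i then 1 else 0) * dcoord k (fun y => b y * h y) p := by
          intro k
          rw [dcoord_sub (contDiff_const.mul hsm1) (contDiff_const.mul hsm2),
            dcoord_mul contDiff_const hsm1, dcoord_mul contDiff_const hsm2, dcoord_const,
            dcoord_const]
          ring
        rw [Finset.sum_congr rfl fun k _ => this k]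
        simp only [Finset.sum_sub_distrib, ite_mul, one_mul, zero_mul,
          Finset.sum_ite_eq', Finset.mem_univ, if_true]
      simp only [hexp] at hdiv
      rw [integral_sub (Ω.integrable_of_continuous (hsm1.dcoord j).continuous)
        (Ω.integrable_of_continuous (hsm2.dcoord i).continuous)] at hdiv
      linarith
    rw [heq]
    refine (hKb _ hsm2 ((tsupport_mul_subset_left.trans hbsupp).trans hsupp1)).trans ?_
    rw [mul_assoc]
    gcongr
    refine eLpNorm_le_mul_eLpNorm_of_ae_le_mul ?_ 2
    filter_upwards [ae_restrict_mem isClosed_frontier.measurableSet] with y hy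
    rw [norm_mul]
    gcongr
    exact hC y (frontier_subset_closure hy)

/-- The integral of a derivative is controlled by the `L²` norm on the boundary. -/
theorem exists_integral_dcoord_mul_le (Ω : SmoothBoundedDomain) {a : E3 → ℝ}
    (ha : ContDiff ℝ ∞ a) (j : Fin 3) :
    ∃ K : ℝ≥0∞, K ≠ ⊤ ∧ ∀ h : E3 → ℝ, ContDiff ℝ ∞ h →
      ‖∫ p in Ω.carrier, dcoord j (fun y => a y * h y) p‖ₑ ≤ K * eLpNorm h 2 Ω.surface := by
  choose! R hR hRa using Ω.exists_local_integral_dcoord_mul_le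
  obtain ⟨t, ht, htc⟩ := Ω.isCompact_closure.elim_nhds_subcover (fun x => Metric.ball x (R x))
    (fun x hx => Metric.ball_mem_nhds x (hR x hx))
  obtain ⟨χ, hχ⟩ := SmoothPartitionOfUnity.exists_isSubordinate (modelWithCornersSelf ℝ E3)
    (isClosed_closure (s := Ω.carrier)) (fun x : t => Metric.ball (x : E3) (R x))
    (fun _ => Metric.isOpen_ball) (by simpa [Set.iUnion_subtype] using htc)
  have hχsm : ∀ x, ContDiff ℝ ∞ (χ x) := fun x => (χ x).contMDiff.contDiff
  have hloc := fun x : t => hRa x (ht x x.2) (fun y => χ x y * a y) ((hχsm x).mul ha)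
    (tsupport_mul_subset_left.trans (hχ x)) j
  choose K hK hKb using hloc
  refine ⟨∑ x, K x, by simpa using hK, fun h hh => ?_⟩
  have hsm : ∀ x : t, ContDiff ℝ ∞ (fun y => χ x y * a y * h y) := fun x =>
    ((hχsm x).mul ha).mul hh
  have heq : ∫ p in Ω.carrier, dcoord j (fun y => a y * h y) p =
      ∑ x : t, ∫ p in Ω.carrier, dcoord j (fun y => χ x y * a y * h y) p := by
    rw [← integral_finsetSum _ fun x _ =>
      Ω.integrable_of_continuous ((hsm x).dcoord j).continuous]
    refine setIntegral_congr_fun Ω.isOpen.measurableSet fun p hp => ?_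
    rw [← dcoord_sum _ hsm]
    have : (fun y => a y * h y) =ᶠ[𝓝 p] fun y => ∑ x, χ x y * a y * h y := by
      filter_upwards [Ω.isOpen.mem_nhds hp] with y hy
      have h1 := χ.sum_eq_one (subset_closure hy)
      rw [finsum_eq_sum_of_fintype] at h1
      simp only [mul_assoc]
      rw [← Finset.sum_mul, h1, one_mul]
    simp only [dcoord, this.fderiv_eq]
  rw [heq, Finset.sum_mul]
  refine (enorm_sum_le _ _).trans (Finset.sum_le_sum fun x _ => hKb x h hh)

/-- The flux of `h F` vanishes in the limit when `h` tends to zero on the boundary. -/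
theorem tendsto_integral_divergence_mul {F : Fin 3 → E3 → ℝ} (hF : ∀ i, ContDiff ℝ ∞ (F i))
    {h : ℕ → E3 → ℝ} (hh : ∀ k, ContDiff ℝ ∞ (h k))
    (hlim : Tendsto (fun k => eLpNorm (h k) 2 Ω.surface) atTop (𝓝 0)) :
    Tendsto (fun k => ∫ p in Ω.carrier, ∑ i, dcoord i (fun y => F i y * h k y) p)
      atTop (𝓝 0) := by
  have hsum : ∀ k, ∫ p in Ω.carrier, ∑ i, dcoord i (fun y => F i y * h k y) p =
      ∑ i, ∫ p in Ω.carrier, dcoord i (fun y => F i y * h k y) p := fun k =>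
    integral_finsetSum _ fun i _ =>
      Ω.integrable_of_continuous (((hF i).mul (hh k)).dcoord i).continuous
  simp only [hsum]
  rw [← Finset.sum_const_zero (s := (Finset.univ : Finset (Fin 3)))]
  refine tendsto_finsetSum _ fun i _ => ?_
  obtain ⟨K, hK, hKb⟩ := Ω.exists_integral_dcoord_mul_le (hF i) i
  rw [tendsto_zero_iff_enorm_tendsto_zero]
  refine tendsto_of_tendsto_of_tendsto_of_le_of_le tendsto_const_nhds ?_ (fun _ => zero_le)
    fun k => hKb (h k) (hh k)
  simpa using ENNReal.Tendsto.const_mul hlim (Or.inr hK)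

end SmoothBoundedDomain

/-! ### The pointwise identities behind the second order estimate. -/

section Fields

variable (N : Fin 3 → E3 → ℝ) (ξ : E3 → ℝ)

/-- The derivative of `ξ` along the field `N`. -/
noncomputable def derivAlong (x : E3) : ℝ := ∑ k, N k x * dcoord k ξ x

/-- The antisymmetric tensor `N ∧ ∇ξ`. -/
noncomputable def wedgeGrad (i j : Fin 3) (x : E3) : ℝ :=
  N i x * dcoord j ξ x - N j x * dcoord i ξ x

/-- The divergence of `N ∧ ∇ξ`, a divergence-free field. -/
noncomputable def divWedge (j : Fin 3) (x : E3) : ℝ := ∑ i, dcoord i (wedgeGrad N ξ i j) x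

/-- The field whose divergence is `|D²ξ|² - (Δξ)²`. -/
noncomputable def hessField (k : Fin 3) (x : E3) : ℝ :=
  ∑ i, (dcoord i ξ x * dcoord i (dcoord k ξ) x - dcoord k ξ x * dcoord i (dcoord i ξ) x)

/-- The coefficients of the curvature form. -/
noncomputable def curvCoeff (a b : Fin 3) (x : E3) : ℝ :=
  dcoord a (N b) x - N a x * ∑ i, N i x * dcoord i (N b) x +
    (∑ i, dcoord i (N i) x) * (N a x * N b x) - N a x * ∑ i, N i x * dcoord b (N i) x

/-- The curvature form, quadratic in the gradient. -/
noncomputable def curvForm (x : E3) : ℝ :=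
  ∑ a, ∑ b, curvCoeff N a b x * (dcoord a ξ x * dcoord b ξ x)

variable {N ξ}

theorem contDiff_derivAlong (hN : ∀ i, ContDiff ℝ ∞ (N i)) (hξ : ContDiff ℝ ∞ ξ) :
    ContDiff ℝ ∞ (derivAlong N ξ) :=
  ContDiff.sum fun k _ => (hN k).mul (hξ.dcoord k)

theorem contDiff_wedgeGrad (hN : ∀ i, ContDiff ℝ ∞ (N i)) (hξ : ContDiff ℝ ∞ ξ) (i j : Fin 3) :
    ContDiff ℝ ∞ (wedgeGrad N ξ i j) :=
  ((hN i).mul (hξ.dcoord j)).sub ((hN j).mul (hξ.dcoord i))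

theorem contDiff_divWedge (hN : ∀ i, ContDiff ℝ ∞ (N i)) (hξ : ContDiff ℝ ∞ ξ) (j : Fin 3) :
    ContDiff ℝ ∞ (divWedge N ξ j) :=
  ContDiff.sum fun i _ => (contDiff_wedgeGrad hN hξ i j).dcoord i

theorem contDiff_hessField (hξ : ContDiff ℝ ∞ ξ) (k : Fin 3) : ContDiff ℝ ∞ (hessField ξ k) :=
  ContDiff.sum fun i _ => ((hξ.dcoord i).mul ((hξ.dcoord k).dcoord i)).sub
    ((hξ.dcoord k).mul ((hξ.dcoord i).dcoord i))

theorem contDiff_curvCoeff (hN : ∀ i, ContDiff ℝ ∞ (N i)) (a b : Fin 3) :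
    ContDiff ℝ ∞ (curvCoeff N a b) :=
  ((((hN b).dcoord a).sub ((hN a).mul (ContDiff.sum fun i _ => (hN i).mul ((hN b).dcoord i)))).add
    ((ContDiff.sum fun i _ => (hN i).dcoord i).mul ((hN a).mul (hN b)))).sub
    ((hN a).mul (ContDiff.sum fun i _ => (hN i).mul ((hN i).dcoord b)))

theorem contDiff_curvForm (hN : ∀ i, ContDiff ℝ ∞ (N i)) (hξ : ContDiff ℝ ∞ ξ) :
    ContDiff ℝ ∞ (curvForm N ξ) :=
  ContDiff.sum fun a _ => ContDiff.sum fun b _ => (contDiff_curvCoeff hN a b).mul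
    ((hξ.dcoord a).mul (hξ.dcoord b))

theorem dcoord_derivAlong (hN : ∀ i, ContDiff ℝ ∞ (N i)) (hξ : ContDiff ℝ ∞ ξ) (j : Fin 3)
    (x : E3) : dcoord j (derivAlong N ξ) x =
      ∑ k, (dcoord j (N k) x * dcoord k ξ x + N k x * dcoord j (dcoord k ξ) x) := by
  unfold derivAlong
  rw [dcoord_sum _ fun k => (hN k).mul (hξ.dcoord k)]
  exact Finset.sum_congr rfl fun k _ => dcoord_mul (hN k) (hξ.dcoord k) x

theorem divWedge_eq (hN : ∀ i, ContDiff ℝ ∞ (N i)) (hξ : ContDiff ℝ ∞ ξ) (j : Fin 3)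
    (x : E3) : divWedge N ξ j x =
      ∑ i, (dcoord i (N i) x * dcoord j ξ x + N i x * dcoord i (dcoord j ξ) x -
        (dcoord i (N j) x * dcoord i ξ x + N j x * dcoord i (dcoord i ξ) x)) := by
  refine Finset.sum_congr rfl fun i _ => ?_
  unfold wedgeGrad
  rw [dcoord_sub ((hN i).mul (hξ.dcoord j)) ((hN j).mul (hξ.dcoord i)),
    dcoord_mul (hN i) (hξ.dcoord j), dcoord_mul (hN j) (hξ.dcoord i)]

theorem wedgeGrad_swap (i j : Fin 3) : wedgeGrad N ξ j i = fun x => - wedgeGrad N ξ i j x := by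
  funext x; simp only [wedgeGrad]; ring

/-- An antisymmetric tensor is contracted with a symmetric Hessian. -/
theorem sum_wedgeGrad_mul_eq_zero {h : E3 → ℝ} (hh : ContDiff ℝ ∞ h) (x : E3) :
    ∑ i, ∑ j, wedgeGrad N ξ i j x * dcoord i (dcoord j h) x = 0 := by
  have h1 := dcoord_comm (i := 0) (j := 1) hh x
  have h2 := dcoord_comm (i := 0) (j := 2) hh x
  have h3 := dcoord_comm (i := 1) (j := 2) hh x
  simp only [Fin.sum_univ_three, wedgeGrad]
  rw [h1, h2, h3]
  ring

/-- The double divergence of an antisymmetric tensor equals its own negative, by exchanging both the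
indices and the order of differentiation. -/
theorem sum_dcoord_divWedge_eq_zero (hN : ∀ i, ContDiff ℝ ∞ (N i)) (hξ : ContDiff ℝ ∞ ξ)
    (x : E3) : ∑ j, dcoord j (divWedge N ξ j) x = 0 := by
  have e : ∀ j, dcoord j (divWedge N ξ j) x = ∑ i, dcoord j (dcoord i (wedgeGrad N ξ i j)) x :=
    fun j => dcoord_sum _ (fun i => (contDiff_wedgeGrad hN hξ i j).dcoord i) x
  have hneg : ∀ i j, dcoord j (dcoord i (wedgeGrad N ξ i j)) x =
      - dcoord i (dcoord j (wedgeGrad N ξ j i)) x := by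
    intro i j
    rw [dcoord_comm (contDiff_wedgeGrad hN hξ i j), wedgeGrad_swap j i]
    have : dcoord j (fun x => -wedgeGrad N ξ j i x) = fun x => - dcoord j (wedgeGrad N ξ j i) x :=
      funext fun y => dcoord_neg y
    rw [this, dcoord_neg]
  have key : ∑ j, dcoord j (divWedge N ξ j) x = - ∑ j, dcoord j (divWedge N ξ j) x := by
    conv_lhs => rw [Finset.sum_congr rfl fun j _ => e j, Finset.sum_comm]
    rw [Finset.sum_congr rfl fun j _ => e j, ← Finset.sum_neg_distrib]
    refine Finset.sum_congr rfl fun i _ => ?_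
    rw [← Finset.sum_neg_distrib]
    exact Finset.sum_congr rfl fun j _ => hneg i j
  linarith

theorem sum_dcoord_mul_divWedge (hN : ∀ i, ContDiff ℝ ∞ (N i)) (hξ : ContDiff ℝ ∞ ξ)
    {h : E3 → ℝ} (hh : ContDiff ℝ ∞ h) (x : E3) :
    ∑ j, dcoord j (fun y => divWedge N ξ j y * h y) x = ∑ j, divWedge N ξ j x * dcoord j h x := by
  simp only [dcoord_mul (contDiff_divWedge hN hξ _) hh, Finset.sum_add_distrib]
  rw [← Finset.sum_mul, sum_dcoord_divWedge_eq_zero hN hξ]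
  ring

/-- This field and `divWedge N ξ` times `h` have the same divergence. That is why subtracting both
in `tangent_identity` produces twice the boundary form. -/
theorem sum_dcoord_wedgeGrad_mul (hN : ∀ i, ContDiff ℝ ∞ (N i)) (hξ : ContDiff ℝ ∞ ξ)
    {h : E3 → ℝ} (hh : ContDiff ℝ ∞ h) (x : E3) :
    ∑ i, dcoord i (fun y => ∑ j, wedgeGrad N ξ i j y * dcoord j h y) x =
      ∑ j, divWedge N ξ j x * dcoord j h x := by
  have e : ∀ i, dcoord i (fun y => ∑ j, wedgeGrad N ξ i j y * dcoord j h y) x =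
      ∑ j, dcoord i (wedgeGrad N ξ i j) x * dcoord j h x +
        ∑ j, wedgeGrad N ξ i j x * dcoord i (dcoord j h) x := by
    intro i
    rw [dcoord_sum _ fun j => (contDiff_wedgeGrad hN hξ i j).mul (hh.dcoord j),
      ← Finset.sum_add_distrib]
    exact Finset.sum_congr rfl fun j _ => dcoord_mul (contDiff_wedgeGrad hN hξ i j) (hh.dcoord j) x
  rw [Finset.sum_congr rfl fun i _ => e i, Finset.sum_add_distrib, sum_wedgeGrad_mul_eq_zero hh,
    add_zero, Finset.sum_comm]
  exact Finset.sum_congr rfl fun j _ => by rw [divWedge, Finset.sum_mul]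

/-- The terms with third derivatives cancel after the two summation indices are exchanged. -/
theorem sum_dcoord_hessField (hξ : ContDiff ℝ ∞ ξ) (x : E3) :
    ∑ k, dcoord k (hessField ξ k) x =
      ∑ k, ∑ i, dcoord k (dcoord i ξ) x ^ 2 - (∑ i, dcoord i (dcoord i ξ) x) ^ 2 := by
  have e : ∀ k, dcoord k (hessField ξ k) x =
      ∑ i, (dcoord k (dcoord i ξ) x ^ 2 - dcoord k (dcoord k ξ) x * dcoord i (dcoord i ξ) x) +
      (∑ i, dcoord i ξ x * dcoord i (dcoord k (dcoord k ξ)) x -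
        ∑ i, dcoord k ξ x * dcoord k (dcoord i (dcoord i ξ)) x) := by
    intro k
    unfold hessField
    rw [dcoord_sum _ fun i => ((hξ.dcoord i).mul ((hξ.dcoord k).dcoord i)).sub
      ((hξ.dcoord k).mul ((hξ.dcoord i).dcoord i)), ← Finset.sum_sub_distrib,
      ← Finset.sum_add_distrib]
    refine Finset.sum_congr rfl fun i _ => ?_
    rw [dcoord_sub ((hξ.dcoord i).mul ((hξ.dcoord k).dcoord i))
      ((hξ.dcoord k).mul ((hξ.dcoord i).dcoord i)), dcoord_mul (hξ.dcoord i)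
      ((hξ.dcoord k).dcoord i), dcoord_mul (hξ.dcoord k) ((hξ.dcoord i).dcoord i),
      dcoord_comm (i := i) (j := k) hξ, dcoord_comm (i := k) (j := i) (hξ.dcoord k)]
    ring
  rw [Finset.sum_congr rfl fun k _ => e k, Finset.sum_add_distrib, Finset.sum_sub_distrib,
    Finset.sum_comm (f := fun k i => dcoord i ξ x * dcoord i (dcoord k (dcoord k ξ)) x), sub_self,
    add_zero]
  simp only [Finset.sum_sub_distrib]
  rw [sq, Finset.sum_mul_sum]

/-- On the boundary the combined field is tangent. -/
theorem tangent_identity (hN : ∀ i, ContDiff ℝ ∞ (N i)) (hξ : ContDiff ℝ ∞ ξ) {x : E3}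
    (hx : ∑ i, N i x ^ 2 = 1) :
    ∑ i, (hessField ξ i x - ∑ j, wedgeGrad N ξ i j x * dcoord j (derivAlong N ξ) x -
      divWedge N ξ i x * derivAlong N ξ x + curvForm N ξ x * N i x) * N i x = 0 := by
  -- The normal component of `(N ∧ ∇ξ) ∇h` is, for unit `N`, `∇ξ · ∇h - h (N · ∇h)`; its terms of
  -- second order match those of the Hessian field.
  have hA : ∑ i, (∑ j, wedgeGrad N ξ i j x * dcoord j (derivAlong N ξ) x) * N i x =
      (∑ i, N i x ^ 2) * ∑ j, dcoord j ξ x * dcoord j (derivAlong N ξ) x -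
        derivAlong N ξ x * ∑ j, N j x * dcoord j (derivAlong N ξ) x := by
    simp only [wedgeGrad, derivAlong, Fin.sum_univ_three]; ring
  have hq : ∑ i, curvForm N ξ x * N i x * N i x = curvForm N ξ x * ∑ i, N i x ^ 2 := by
    rw [Finset.mul_sum]
    exact Finset.sum_congr rfl fun i _ => by ring
  simp only [add_mul, sub_mul, Finset.sum_add_distrib, Finset.sum_sub_distrib]
  rw [hA, hq, hx]
  simp only [dcoord_derivAlong hN hξ, divWedge_eq hN hξ, curvForm, curvCoeff, hessField,
    derivAlong, Fin.sum_univ_three]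
  have h1 := dcoord_comm (i := 0) (j := 1) hξ x
  have h2 := dcoord_comm (i := 0) (j := 2) hξ x
  have h3 := dcoord_comm (i := 1) (j := 2) hξ x
  rw [h1, h2, h3]
  rw [Fin.sum_univ_three] at hx
  -- What remains after the cancellations is `(N · ∇ξ) Δξ (|N|² - 1)`.
  linear_combination (N 0 x * dcoord 0 ξ x + N 1 x * dcoord 1 ξ x + N 2 x * dcoord 2 ξ x) *
    (dcoord 0 (dcoord 0 ξ) x + dcoord 1 (dcoord 1 ξ) x + dcoord 2 (dcoord 2 ξ) x) * hx

end Fields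

/-! ### The second order estimate for smooth functions. -/

/-- The pointwise length of the gradient. -/
noncomputable def gradNorm (ξ : E3 → ℝ) (x : E3) : ℝ := √(∑ i, dcoord i ξ x ^ 2)

/-- The pointwise length of the vector of the first and second derivatives. -/
noncomputable def jetNorm (ξ : E3 → ℝ) (x : E3) : ℝ :=
  √(∑ i, dcoord i ξ x ^ 2 + ∑ k, ∑ i, dcoord k (dcoord i ξ) x ^ 2)

theorem gradNorm_nonneg (ξ : E3 → ℝ) (x : E3) : 0 ≤ gradNorm ξ x := Real.sqrt_nonneg _

theorem jetNorm_nonneg (ξ : E3 → ℝ) (x : E3) : 0 ≤ jetNorm ξ x := Real.sqrt_nonneg _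

theorem sq_gradNorm (ξ : E3 → ℝ) (x : E3) : gradNorm ξ x ^ 2 = ∑ i, dcoord i ξ x ^ 2 :=
  Real.sq_sqrt (by positivity)

theorem sq_jetNorm (ξ : E3 → ℝ) (x : E3) : jetNorm ξ x ^ 2 =
    ∑ i, dcoord i ξ x ^ 2 + ∑ k, ∑ i, dcoord k (dcoord i ξ) x ^ 2 :=
  Real.sq_sqrt (by positivity)

theorem gradNorm_le_jetNorm (ξ : E3 → ℝ) (x : E3) : gradNorm ξ x ≤ jetNorm ξ x :=
  Real.sqrt_le_sqrt (le_add_of_nonneg_right (by positivity))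

theorem abs_dcoord_le_gradNorm (ξ : E3 → ℝ) (i : Fin 3) (x : E3) :
    |dcoord i ξ x| ≤ gradNorm ξ x :=
  Real.abs_le_sqrt (Finset.single_le_sum (f := fun i => dcoord i ξ x ^ 2)
    (fun _ _ => sq_nonneg _) (Finset.mem_univ i))

theorem abs_dcoord_dcoord_le_jetNorm (ξ : E3 → ℝ) (k i : Fin 3) (x : E3) :
    |dcoord k (dcoord i ξ) x| ≤ jetNorm ξ x := by
  refine Real.abs_le_sqrt ?_
  have h1 : dcoord k (dcoord i ξ) x ^ 2 ≤ ∑ i, dcoord k (dcoord i ξ) x ^ 2 :=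
    Finset.single_le_sum (f := fun i => dcoord k (dcoord i ξ) x ^ 2)
    (fun _ _ => sq_nonneg _) (Finset.mem_univ i)
  have h2 : ∑ i, dcoord k (dcoord i ξ) x ^ 2 ≤ ∑ k, ∑ i, dcoord k (dcoord i ξ) x ^ 2 :=
    Finset.single_le_sum (f := fun k => ∑ i, dcoord k (dcoord i ξ) x ^ 2)
    (fun _ _ => by positivity) (Finset.mem_univ k)
  have h3 : 0 ≤ ∑ i, dcoord i ξ x ^ 2 := by positivity
  linarith

theorem continuous_gradNorm {ξ : E3 → ℝ} (hξ : ContDiff ℝ ∞ ξ) : Continuous (gradNorm ξ) :=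
  (continuous_finsetSum _ fun i _ => (hξ.dcoord i).continuous.pow 2).sqrt

theorem continuous_jetNorm {ξ : E3 → ℝ} (hξ : ContDiff ℝ ∞ ξ) : Continuous (jetNorm ξ) :=
  ((continuous_finsetSum _ fun i _ => (hξ.dcoord i).continuous.pow 2).add
    (continuous_finsetSum _ fun k _ => continuous_finsetSum _ fun i _ =>
      ((hξ.dcoord i).dcoord k).continuous.pow 2)).sqrt

namespace SmoothBoundedDomain

variable (Ω : SmoothBoundedDomain)

/-- Cauchy–Schwarz: the quadratic polynomial `t ↦ ∫ (f + t g)²` is nonnegative, so its discriminant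
is not positive. -/
theorem sq_integral_mul_le {f g : E3 → ℝ} (hf : Continuous f) (hg : Continuous g) :
    (∫ x in Ω.carrier, f x * g x) ^ 2 ≤
      (∫ x in Ω.carrier, f x ^ 2) * ∫ x in Ω.carrier, g x ^ 2 := by
  have h : ∀ t : ℝ, 0 ≤ (∫ x in Ω.carrier, g x ^ 2) * (t * t) +
      (2 * ∫ x in Ω.carrier, f x * g x) * t + ∫ x in Ω.carrier, f x ^ 2 := by
    intro t
    have h1 : 0 ≤ ∫ x in Ω.carrier, (f x + t * g x) ^ 2 :=
      integral_nonneg fun x => sq_nonneg _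
    have h2 : ∫ x in Ω.carrier, (f x + t * g x) ^ 2 =
        ∫ x in Ω.carrier, (f x ^ 2 + (2 * t) * (f x * g x) + (t * t) * g x ^ 2) :=
      integral_congr_ae (Eventually.of_forall fun x => by ring)
    rw [h2, integral_add, integral_add, integral_const_mul, integral_const_mul] at h1
    · linarith
    all_goals exact Ω.integrable_of_continuous (by fun_prop)
  have := discrim_le_zero h
  rw [discrim] at this
  nlinarith

theorem abs_integral_le_of_abs_le {u f g : E3 → ℝ} {C : ℝ} (hf : Continuous f)
    (hg : Continuous g) (hC : 0 ≤ C) (h : ∀ x ∈ closure Ω.carrier, |u x| ≤ C * (f x * g x)) :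
    |∫ x in Ω.carrier, u x| ≤
      C * √((∫ x in Ω.carrier, f x ^ 2) * ∫ x in Ω.carrier, g x ^ 2) := by
  calc |∫ x in Ω.carrier, u x| ≤ ∫ x in Ω.carrier, C * (f x * g x) := by
        rw [← Real.norm_eq_abs]
        refine norm_integral_le_of_norm_le (Ω.integrable_of_continuous (by fun_prop)) ?_
        filter_upwards [ae_restrict_mem Ω.isOpen.measurableSet] with x hx
          using h x (subset_closure hx)
    _ = C * ∫ x in Ω.carrier, f x * g x := integral_const_mul _ _
    _ ≤ _ := by
      gcongr
      exact Real.le_sqrt_of_sq_le (Ω.sq_integral_mul_le hf hg)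

/-- The Dirichlet integral over the domain. -/
noncomputable def gradSq (ξ : E3 → ℝ) : ℝ := ∫ x in Ω.carrier, ∑ i, dcoord i ξ x ^ 2

/-- The squared `L²` norm of the Hessian. -/
noncomputable def hessSq (ξ : E3 → ℝ) : ℝ :=
  ∫ x in Ω.carrier, ∑ k, ∑ i, dcoord k (dcoord i ξ) x ^ 2

/-- The squared `L²` norm of the Laplacian. -/
noncomputable def lapSq (ξ : E3 → ℝ) : ℝ :=
  ∫ x in Ω.carrier, (∑ i, dcoord i (dcoord i ξ) x) ^ 2

theorem gradSq_nonneg (ξ : E3 → ℝ) : 0 ≤ Ω.gradSq ξ := integral_nonneg fun x => by positivity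

theorem hessSq_nonneg (ξ : E3 → ℝ) : 0 ≤ Ω.hessSq ξ := integral_nonneg fun x => by positivity

theorem integral_sq_gradNorm (ξ : E3 → ℝ) : ∫ x in Ω.carrier, gradNorm ξ x ^ 2 = Ω.gradSq ξ :=
  integral_congr_ae (Eventually.of_forall fun x => sq_gradNorm ξ x)

theorem integral_sq_jetNorm {ξ : E3 → ℝ} (hξ : ContDiff ℝ ∞ ξ) :
    ∫ x in Ω.carrier, jetNorm ξ x ^ 2 = Ω.gradSq ξ + Ω.hessSq ξ := by
  simp only [sq_jetNorm]
  exact integral_add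
    (Ω.integrable_of_continuous (continuous_finsetSum _ fun i _ => (hξ.dcoord i).continuous.pow 2))
    (Ω.integrable_of_continuous (continuous_finsetSum _ fun k _ => continuous_finsetSum _ fun i _ =>
      ((hξ.dcoord i).dcoord k).continuous.pow 2))

/-- The bilinear boundary form `∫ div(N ∧ ∇ζ) · ∇(∂ξ/∂N)`. -/
noncomputable def boundaryForm (N : Fin 3 → E3 → ℝ) (ξ ζ : E3 → ℝ) : ℝ :=
  ∫ x in Ω.carrier, ∑ j, divWedge N ζ j x * dcoord j (derivAlong N ξ) x

variable {N : Fin 3 → E3 → ℝ}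

/-- A linear differential operator of order two whose values are controlled by the first and second
derivatives, uniformly on the domain. -/
def IsJetBounded (T : (E3 → ℝ) → E3 → ℝ) : Prop :=
  ∃ C, 0 ≤ C ∧ ∀ ζ, ContDiff ℝ ∞ ζ → ∀ x ∈ closure Ω.carrier, |T ζ x| ≤ C * jetNorm ζ x

variable {Ω}

theorem IsJetBounded.add {S T : (E3 → ℝ) → E3 → ℝ} (hS : Ω.IsJetBounded S)
    (hT : Ω.IsJetBounded T) : Ω.IsJetBounded fun ζ x => S ζ x + T ζ x := by
  obtain ⟨C, hC, h⟩ := hS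
  obtain ⟨D, hD, k⟩ := hT
  refine ⟨C + D, by positivity, fun ζ hζ x hx => (abs_add_le _ _).trans ?_⟩
  have := h ζ hζ x hx
  have := k ζ hζ x hx
  linarith

theorem IsJetBounded.mul {c : E3 → ℝ} (hc : Continuous c) {T : (E3 → ℝ) → E3 → ℝ}
    (hT : Ω.IsJetBounded T) : Ω.IsJetBounded fun ζ x => c x * T ζ x := by
  obtain ⟨C, hC, h⟩ := Ω.exists_bound hc
  obtain ⟨D, hD, k⟩ := hT
  refine ⟨C * D, by positivity, fun ζ hζ x hx => ?_⟩
  rw [abs_mul, mul_assoc]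
  exact mul_le_mul (h x hx) (k ζ hζ x hx) (abs_nonneg _) hC

theorem IsJetBounded.sub {S T : (E3 → ℝ) → E3 → ℝ} (hS : Ω.IsJetBounded S)
    (hT : Ω.IsJetBounded T) : Ω.IsJetBounded fun ζ x => S ζ x - T ζ x := by
  have := hS.add (hT.mul (c := fun _ => -1) continuous_const)
  simpa [sub_eq_add_neg] using this

theorem IsJetBounded.sum {T : Fin 3 → (E3 → ℝ) → E3 → ℝ} (hT : ∀ i, Ω.IsJetBounded (T i)) :
    Ω.IsJetBounded fun ζ x => ∑ i, T i ζ x := by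
  simp only [Fin.sum_univ_three]
  exact ((hT 0).add (hT 1)).add (hT 2)

theorem isJetBounded_dcoord (i : Fin 3) : Ω.IsJetBounded fun ζ => dcoord i ζ :=
  ⟨1, zero_le_one, fun ζ _ x _ => by
    rw [one_mul]; exact (abs_dcoord_le_gradNorm ζ i x).trans (gradNorm_le_jetNorm ζ x)⟩

theorem isJetBounded_dcoord_dcoord (k i : Fin 3) :
    Ω.IsJetBounded fun ζ => dcoord k (dcoord i ζ) :=
  ⟨1, zero_le_one, fun ζ _ x _ => by
    rw [one_mul]; exact abs_dcoord_dcoord_le_jetNorm ζ k i x⟩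

theorem IsJetBounded.congr {S T : (E3 → ℝ) → E3 → ℝ} (hS : Ω.IsJetBounded S)
    (h : ∀ ζ, ContDiff ℝ ∞ ζ → ∀ x, T ζ x = S ζ x) : Ω.IsJetBounded T := by
  obtain ⟨C, hC, k⟩ := hS
  exact ⟨C, hC, fun ζ hζ x hx => by rw [h ζ hζ]; exact k ζ hζ x hx⟩

theorem isJetBounded_dcoord_derivAlong (hN : ∀ i, ContDiff ℝ ∞ (N i)) (j : Fin 3) :
    Ω.IsJetBounded fun ζ => dcoord j (derivAlong N ζ) :=
  (IsJetBounded.sum fun k => ((isJetBounded_dcoord k).mul ((hN k).dcoord j).continuous).add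
    ((isJetBounded_dcoord_dcoord j k).mul (hN k).continuous)).congr
    fun _ hζ x => dcoord_derivAlong hN hζ j x

theorem isJetBounded_divWedge (hN : ∀ i, ContDiff ℝ ∞ (N i)) (j : Fin 3) :
    Ω.IsJetBounded fun ζ => divWedge N ζ j :=
  (IsJetBounded.sum fun i => (((isJetBounded_dcoord j).mul ((hN i).dcoord i).continuous).add
    ((isJetBounded_dcoord_dcoord i j).mul (hN i).continuous)).sub
    (((isJetBounded_dcoord i).mul ((hN j).dcoord i).continuous).add
    ((isJetBounded_dcoord_dcoord i i).mul (hN j).continuous))).congr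
    fun _ hζ x => divWedge_eq hN hζ j x

/-- Both factors of the integrand involve only first and second derivatives, with coefficients
bounded on the closure. The resulting `H²` continuity is what permits replacing one argument of the
form by a nearby function. -/
theorem exists_abs_boundaryForm_le (Ω : SmoothBoundedDomain) (hN : ∀ i, ContDiff ℝ ∞ (N i)) :
    ∃ C, 0 ≤ C ∧ ∀ ξ ζ, ContDiff ℝ ∞ ξ → ContDiff ℝ ∞ ζ →
      |Ω.boundaryForm N ξ ζ| ≤
        C * √((Ω.gradSq ζ + Ω.hessSq ζ) * (Ω.gradSq ξ + Ω.hessSq ξ)) := by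
  choose C hC hCb using isJetBounded_divWedge (Ω := Ω) hN
  choose D hD hDb using isJetBounded_dcoord_derivAlong (Ω := Ω) hN
  refine ⟨∑ j, C j * D j, Finset.sum_nonneg fun j _ => mul_nonneg (hC j) (hD j),
    fun ξ ζ hξ hζ => ?_⟩
  rw [← Ω.integral_sq_jetNorm hξ, ← Ω.integral_sq_jetNorm hζ]
  refine Ω.abs_integral_le_of_abs_le (continuous_jetNorm hζ) (continuous_jetNorm hξ)
    (Finset.sum_nonneg fun j _ => mul_nonneg (hC j) (hD j)) fun x hx => ?_
  rw [Finset.sum_mul]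
  refine (Finset.abs_sum_le_sum_abs _ _).trans (Finset.sum_le_sum fun j _ => ?_)
  rw [abs_mul]
  calc _ ≤ (C j * jetNorm ζ x) * (D j * jetNorm ξ x) :=
        mul_le_mul (hCb j ζ hζ x hx) (hDb j ξ hξ x hx) (abs_nonneg _)
          (mul_nonneg (hC j) (jetNorm_nonneg _ _))
    _ = _ := by ring

theorem boundaryForm_sub (Ω : SmoothBoundedDomain) (hN : ∀ i, ContDiff ℝ ∞ (N i))
    {ξ ζ ζ' : E3 → ℝ} (hξ : ContDiff ℝ ∞ ξ) (hζ : ContDiff ℝ ∞ ζ) (hζ' : ContDiff ℝ ∞ ζ') :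
    Ω.boundaryForm N ξ (fun x => ζ x - ζ' x) =
      Ω.boundaryForm N ξ ζ - Ω.boundaryForm N ξ ζ' := by
  have hd : ∀ i, dcoord i (fun x => ζ x - ζ' x) = fun x => dcoord i ζ x - dcoord i ζ' x :=
    fun i => funext fun x => dcoord_sub hζ hζ' x
  have hc : ∀ {ζ}, ContDiff ℝ ∞ ζ → Integrable (fun x =>
      ∑ j, divWedge N ζ j x * dcoord j (derivAlong N ξ) x) Ω.vol := fun hζ =>
    Ω.integrable_of_continuous (continuous_finsetSum _ fun j _ =>
      (contDiff_divWedge hN hζ j).continuous.mul ((contDiff_derivAlong hN hξ).dcoord j).continuous)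
  unfold boundaryForm
  rw [← integral_sub (hc hζ) (hc hζ')]
  refine integral_congr_ae (Eventually.of_forall fun x => ?_)
  simp only
  rw [← Finset.sum_sub_distrib]
  refine Finset.sum_congr rfl fun j _ => ?_
  rw [← sub_mul, divWedge_eq hN (hζ.sub hζ'), divWedge_eq hN hζ, divWedge_eq hN hζ',
    ← Finset.sum_sub_distrib]
  congr 1
  refine Finset.sum_congr rfl fun i _ => ?_
  rw [hd, hd, dcoord_sub (hζ.dcoord j) (hζ'.dcoord j), dcoord_sub (hζ.dcoord i) (hζ'.dcoord i)]
  ring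

/-- After expanding the divergence, each term is quadratic in the derivatives of `ξ` and contains at
least one first derivative. The Hessian thus enters to the power one instead of two, so that the
term can be absorbed later. -/
theorem exists_abs_integral_curvForm_le (Ω : SmoothBoundedDomain)
    (hN : ∀ i, ContDiff ℝ ∞ (N i)) :
    ∃ C, 0 ≤ C ∧ ∀ ξ, ContDiff ℝ ∞ ξ →
      |∫ x in Ω.carrier, ∑ k, dcoord k (fun y => curvForm N ξ y * N k y) x| ≤
        C * √(Ω.gradSq ξ * (Ω.gradSq ξ + Ω.hessSq ξ)) := by
  have hw := contDiff_curvCoeff hN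
  have hsm : ∀ k a b, ContDiff ℝ ∞ fun y => curvCoeff N a b y * N k y := fun k a b =>
    (hw a b).mul (hN k)
  choose C hC hCb using fun k a b => Ω.exists_bound (hsm k a b).continuous
  choose D hD hDb using fun k a b => Ω.exists_bound ((hsm k a b).dcoord k).continuous
  have hpos : 0 ≤ ∑ k, ∑ a, ∑ b, (D k a b + 2 * C k a b) :=
    Finset.sum_nonneg fun k _ => Finset.sum_nonneg fun a _ => Finset.sum_nonneg fun b _ =>
      add_nonneg (hD k a b) (mul_nonneg two_pos.le (hC k a b))
  refine ⟨∑ k, ∑ a, ∑ b, (D k a b + 2 * C k a b), hpos, fun ξ hξ => ?_⟩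
  rw [← Ω.integral_sq_jetNorm hξ, ← Ω.integral_sq_gradNorm ξ]
  refine Ω.abs_integral_le_of_abs_le (continuous_gradNorm hξ) (continuous_jetNorm hξ) hpos
    fun x hx => ?_
  have e : ∀ k, dcoord k (fun y => curvForm N ξ y * N k y) x = ∑ a, ∑ b,
      (dcoord k (fun y => curvCoeff N a b y * N k y) x * (dcoord a ξ x * dcoord b ξ x) +
      (curvCoeff N a b x * N k x) * (dcoord k (dcoord a ξ) x * dcoord b ξ x +
        dcoord a ξ x * dcoord k (dcoord b ξ) x)) := by
    intro k
    have e1 : (fun y => curvForm N ξ y * N k y) = fun y => ∑ a, ∑ b,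
        (curvCoeff N a b y * N k y) * (dcoord a ξ y * dcoord b ξ y) := by
      funext y
      simp only [curvForm, Finset.sum_mul]
      exact Finset.sum_congr rfl fun a _ => Finset.sum_congr rfl fun b _ => by ring
    rw [e1, dcoord_sum _ fun a => ContDiff.sum fun b _ =>
      (hsm k a b).mul ((hξ.dcoord a).mul (hξ.dcoord b))]
    refine Finset.sum_congr rfl fun a _ => ?_
    rw [dcoord_sum _ fun b => (hsm k a b).mul ((hξ.dcoord a).mul (hξ.dcoord b))]
    refine Finset.sum_congr rfl fun b _ => ?_
    rw [dcoord_mul (hsm k a b) ((hξ.dcoord a).mul (hξ.dcoord b)),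
      dcoord_mul (hξ.dcoord a) (hξ.dcoord b)]
  have hp := gradNorm_nonneg ξ x
  have hj := jetNorm_nonneg ξ x
  have hpj := gradNorm_le_jetNorm ξ x
  simp only [e, Finset.sum_mul]
  refine (Finset.abs_sum_le_sum_abs _ _).trans (Finset.sum_le_sum fun k _ => ?_)
  refine (Finset.abs_sum_le_sum_abs _ _).trans (Finset.sum_le_sum fun a _ => ?_)
  refine (Finset.abs_sum_le_sum_abs _ _).trans (Finset.sum_le_sum fun b _ => ?_)
  have ha := abs_dcoord_le_gradNorm ξ a x
  have hb := abs_dcoord_le_gradNorm ξ b x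
  have hka := abs_dcoord_dcoord_le_jetNorm ξ k a x
  have hkb := abs_dcoord_dcoord_le_jetNorm ξ k b x
  have t1 : |dcoord a ξ x * dcoord b ξ x| ≤ gradNorm ξ x * jetNorm ξ x := by
    rw [abs_mul]; exact mul_le_mul ha (hb.trans hpj) (abs_nonneg _) hp
  have t2 : |dcoord k (dcoord a ξ) x * dcoord b ξ x + dcoord a ξ x * dcoord k (dcoord b ξ) x| ≤
      2 * (gradNorm ξ x * jetNorm ξ x) := by
    refine (abs_add_le _ _).trans ?_
    rw [abs_mul, abs_mul]
    have u1 := mul_le_mul hka hb (abs_nonneg _) hj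
    have u2 := mul_le_mul ha hkb (abs_nonneg _) hp
    linarith
  refine (abs_add_le _ _).trans ?_
  rw [abs_mul _ (dcoord a ξ x * dcoord b ξ x),
    abs_mul (curvCoeff N a b x * N k x)]
  have u1 := mul_le_mul (hDb k a b x hx) t1 (abs_nonneg _) (hD k a b)
  have u2 := mul_le_mul (hCb k a b x hx) t2 (abs_nonneg _) (hC k a b)
  linarith

/-- Integrating the Hessian identity over the domain. -/
theorem hessSq_eq (Ω : SmoothBoundedDomain) (hN : ∀ i, ContDiff ℝ ∞ (N i))
    (hNn : ∀ x ∈ frontier Ω.carrier, ∀ i, N i x = outwardNormal Ω.carrier x i)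
    {ξ : E3 → ℝ} (hξ : ContDiff ℝ ∞ ξ) :
    Ω.hessSq ξ = Ω.lapSq ξ + 2 * Ω.boundaryForm N ξ ξ -
      ∫ x in Ω.carrier, ∑ k, dcoord k (fun y => curvForm N ξ y * N k y) x := by
  have hh := contDiff_derivAlong hN hξ
  have s1 := contDiff_hessField hξ
  have s2 : ∀ i, ContDiff ℝ ∞ fun y =>
      ∑ j, wedgeGrad N ξ i j y * dcoord j (derivAlong N ξ) y := fun i =>
    ContDiff.sum fun j _ => (contDiff_wedgeGrad hN hξ i j).mul (hh.dcoord j)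
  have s3 : ∀ i, ContDiff ℝ ∞ fun y => divWedge N ξ i y * derivAlong N ξ y := fun i =>
    (contDiff_divWedge hN hξ i).mul hh
  have s4 : ∀ i, ContDiff ℝ ∞ fun y => curvForm N ξ y * N i y := fun i =>
    (contDiff_curvForm hN hξ).mul (hN i)
  have hone : ∀ x ∈ frontier Ω.carrier, ∑ i, N i x ^ 2 = 1 := by
    intro x hx
    obtain ⟨ρ, hρ⟩ := Ω.exists_isGlobalDefiningFunction
    have h1 : ‖outwardNormal Ω.carrier x‖ ^ 2 = 1 := by
      rw [outwardNormal_eq (hρ.isLocal hx) hx, norm_smul, norm_inv, norm_norm,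
        inv_mul_cancel₀ (norm_ne_zero_iff.2 (hρ.gradient_ne_zero x hx)), one_pow]
    rw [EuclideanSpace.norm_sq_eq] at h1
    simpa [hNn x hx] using h1
  have hdiv := integral_divergence_eq_zero_of_tangent (Ω := Ω)
    (fun i => (((s1 i).sub (s2 i)).sub (s3 i)).add (s4 i)) (fun x hx => by
      have := tangent_identity hN hξ (hone x hx)
      simpa only [hNn x hx] using this)
  have hexp : ∀ x, ∑ i, dcoord i (fun y => hessField ξ i y -
      (∑ j, wedgeGrad N ξ i j y * dcoord j (derivAlong N ξ) y) -
      divWedge N ξ i y * derivAlong N ξ y + curvForm N ξ y * N i y) x =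
      (∑ k, ∑ i, dcoord k (dcoord i ξ) x ^ 2 - (∑ i, dcoord i (dcoord i ξ) x) ^ 2) -
      2 * (∑ j, divWedge N ξ j x * dcoord j (derivAlong N ξ) x) +
      ∑ k, dcoord k (fun y => curvForm N ξ y * N k y) x := by
    intro x
    have : ∀ i, dcoord i (fun y => hessField ξ i y -
      (∑ j, wedgeGrad N ξ i j y * dcoord j (derivAlong N ξ) y) -
      divWedge N ξ i y * derivAlong N ξ y + curvForm N ξ y * N i y) x =
      dcoord i (hessField ξ i) x -
      dcoord i (fun y => ∑ j, wedgeGrad N ξ i j y * dcoord j (derivAlong N ξ) y) x -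
      dcoord i (fun y => divWedge N ξ i y * derivAlong N ξ y) x +
      dcoord i (fun y => curvForm N ξ y * N i y) x := fun i => by
      rw [dcoord_add (((s1 i).sub (s2 i)).sub (s3 i)) (s4 i), dcoord_sub ((s1 i).sub (s2 i)) (s3 i),
        dcoord_sub (s1 i) (s2 i)]
    rw [Finset.sum_congr rfl fun i _ => this i, Finset.sum_add_distrib, Finset.sum_sub_distrib,
      Finset.sum_sub_distrib, sum_dcoord_hessField hξ, sum_dcoord_wedgeGrad_mul hN hξ hh,
      sum_dcoord_mul_divWedge hN hξ hh]
    ring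
  have c1 : Continuous fun x => ∑ k, ∑ i, dcoord k (dcoord i ξ) x ^ 2 :=
    continuous_finsetSum _ fun k _ => continuous_finsetSum _ fun i _ =>
      ((hξ.dcoord i).dcoord k).continuous.pow 2
  have c2 : Continuous fun x => (∑ i, dcoord i (dcoord i ξ) x) ^ 2 :=
    (continuous_finsetSum _ fun i _ => ((hξ.dcoord i).dcoord i).continuous).pow 2
  have c3 : Continuous fun x => ∑ j, divWedge N ξ j x * dcoord j (derivAlong N ξ) x :=
    continuous_finsetSum _ fun j _ => (contDiff_divWedge hN hξ j).continuous.mul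
      (hh.dcoord j).continuous
  have c4 : Continuous fun x => ∑ k, dcoord k (fun y => curvForm N ξ y * N k y) x :=
    continuous_finsetSum _ fun k _ => ((s4 k).dcoord k).continuous
  rw [integral_congr_ae (Eventually.of_forall hexp), integral_add, integral_sub, integral_sub,
    integral_const_mul] at hdiv
  · unfold hessSq lapSq boundaryForm
    linarith
  all_goals exact Ω.integrable_of_continuous (by fun_prop)

end SmoothBoundedDomain

namespace SmoothBoundedDomain

variable {Ω : SmoothBoundedDomain} {N : Fin 3 → E3 → ℝ}

/-- Since `divWedge N ζ` is divergence free, the integrand is the divergence of that field times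
`∂ξ_k/∂N`, and the flux estimate applies. Its constant depends on the fixed `ζ`, so the diagonal
case needs a further argument. -/
theorem tendsto_boundaryForm (hN : ∀ i, ContDiff ℝ ∞ (N i)) {ξ : ℕ → E3 → ℝ}
    (hξ : ∀ k, ContDiff ℝ ∞ (ξ k))
    (hn : Tendsto (fun k => eLpNorm (derivAlong N (ξ k)) 2 Ω.surface) atTop (𝓝 0))
    {ζ : E3 → ℝ} (hζ : ContDiff ℝ ∞ ζ) :
    Tendsto (fun k => Ω.boundaryForm N (ξ k) ζ) atTop (𝓝 0) := by
  refine (tendsto_integral_divergence_mul (Ω := Ω) (contDiff_divWedge hN hζ)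
    (fun k => contDiff_derivAlong hN (hξ k)) hn).congr fun k => ?_
  exact integral_congr_ae (Eventually.of_forall fun x =>
    sum_dcoord_mul_divWedge hN hζ (contDiff_derivAlong hN (hξ k)) x)

/-- One writes `ξ_k = (ξ_k - ξ_M) + ξ_M` in the second argument: the difference is small in `H²`
uniformly in `k ≥ M`, and the fixed `ξ_M` falls under the previous lemma. -/
theorem tendsto_boundaryForm_self (hN : ∀ i, ContDiff ℝ ∞ (N i)) {ξ : ℕ → E3 → ℝ}
    (hξ : ∀ k, ContDiff ℝ ∞ (ξ k))
    (hn : Tendsto (fun k => eLpNorm (derivAlong N (ξ k)) 2 Ω.surface) atTop (𝓝 0))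
    {B : ℝ} (hB : ∀ k, Ω.gradSq (ξ k) + Ω.hessSq (ξ k) ≤ B)
    (hC : ∀ ε > 0, ∃ M : ℕ, ∀ k ≥ M, ∀ m ≥ M, Ω.gradSq (fun x => ξ k x - ξ m x) +
      Ω.hessSq (fun x => ξ k x - ξ m x) < ε) :
    Tendsto (fun k => Ω.boundaryForm N (ξ k) (ξ k)) atTop (𝓝 0) := by
  obtain ⟨C, hC0, hCb⟩ := exists_abs_boundaryForm_le Ω hN
  have hB0 : 0 ≤ B := (add_nonneg (Ω.gradSq_nonneg _) (Ω.hessSq_nonneg _)).trans (hB 0)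
  rw [Metric.tendsto_atTop]
  intro ε hε
  -- Solves `√(δ (B + 1)) = ε / 2 / (C + 1)`; the added ones only prevent division by zero.
  set δ := (ε / 2 / (C + 1)) ^ 2 / (B + 1) with hδ
  have hδ0 : 0 < δ := by positivity
  obtain ⟨M, hM⟩ := hC δ hδ0
  obtain ⟨M', hM'⟩ := Metric.tendsto_atTop.1 (tendsto_boundaryForm (Ω := Ω) hN hξ hn (hξ M)) (ε / 2)
    (half_pos hε)
  refine ⟨max M M', fun k hk => ?_⟩
  have h1 := hM' k (le_of_max_le_right hk)
  have h2 := hM k (le_of_max_le_left hk) M le_rfl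
  have h3 := boundaryForm_sub Ω hN (hξ k) (hξ k) (hξ M)
  have h4 := hCb (ξ k) (fun x => ξ k x - ξ M x) (hξ k) ((hξ k).sub (hξ M))
  have h5 : √((Ω.gradSq (fun x => ξ k x - ξ M x) + Ω.hessSq (fun x => ξ k x - ξ M x)) *
      (Ω.gradSq (ξ k) + Ω.hessSq (ξ k))) ≤ ε / 2 / (C + 1) := by
    rw [Real.sqrt_le_left (by positivity)]
    calc _ ≤ δ * (B + 1) := mul_le_mul h2.le ((hB k).trans (by linarith))
          (add_nonneg (Ω.gradSq_nonneg _) (Ω.hessSq_nonneg _)) hδ0.le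
      _ = _ := by rw [hδ]; field_simp
  have h6 : C * (ε / 2 / (C + 1)) ≤ ε / 2 := by
    rw [← mul_div_assoc, div_le_iff₀ (by positivity)]
    nlinarith
  rw [Real.dist_eq, sub_zero] at h1 ⊢
  have h7 : |Ω.boundaryForm N (ξ k) (ξ k) - Ω.boundaryForm N (ξ k) (ξ M)| ≤ ε / 2 := by
    rw [← h3]
    exact h4.trans ((mul_le_mul_of_nonneg_left h5 hC0).trans h6)
  have h8 := abs_add_le (Ω.boundaryForm N (ξ k) (ξ k) - Ω.boundaryForm N (ξ k) (ξ M))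
    (Ω.boundaryForm N (ξ k) (ξ M))
  rw [sub_add_cancel] at h8
  linarith

/-- The second order estimate for the Neumann problem, for smooth approximations whose normal
derivatives tend to zero on the boundary. -/
theorem exists_hessSq_le (Ω : SmoothBoundedDomain) :
    ∃ C, 0 ≤ C ∧ ∀ ξ : ℕ → E3 → ℝ, (∀ k, ContDiff ℝ ∞ (ξ k)) →
      Tendsto (fun k => eLpNorm (normalDeriv Ω.carrier (ξ k)) 2 Ω.surface) atTop (𝓝 0) →
      (∃ B, ∀ k, Ω.gradSq (ξ k) + Ω.hessSq (ξ k) ≤ B) →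
      (∀ ε > 0, ∃ M : ℕ, ∀ k ≥ M, ∀ m ≥ M, Ω.gradSq (fun x => ξ k x - ξ m x) +
        Ω.hessSq (fun x => ξ k x - ξ m x) < ε) →
      ∃ s : ℕ → ℝ, Tendsto s atTop (𝓝 0) ∧
        ∀ k, Ω.hessSq (ξ k) ≤ C * (Ω.lapSq (ξ k) + Ω.gradSq (ξ k)) + s k := by
  obtain ⟨N, hN, hNn⟩ := Ω.exists_normal_field
  obtain ⟨C, hC0, hC⟩ := exists_abs_integral_curvForm_le Ω hN
  refine ⟨2 + C ^ 2, by positivity, fun ξ hξ hn ⟨B, hB⟩ hcau => ?_⟩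
  have hn' : Tendsto (fun k => eLpNorm (derivAlong N (ξ k)) 2 Ω.surface) atTop (𝓝 0) := by
    refine hn.congr fun k => eLpNorm_congr_ae ?_
    filter_upwards [ae_restrict_mem isClosed_frontier.measurableSet] with x hx
    rw [normalDeriv, fderiv_apply_eq_sum_dcoord, derivAlong]
    exact Finset.sum_congr rfl fun i _ => by rw [hNn x hx]
  refine ⟨fun k => 4 * Ω.boundaryForm N (ξ k) (ξ k), ?_, fun k => ?_⟩
  · simpa using (tendsto_boundaryForm_self hN hξ hn' hB hcau).const_mul 4
  · have h1 := hessSq_eq Ω hN hNn (hξ k)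
    have h2 := (neg_le_abs _).trans (hC (ξ k) (hξ k))
    have hg := Ω.gradSq_nonneg (ξ k)
    have hH := Ω.hessSq_nonneg (ξ k)
    have hL : 0 ≤ Ω.lapSq (ξ k) := integral_nonneg fun x => sq_nonneg _
    -- Young's inequality leaves half of the Hessian term to be absorbed on the left. Doubling the
    -- inequality then yields the factor `4` before the boundary form and the constant `2 + C ^ 2`.
    have h3 : C * √(Ω.gradSq (ξ k) * (Ω.gradSq (ξ k) + Ω.hessSq (ξ k))) ≤
        (C ^ 2 * Ω.gradSq (ξ k) + (Ω.gradSq (ξ k) + Ω.hessSq (ξ k))) / 2 := by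
      rw [Real.sqrt_mul hg]
      have e1 := Real.sq_sqrt hg
      have e2 := Real.sq_sqrt (add_nonneg hg hH)
      nlinarith [sq_nonneg (C * √(Ω.gradSq (ξ k)) - √(Ω.gradSq (ξ k) + Ω.hessSq (ξ k)))]
    nlinarith [mul_nonneg (sq_nonneg C) hL]

end SmoothBoundedDomain

/-! ### The Sobolev inequality on the domain. -/

theorem norm_gradient_eq_gradNorm (ξ : E3 → ℝ) (x : E3) : ‖gradient ξ x‖ = gradNorm ξ x := by
  rw [EuclideanSpace.norm_eq, gradNorm]
  congr 1
  exact Finset.sum_congr rfl fun i _ => by rw [gradient_apply, Real.norm_eq_abs, sq_abs]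

theorem abs_fderiv_apply_le_gradNorm (ξ : E3 → ℝ) (x v : E3) :
    |fderiv ℝ ξ x v| ≤ ‖v‖ * gradNorm ξ x := by
  have : fderiv ℝ ξ x v = inner ℝ (gradient ξ x) v := by
    rw [gradient, InnerProductSpace.toDual_symm_apply]
  rw [this, mul_comm, ← norm_gradient_eq_gradNorm]
  exact abs_real_inner_le_norm _ _

theorem gradNorm_eq_norm_fderiv (ξ : E3 → ℝ) (x : E3) : gradNorm ξ x = ‖fderiv ℝ ξ x‖ := by
  rw [← norm_gradient_eq_gradNorm, gradient, LinearIsometryEquiv.norm_map]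

theorem hasDerivAt_line {f : E3 → ℝ} (hf : ContDiff ℝ ∞ f) (p e : E3) (s : ℝ) :
    HasDerivAt (fun s : ℝ => f (p + s • e)) (fderiv ℝ f (p + s • e) e) s := by
  have hl : HasDerivAt (fun s : ℝ => p + s • e) e s := by
    simpa using ((hasDerivAt_id s).smul_const e).const_add p
  exact ((smooth_differentiable hf) _).hasFDerivAt.comp_hasDerivAt s hl

/-- Along the half-line from `p` in direction `e` the function `φ` eventually vanishes, so `φ p` is
minus the integral of its derivative. Where the derivative is nonzero the half-line is in `B`, hence
in `S` by stability: only values of the gradient in `S` are used. -/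
theorem enorm_indicator_le_lintegral_line {S : Set E3} {φ : E3 → ℝ} {B : Set E3} {e : E3}
    (he : e ≠ 0) (hφ : ContDiff ℝ ∞ φ) (hφc : HasCompactSupport φ) (hB : tsupport φ ⊆ B)
    (hS : ∀ p ∈ S, p ∈ B → ∀ t : ℝ, 0 ≤ t → p + t • e ∈ B → p + t • e ∈ S) (p : E3) :
    ‖S.indicator φ p‖ₑ ≤ ENNReal.ofReal ‖e‖ * ∫⁻ s : ℝ, ‖S.indicator (gradNorm φ) (p + s • e)‖ₑ := by
  by_cases hpS : p ∈ S
  swap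
  · simp [hpS]
  by_cases hp0 : φ p = 0
  · simp [hpS, hp0]
  have hpB : p ∈ B := hB (subset_tsupport φ hp0)
  have hsm : ContDiff ℝ 1 fun s : ℝ => φ (p + s • e) :=
    (hφ.of_le (by norm_cast)).comp (by fun_prop)
  have hcs : HasCompactSupport fun s : ℝ => φ (p + s • e) := by
    obtain ⟨R, hR⟩ := hφc.isBounded.exists_norm_le
    have hpos := norm_pos_iff.2 he
    refine HasCompactSupport.of_support_subset_isCompact
      (isCompact_Icc (a := -((R + ‖p‖) / ‖e‖)) (b := (R + ‖p‖) / ‖e‖)) ?_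
    intro s hs
    have h1 := hR _ (subset_tsupport φ hs)
    have h2 : |s| * ‖e‖ ≤ R + ‖p‖ := by
      calc |s| * ‖e‖ = ‖(p + s • e) - p‖ := by rw [add_sub_cancel_left, norm_smul]; rfl
        _ ≤ ‖p + s • e‖ + ‖p‖ := norm_sub_le _ _
        _ ≤ R + ‖p‖ := by gcongr
    exact abs_le.1 ((le_div_iff₀ hpos).2 h2)
  have hftc := hcs.integral_Ioi_deriv_eq hsm 0
  simp only [zero_smul, add_zero] at hftc
  rw [Set.indicator_of_mem hpS, ← enorm_neg, ← hftc, ← lintegral_const_mul' _ _ ENNReal.ofReal_ne_top]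
  refine (enorm_integral_le_lintegral_enorm _).trans
    ((setLIntegral_mono' measurableSet_Ioi fun s hs => ?_).trans (setLIntegral_le_lintegral _ _))
  rw [(hasDerivAt_line hφ p e s).deriv]
  by_cases hs0 : fderiv ℝ φ (p + s • e) = 0
  · simp [hs0]
  · have hmem : p + s • e ∈ S := by
      refine hS p hpS hpB s (le_of_lt hs) (hB (support_fderiv_subset ℝ hs0))
    rw [Set.indicator_of_mem hmem, Real.enorm_eq_ofReal_abs, Real.enorm_eq_ofReal_abs,
      ← ENNReal.ofReal_mul (norm_nonneg _), abs_of_nonneg (gradNorm_nonneg _ _)]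
    exact ENNReal.ofReal_le_ofReal (abs_fderiv_apply_le_gradNorm _ _ _)

/-- A Gagliardo inequality on a set that is stable, within an open set containing the support, under
moving in three independent directions. -/
theorem exists_lintegral_rpow_le_of_directions {S B : Set E3} (hSm : MeasurableSet S)
    (T : (Fin 3 → ℝ) ≃L[ℝ] E3)
    (hS : ∀ i, ∀ p ∈ S, p ∈ B → ∀ t : ℝ, 0 ≤ t → p + t • T (Pi.single i 1) ∈ B →
      p + t • T (Pi.single i 1) ∈ S) :
    ∃ K : ℝ≥0∞, K ≠ ⊤ ∧ ∀ φ : E3 → ℝ, ContDiff ℝ ∞ φ → HasCompactSupport φ → tsupport φ ⊆ B →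
      ∫⁻ p in S, ‖φ p‖ₑ ^ (3 / 2 : ℝ) ≤ K * (∫⁻ p in S, ‖gradNorm φ p‖ₑ) ^ (3 / 2 : ℝ) := by
  -- The map `T` changes Lebesgue measure by a constant factor only; uniqueness of Haar measure
  -- avoids computing determinants.
  obtain ⟨c, hc⟩ : ∃ c : NNReal, (volume : Measure E3) = c • Measure.map T volume :=
    ⟨_, Measure.isAddLeftInvariant_eq_smul _ _⟩
  obtain ⟨d, hd⟩ : ∃ d : NNReal, Measure.map T volume = d • (volume : Measure E3) :=
    ⟨_, Measure.isAddLeftInvariant_eq_smul _ _⟩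
  set M : ℝ≥0∞ := ∑ i, ENNReal.ofReal ‖T (Pi.single i 1)‖ with hM
  have hMtop : M ≠ ⊤ := by simp [hM]
  refine ⟨c * (M * d) ^ (3 / 2 : ℝ), ENNReal.mul_ne_top (by simp)
    (ENNReal.rpow_ne_top_of_nonneg (by norm_num) (ENNReal.mul_ne_top hMtop (by simp))), ?_⟩
  intro φ hφ hφc hsupp
  have hTm : Measurable T := T.continuous.measurable
  have hum : Measurable (S.indicator φ) := hφ.continuous.measurable.indicator hSm
  have hgm : Measurable (S.indicator (gradNorm φ)) :=
    (continuous_gradNorm hφ).measurable.indicator hSm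
  set f : (Fin 3 → ℝ) → ℝ≥0∞ := fun t => M * ‖S.indicator (gradNorm φ) (T t)‖ₑ with hf
  have hfm : Measurable f := ((hgm.comp hTm).enorm).const_mul M
  have hline : ∀ t i, ‖S.indicator φ (T t)‖ₑ ≤ ∫⁻ s, f (Function.update t i s) := by
    intro t i
    have he : T (Pi.single i 1) ≠ 0 := by simp
    refine (enorm_indicator_le_lintegral_line he hφ hφc hsupp (hS i) (T t)).trans ?_
    have e1 : ∀ s, T (Function.update t i s) = T t + (s - t i) • T (Pi.single i 1) := by
      intro s
      rw [← T.map_smul, ← T.map_add]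
      congr 1
      ext j
      by_cases hj : j = i
      · subst hj; simp
      · simp [hj]
    have e2 : ∫⁻ s, f (Function.update t i s) =
        ∫⁻ s : ℝ, M * ‖S.indicator (gradNorm φ) (T t + s • T (Pi.single i 1))‖ₑ := by
      simp only [hf, e1]
      exact lintegral_sub_right_eq_self (μ := (volume : Measure ℝ))
        (fun s : ℝ => M * ‖S.indicator (gradNorm φ) (T t + s • T (Pi.single i 1))‖ₑ) (t i)
    rw [e2, lintegral_const_mul' _ _ hMtop]
    gcongr
    exact Finset.single_le_sum (f := fun i => ENNReal.ofReal ‖T (Pi.single i 1)‖)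
      (fun _ _ => zero_le) (Finset.mem_univ i)
  have hHC : Real.HolderConjugate (Fintype.card (Fin 3) : ℝ) (3 / 2) := by
    rw [Real.holderConjugate_iff]; norm_num
  -- The grid-lines inequality: in three variables, the product of the square roots of the three
  -- line integrals has integral at most the total integral to the power `3/2`.
  have hgrid := lintegral_prod_lintegral_pow_le (fun _ : Fin 3 => (volume : Measure ℝ)) hHC hfm
  have hpt : ∀ t, ‖S.indicator φ (T t)‖ₑ ^ (3 / 2 : ℝ) ≤
      ∏ i, (∫⁻ s, f (Function.update t i s)) ^ ((1 : ℝ) / ((Fintype.card (Fin 3) : ℝ) - 1)) := by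
    intro t
    calc ‖S.indicator φ (T t)‖ₑ ^ (3 / 2 : ℝ) = ∏ _i : Fin 3, ‖S.indicator φ (T t)‖ₑ ^ (1 / 2 : ℝ) := by
          rw [Finset.prod_const, ← ENNReal.rpow_natCast, ← ENNReal.rpow_mul]
          norm_num
      _ ≤ _ := by
          refine Finset.prod_le_prod' fun i _ => ?_
          have : (1 : ℝ) / ((Fintype.card (Fin 3) : ℝ) - 1) = 1 / 2 := by norm_num
          rw [this]
          exact ENNReal.rpow_le_rpow (hline t i) (by norm_num)
  have hl : ∫⁻ p in S, ‖φ p‖ₑ ^ (3 / 2 : ℝ) = c * ∫⁻ t, ‖S.indicator φ (T t)‖ₑ ^ (3 / 2 : ℝ) := by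
    have h0 : ∫⁻ p in S, ‖φ p‖ₑ ^ (3 / 2 : ℝ) = ∫⁻ p, ‖S.indicator φ p‖ₑ ^ (3 / 2 : ℝ) := by
      rw [← lintegral_indicator hSm]
      refine lintegral_congr fun p => ?_
      by_cases hp : p ∈ S <;> simp [hp]
    rw [h0]
    conv_lhs => rw [hc]
    rw [lintegral_smul_measure, lintegral_map (hum.enorm.pow_const _) hTm]
    rfl
  have hr : ∫⁻ t, f t = M * d * ∫⁻ p in S, ‖gradNorm φ p‖ₑ := by
    have h0 : ∫⁻ p in S, ‖gradNorm φ p‖ₑ = ∫⁻ p, ‖S.indicator (gradNorm φ) p‖ₑ := by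
      rw [← lintegral_indicator hSm]
      refine lintegral_congr fun p => ?_
      by_cases hp : p ∈ S <;> simp [hp]
    rw [h0, hf, lintegral_const_mul' _ _ hMtop, mul_assoc]
    congr 1
    rw [← lintegral_map hgm.enorm hTm, hd, lintegral_smul_measure]
    rfl
  rw [hl, mul_assoc]
  gcongr
  rw [← ENNReal.mul_rpow_of_nonneg _ _ (by norm_num), ← hr]
  exact (lintegral_mono hpt).trans hgrid

namespace SmoothBoundedDomain

variable {Ω : SmoothBoundedDomain}

/-- Near a boundary point the domain is stable under moving in directions close to the inward
normal. -/
theorem exists_ball_forall_add_smul_mem (Ω : SmoothBoundedDomain) {x e : E3} {ρ : E3 → ℝ}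
    (hρ : Ω.IsGlobalDefiningFunction ρ) (he : fderiv ℝ ρ x e < 0) :
    ∃ R > 0, ∀ p ∈ Ω.carrier, p ∈ Metric.ball x R → ∀ t : ℝ, 0 ≤ t →
      p + t • e ∈ Metric.ball x R → p + t • e ∈ Ω.carrier := by
  have hc : Continuous fun y => fderiv ℝ ρ y e :=
    (hρ.contDiff.continuous_fderiv (by simp)).clm_apply continuous_const
  obtain ⟨R, hR, hB⟩ := Metric.eventually_nhds_iff_ball.1
    (hc.continuousAt.eventually (gt_mem_nhds he))
  refine ⟨R, hR, fun p hp hpB t ht htB => ?_⟩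
  have hseg : ∀ s ∈ Set.Icc 0 t, p + s • e ∈ Metric.ball x R := by
    intro s hs
    rcases ht.eq_or_lt with rfl | ht0
    · have : s = 0 := le_antisymm hs.2 hs.1
      simpa [this] using hpB
    · have := (convex_ball x R) hpB htB (a := 1 - s / t) (b := s / t)
        (by rw [sub_nonneg, div_le_one ht0]; exact hs.2) (div_nonneg hs.1 ht) (by ring)
      convert this using 1
      rw [smul_add, smul_smul, div_mul_cancel₀ _ ht0.ne']
      module
  have hanti : AntitoneOn (fun s : ℝ => ρ (p + s • e)) (Set.Icc 0 t) := by
    refine antitoneOn_of_deriv_nonpos (convex_Icc 0 t) ?_ ?_ ?_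
    · exact fun s _ => (hasDerivAt_line hρ.contDiff p e s).continuousAt.continuousWithinAt
    · exact fun s _ => (hasDerivAt_line hρ.contDiff p e s).differentiableAt.differentiableWithinAt
    · intro s hs
      rw [(hasDerivAt_line hρ.contDiff p e s).deriv]
      exact (hB _ (hseg s (interior_subset hs))).le
  have := hanti ⟨le_rfl, ht⟩ ⟨ht, le_rfl⟩ ht
  simp only [zero_smul, add_zero] at this
  rw [hρ.mem_iff] at hp ⊢
  linarith

/-- Directions near the inward normal keep points in `Ω` locally, and the inward directions form an
open half-space, which contains a basis: the vectors `v + ε e_i` with `v` the inward gradient. -/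
theorem exists_directions (Ω : SmoothBoundedDomain) {x : E3} (hx : x ∈ closure Ω.carrier) :
    ∃ R > 0, ∃ T : (Fin 3 → ℝ) ≃L[ℝ] E3, ∀ i, ∀ p ∈ Ω.carrier, p ∈ Metric.ball x R →
      ∀ t : ℝ, 0 ≤ t → p + t • T (Pi.single i 1) ∈ Metric.ball x R →
      p + t • T (Pi.single i 1) ∈ Ω.carrier := by
  by_cases hxΩ : x ∈ Ω.carrier
  · obtain ⟨R, hR, hB⟩ := Metric.isOpen_iff.1 Ω.isOpen x hxΩ
    exact ⟨R, hR, (EuclideanSpace.equiv (Fin 3) ℝ).symm, fun i p _ _ t _ h => hB h⟩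
  · have hxf : x ∈ frontier Ω.carrier := by
      rw [Ω.isOpen.frontier_eq]; exact ⟨hx, hxΩ⟩
    obtain ⟨ρ, hρ⟩ := Ω.exists_isGlobalDefiningFunction
    set v := - gradient ρ x with hv
    have hv0 : 0 < ‖v‖ := by
      rw [hv, norm_neg]; exact norm_pos_iff.2 (hρ.gradient_ne_zero x hxf)
    -- The vectors `v + ε e_i` are independent when `ε ≠ 0` and `ε + ∑ v_i ≠ 0`, and `|ε| < ‖v‖`
    -- keeps them inward. Giving `ε` the sign of `∑ v_i` excludes cancellation.
    obtain ⟨ε, hε0, hεv, hεs⟩ : ∃ ε : ℝ, ε ≠ 0 ∧ |ε| < ‖v‖ ∧ ε + ∑ i, v i ≠ 0 := by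
      rcases le_or_gt 0 (∑ i, v i) with h | h
      · exact ⟨‖v‖ / 2, by positivity, by rw [abs_of_pos (by positivity)]; linarith, by positivity⟩
      · refine ⟨-(‖v‖ / 2), by simp [hv0.ne'], by rw [abs_neg, abs_of_pos (by positivity)]; linarith,
          ?_⟩
        have : 0 < ‖v‖ / 2 := by positivity
        linarith
    let T₀ : (Fin 3 → ℝ) →ₗ[ℝ] E3 :=
      { toFun := fun t => ε • WithLp.toLp 2 t + (∑ i, t i) • v
        map_add' := fun s t => by
          simp only [Pi.add_apply, Finset.sum_add_distrib, WithLp.toLp_add]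
          module
        map_smul' := fun c t => by
          simp only [Pi.smul_apply, smul_eq_mul, ← Finset.mul_sum, WithLp.toLp_smul,
            RingHom.id_apply]
          module }
    have hinj : Function.Injective T₀ := by
      rw [← LinearMap.ker_eq_bot, LinearMap.ker_eq_bot']
      intro t ht
      have ht' : ∀ i, ε * t i + (∑ j, t j) * v i = 0 := fun i => by
        have := congrArg (fun w : E3 => w i) ht
        simpa [T₀] using this
      have hsum : (ε + ∑ i, v i) * ∑ j, t j = 0 := by
        have := Finset.sum_congr (rfl : (Finset.univ : Finset (Fin 3)) = _) fun i _ => ht' i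
        rw [Finset.sum_add_distrib, ← Finset.mul_sum, ← Finset.mul_sum] at this
        simp only [Finset.sum_const_zero] at this
        linarith
      have hs0 := (mul_eq_zero.1 hsum).resolve_left hεs
      funext i
      have := ht' i
      rw [hs0, zero_mul, add_zero] at this
      exact (mul_eq_zero.1 this).resolve_left hε0
    let T : (Fin 3 → ℝ) ≃L[ℝ] E3 :=
      (LinearEquiv.ofInjectiveOfFinrankEq T₀ hinj (by simp)).toContinuousLinearEquiv
    have hT : ∀ i, T (Pi.single i 1) = ε • EuclideanSpace.single i 1 + v := by
      intro i
      change T₀ (Pi.single i 1) = _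
      simp [T₀, EuclideanSpace.single]
    have hdir : ∀ i, fderiv ℝ ρ x (T (Pi.single i 1)) < 0 := by
      intro i
      have e1 : fderiv ℝ ρ x (T (Pi.single i 1)) = inner ℝ (gradient ρ x) (T (Pi.single i 1)) := by
        rw [gradient, InnerProductSpace.toDual_symm_apply]
      have e2 : gradient ρ x = -v := by rw [hv, neg_neg]
      rw [e1, e2, hT, inner_neg_left, inner_add_right, inner_smul_right,
        real_inner_self_eq_norm_sq]
      have h1 : |inner ℝ v (EuclideanSpace.single i (1 : ℝ))| ≤ ‖v‖ := by
        have := abs_real_inner_le_norm v (EuclideanSpace.single i (1 : ℝ) : E3)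
        simpa using this
      have h2 : |ε * inner ℝ v (EuclideanSpace.single i (1 : ℝ))| < ‖v‖ * ‖v‖ := by
        rw [abs_mul]
        calc _ ≤ |ε| * ‖v‖ := by gcongr
          _ < _ := by gcongr
      have := neg_abs_le (ε * inner ℝ v (EuclideanSpace.single i (1 : ℝ)))
      nlinarith
    choose R hR hRb using fun i => Ω.exists_ball_forall_add_smul_mem hρ (hdir i)
    refine ⟨Finset.univ.inf' Finset.univ_nonempty R, by simpa using hR, T,
      fun i p hp hpB t ht htB => ?_⟩
    have hle : Finset.univ.inf' Finset.univ_nonempty R ≤ R i := Finset.inf'_le _ (Finset.mem_univ i)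
    exact hRb i p hp (Metric.ball_subset_ball hle hpB) t ht (Metric.ball_subset_ball hle htB)

theorem gradNorm_mul_le {χ ψ : E3 → ℝ} (hχ : ContDiff ℝ ∞ χ) (hψ : ContDiff ℝ ∞ ψ) (x : E3) :
    gradNorm (fun y => χ y * ψ y) x ≤ |χ x| * gradNorm ψ x + |ψ x| * gradNorm χ x := by
  rw [gradNorm_eq_norm_fderiv, gradNorm_eq_norm_fderiv, gradNorm_eq_norm_fderiv,
    fderiv_fun_mul (smooth_differentiable hχ x) (smooth_differentiable hψ x)]
  refine (norm_add_le _ _).trans ?_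
  rw [norm_smul, norm_smul, Real.norm_eq_abs, Real.norm_eq_abs]

/-- The Sobolev inequality `W^{1,1} ⊂ L^{3/2}` on the domain. -/
theorem exists_lintegral_rpow_le (Ω : SmoothBoundedDomain) :
    ∃ K : ℝ≥0∞, K ≠ ⊤ ∧ ∀ ψ : E3 → ℝ, ContDiff ℝ ∞ ψ →
      ∫⁻ p in Ω.carrier, ‖ψ p‖ₑ ^ (3 / 2 : ℝ) ≤
        K * (∫⁻ p in Ω.carrier, ENNReal.ofReal (|ψ p| + gradNorm ψ p)) ^ (3 / 2 : ℝ) := by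
  suffices H : ∃ K : ℝ≥0∞, K ≠ ⊤ ∧ ∀ ψ : E3 → ℝ, ContDiff ℝ ∞ ψ →
      ∫⁻ p in closure Ω.carrier ∩ Ω.carrier, ‖ψ p‖ₑ ^ (3 / 2 : ℝ) ≤
        K * (∫⁻ p in Ω.carrier, ENNReal.ofReal (|ψ p| + gradNorm ψ p)) ^ (3 / 2 : ℝ) by
    rwa [Set.inter_eq_self_of_subset_right subset_closure] at H
  refine Ω.isCompact_closure.induction_on (p := fun s => ∃ K : ℝ≥0∞, K ≠ ⊤ ∧
    ∀ ψ : E3 → ℝ, ContDiff ℝ ∞ ψ → ∫⁻ p in s ∩ Ω.carrier, ‖ψ p‖ₑ ^ (3 / 2 : ℝ) ≤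
        K * (∫⁻ p in Ω.carrier, ENNReal.ofReal (|ψ p| + gradNorm ψ p)) ^ (3 / 2 : ℝ)) ?_ ?_ ?_ ?_
  · exact ⟨0, by simp, by simp⟩
  · rintro s t hst ⟨K, hK, h⟩
    exact ⟨K, hK, fun ψ hψ =>
      (lintegral_mono_set (Set.inter_subset_inter_left _ hst)).trans (h ψ hψ)⟩
  · rintro s t ⟨K, hK, h⟩ ⟨K', hK', h'⟩
    refine ⟨K + K', ENNReal.add_ne_top.2 ⟨hK, hK'⟩, fun ψ hψ => ?_⟩
    rw [Set.union_inter_distrib_right, add_mul]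
    exact (lintegral_union_le _ _ _).trans (add_le_add (h ψ hψ) (h' ψ hψ))
  · intro x hx
    obtain ⟨R, hR, T, hT⟩ := Ω.exists_directions hx
    obtain ⟨K, hK, hKb⟩ := exists_lintegral_rpow_le_of_directions Ω.isOpen.measurableSet T hT
    let χ : ContDiffBump x := ⟨R / 4, R / 2, by positivity, by linarith⟩
    have hχ : ContDiff ℝ ∞ χ := χ.contDiff
    obtain ⟨C, hC0, hC⟩ := Ω.exists_bound (continuous_gradNorm hχ)
    refine ⟨_, mem_nhdsWithin_of_mem_nhds (Metric.ball_mem_nhds x (show 0 < R / 4 by positivity)),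
      K * ENNReal.ofReal (1 + C) ^ (3 / 2 : ℝ), ENNReal.mul_ne_top hK
        (ENNReal.rpow_ne_top_of_nonneg (by norm_num) ENNReal.ofReal_ne_top), fun ψ hψ => ?_⟩
    have hsupp : tsupport (fun y => χ y * ψ y) ⊆ Metric.ball x R := by
      refine tsupport_mul_subset_left.trans ?_
      rw [χ.tsupport_eq]
      exact Metric.closedBall_subset_ball (show R / 2 < R by linarith)
    have hcs : HasCompactSupport (fun y => χ y * ψ y) := χ.hasCompactSupport.mul_right
    have h1 := hKb _ (hχ.mul hψ) hcs hsupp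
    calc ∫⁻ p in Metric.ball x (R / 4) ∩ Ω.carrier, ‖ψ p‖ₑ ^ (3 / 2 : ℝ)
        = ∫⁻ p in Metric.ball x (R / 4) ∩ Ω.carrier, ‖χ p * ψ p‖ₑ ^ (3 / 2 : ℝ) := by
          refine setLIntegral_congr_fun
            (Metric.isOpen_ball.measurableSet.inter Ω.isOpen.measurableSet) fun p hp => ?_
          have : χ p = 1 := χ.one_of_mem_closedBall (Metric.ball_subset_closedBall hp.1)
          simp only [this, one_mul]
      _ ≤ ∫⁻ p in Ω.carrier, ‖χ p * ψ p‖ₑ ^ (3 / 2 : ℝ) :=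
          lintegral_mono_set Set.inter_subset_right
      _ ≤ _ := h1
      _ ≤ K * (ENNReal.ofReal (1 + C) *
            ∫⁻ p in Ω.carrier, ENNReal.ofReal (|ψ p| + gradNorm ψ p)) ^ (3 / 2 : ℝ) := by
          gcongr
          rw [← lintegral_const_mul' _ _ ENNReal.ofReal_ne_top]
          refine setLIntegral_mono' Ω.isOpen.measurableSet fun p hp => ?_
          rw [Real.enorm_eq_ofReal (gradNorm_nonneg _ _), ← ENNReal.ofReal_mul (by positivity)]
          refine ENNReal.ofReal_le_ofReal ((gradNorm_mul_le hχ hψ p).trans ?_)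
          have h2 : |χ p| ≤ 1 := by rw [abs_of_nonneg χ.nonneg]; exact χ.le_one
          have h3 : gradNorm χ p ≤ C := (le_abs_self _).trans (hC p (subset_closure hp))
          have h4 := gradNorm_nonneg ψ p
          have h5 := abs_nonneg (ψ p)
          nlinarith [mul_le_mul_of_nonneg_right h2 h4, mul_le_mul_of_nonneg_left h3 h5,
            mul_nonneg hC0 h4]
      _ = _ := by
          rw [ENNReal.mul_rpow_of_nonneg _ _ (by norm_num), mul_assoc]

/-- The Sobolev inequality `H¹ ⊂ L⁶` on the domain. -/
theorem exists_integral_pow_six_le (Ω : SmoothBoundedDomain) :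
    ∃ C, 0 ≤ C ∧ ∀ ξ : E3 → ℝ, ContDiff ℝ ∞ ξ →
      ∫ p in Ω.carrier, ξ p ^ 6 ≤ C * ((∫ p in Ω.carrier, ξ p ^ 2) + Ω.gradSq ξ) ^ 3 := by
  obtain ⟨K, hK, hKb⟩ := Ω.exists_lintegral_rpow_le
  refine ⟨K.toReal ^ 4 * 32 ^ 3, by positivity, fun ξ hξ => ?_⟩
  have hξc := hξ.continuous
  have hgc := continuous_gradNorm hξ
  set Y := ∫ p in Ω.carrier, ξ p ^ 6 with hY
  set Z := ∫ p in Ω.carrier, (|ξ p| + 4 * gradNorm ξ p) ^ 2 with hZ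
  set I := ∫ p in Ω.carrier, |ξ p| ^ 3 * (|ξ p| + 4 * gradNorm ξ p) with hI
  have hY0 : 0 ≤ Y := integral_nonneg fun p => by positivity
  have hZ0 : 0 ≤ Z := integral_nonneg fun p => by positivity
  have hI0 : 0 ≤ I := integral_nonneg fun p =>
    mul_nonneg (by positivity) (add_nonneg (abs_nonneg _)
      (mul_nonneg (by norm_num) (gradNorm_nonneg _ _)))
  -- The `W^{1,1}` inequality is applied to `ξ⁴`: the left side becomes `∫ ξ⁶`, and the gradient
  -- becomes `4 |ξ|³ |∇ξ|`, ready for Cauchy–Schwarz.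
  have hYI : Y ≤ K.toReal * I ^ (3 / 2 : ℝ) := by
    have h := hKb (fun p => ξ p ^ 4) (hξ.pow 4)
    have h1 : ∫⁻ p in Ω.carrier, ‖ξ p ^ 4‖ₑ ^ (3 / 2 : ℝ) = ENNReal.ofReal Y := by
      rw [hY, ofReal_integral_eq_lintegral_ofReal (Ω.integrable_of_continuous (by fun_prop))
        (Eventually.of_forall fun p => by positivity)]
      refine lintegral_congr fun p => ?_
      rw [Real.enorm_eq_ofReal (by positivity), ENNReal.ofReal_rpow_of_nonneg (by positivity)
        (by norm_num)]
      congr 1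
      have e : ξ p ^ 4 = |ξ p| ^ (4 : ℝ) := by
        rw [show (4 : ℝ) = ((4 : ℕ) : ℝ) by norm_num, Real.rpow_natCast]
        exact ((show Even 4 by decide).pow_abs _).symm
      rw [e, ← Real.rpow_mul (abs_nonneg _), show (4 * (3 / 2) : ℝ) = ((6 : ℕ) : ℝ) by norm_num,
        Real.rpow_natCast]
      exact (show Even 6 by decide).pow_abs _
    have h2 : ∫⁻ p in Ω.carrier, ENNReal.ofReal (|ξ p ^ 4| + gradNorm (fun p => ξ p ^ 4) p) =
        ENNReal.ofReal I := by
      rw [hI, ofReal_integral_eq_lintegral_ofReal (Ω.integrable_of_continuous (by fun_prop))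
        (Eventually.of_forall fun p => mul_nonneg (by positivity) (add_nonneg (abs_nonneg _)
          (mul_nonneg (by norm_num) (gradNorm_nonneg _ _))))]
      refine lintegral_congr fun p => ?_
      congr 1
      have e : gradNorm (fun p => ξ p ^ 4) p = 4 * |ξ p| ^ 3 * gradNorm ξ p := by
        rw [gradNorm_eq_norm_fderiv, gradNorm_eq_norm_fderiv,
          (((smooth_differentiable hξ p).hasFDerivAt (𝕜 := ℝ)).pow 4).fderiv, norm_smul]
        simp
      rw [e, abs_pow]
      ring
    rw [h1, h2, ENNReal.ofReal_rpow_of_nonneg hI0 (by norm_num), ← ENNReal.ofReal_toReal hK,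
      ← ENNReal.ofReal_mul ENNReal.toReal_nonneg] at h
    exact (ENNReal.ofReal_le_ofReal_iff (by positivity)).1 h
  have hIYZ : I ^ 2 ≤ Y * Z := by
    have := Ω.sq_integral_mul_le (f := fun p => |ξ p| ^ 3)
      (g := fun p => |ξ p| + 4 * gradNorm ξ p) (by fun_prop) (by fun_prop)
    refine this.trans (le_of_eq ?_)
    rw [hY, hZ]
    congr 2
    funext p
    rw [← pow_mul]
    exact (show Even 6 by decide).pow_abs _
  have hZle : Z ≤ 32 * ((∫ p in Ω.carrier, ξ p ^ 2) + Ω.gradSq ξ) := by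
    rw [← Ω.integral_sq_gradNorm, ← integral_add (Ω.integrable_of_continuous (by fun_prop))
      (Ω.integrable_of_continuous (by fun_prop)), ← integral_const_mul]
    refine integral_mono (Ω.integrable_of_continuous (by fun_prop))
      (Ω.integrable_of_continuous (by fun_prop)) fun p => ?_
    simp only
    have := sq_abs (ξ p)
    nlinarith [sq_nonneg (|ξ p| - 4 * gradNorm ξ p), sq_nonneg (ξ p)]
  -- The fourth power clears the exponent `3/2`; three factors of `Y` can then be divided out.
  have hY4 : Y ^ 4 ≤ (K.toReal ^ 4 * Z ^ 3) * Y ^ 3 := by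
    calc Y ^ 4 ≤ (K.toReal * I ^ (3 / 2 : ℝ)) ^ 4 := by gcongr
      _ = K.toReal ^ 4 * (I ^ 2) ^ 3 := by
        rw [mul_pow, ← Real.rpow_natCast (I ^ (3 / 2 : ℝ)), ← Real.rpow_mul hI0, ← pow_mul,
          ← Real.rpow_natCast I]
        norm_num
      _ ≤ K.toReal ^ 4 * (Y * Z) ^ 3 := by gcongr
      _ = _ := by ring
  have hfin : Y ≤ K.toReal ^ 4 * Z ^ 3 := by
    rcases hY0.eq_or_lt with h | h
    · rw [← h]; positivity
    · have h3 : 0 < Y ^ 3 := by positivity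
      refine le_of_mul_le_mul_right ?_ h3
      calc Y * Y ^ 3 = Y ^ 4 := by ring
        _ ≤ _ := hY4
  calc Y ≤ K.toReal ^ 4 * Z ^ 3 := hfin
    _ ≤ K.toReal ^ 4 * (32 * ((∫ p in Ω.carrier, ξ p ^ 2) + Ω.gradSq ξ)) ^ 3 := by gcongr
    _ = _ := by ring

end SmoothBoundedDomain

/-! ### The Poincaré inequality. -/

/-- The increment is the mean over `[0, 1]` of the derivative along the segment, and the variance of
that derivative is nonnegative. -/
theorem sq_sub_le_integral_line {ξ : E3 → ℝ} (hξ : ContDiff ℝ ∞ ξ) (p v : E3) :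
    (ξ (p + v) - ξ p) ^ 2 ≤ ∫ t in (0 : ℝ)..1, ‖v‖ ^ 2 * gradNorm ξ (p + t • v) ^ 2 := by
  have hc : Continuous fun t : ℝ => fderiv ℝ ξ (p + t • v) v :=
    (((hξ.continuous_fderiv (by simp)).comp (by fun_prop : Continuous fun t : ℝ => p + t • v))).clm_apply
      continuous_const
  have hg : Continuous fun t : ℝ => gradNorm ξ (p + t • v) :=
    (continuous_gradNorm hξ).comp (by fun_prop)
  have hftc : ∫ t in (0 : ℝ)..1, fderiv ℝ ξ (p + t • v) v = ξ (p + v) - ξ p := by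
    rw [intervalIntegral.integral_eq_sub_of_hasDerivAt (fun t _ => hasDerivAt_line hξ p v t)
      (hc.intervalIntegrable 0 1)]
    simp
  set a := ξ (p + v) - ξ p with ha
  have h1 : 0 ≤ ∫ t in (0 : ℝ)..1, (fderiv ℝ ξ (p + t • v) v - a) ^ 2 :=
    intervalIntegral.integral_nonneg zero_le_one fun t _ => sq_nonneg _
  have h2 : ∫ t in (0 : ℝ)..1, (fderiv ℝ ξ (p + t • v) v - a) ^ 2 =
      (∫ t in (0 : ℝ)..1, fderiv ℝ ξ (p + t • v) v ^ 2) - a ^ 2 := by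
    have e : ∀ t : ℝ, (fderiv ℝ ξ (p + t • v) v - a) ^ 2 =
      (fderiv ℝ ξ (p + t • v) v ^ 2 - 2 * a * fderiv ℝ ξ (p + t • v) v) + a ^ 2 := fun t => by ring
    simp only [e]
    rw [intervalIntegral.integral_add, intervalIntegral.integral_sub,
      intervalIntegral.integral_const_mul, hftc, intervalIntegral.integral_const]
    · simp; ring
    all_goals exact Continuous.intervalIntegrable (by fun_prop) 0 1
  have h3 : ∫ t in (0 : ℝ)..1, fderiv ℝ ξ (p + t • v) v ^ 2 ≤
      ∫ t in (0 : ℝ)..1, ‖v‖ ^ 2 * gradNorm ξ (p + t • v) ^ 2 := by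
    refine intervalIntegral.integral_mono_on zero_le_one
      (Continuous.intervalIntegrable (by fun_prop) 0 1)
      (Continuous.intervalIntegrable (by fun_prop) 0 1) fun t _ => ?_
    rw [← mul_pow, ← sq_abs]
    exact pow_le_pow_left₀ (abs_nonneg _) (abs_fderiv_apply_le_gradNorm _ _ _) 2
  linarith

/-- The `L²` norm of an increment is controlled by the gradient on the segments swept out. -/
theorem lintegral_sq_sub_le {ξ : E3 → ℝ} (hξ : ContDiff ℝ ∞ ξ) {A S : Set E3} {v : E3}
    (hAS : ∀ p ∈ A, ∀ t ∈ Set.Icc (0 : ℝ) 1, p + t • v ∈ S) :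
    ∫⁻ p in A, ENNReal.ofReal ((ξ (p + v) - ξ p) ^ 2) ≤
      ENNReal.ofReal (‖v‖ ^ 2) * ∫⁻ p in S, ENNReal.ofReal (gradNorm ξ p ^ 2) := by
  have hg := continuous_gradNorm hξ
  have hcont : Continuous fun z : E3 × ℝ => ‖v‖ ^ 2 * gradNorm ξ (z.1 + z.2 • v) ^ 2 := by
    fun_prop
  calc ∫⁻ p in A, ENNReal.ofReal ((ξ (p + v) - ξ p) ^ 2)
      ≤ ∫⁻ p in A, ∫⁻ t in Set.Ioc (0 : ℝ) 1,
          ENNReal.ofReal (‖v‖ ^ 2 * gradNorm ξ (p + t • v) ^ 2) := by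
        refine lintegral_mono fun p => ?_
        refine (ENNReal.ofReal_le_ofReal (sq_sub_le_integral_line hξ p v)).trans (le_of_eq ?_)
        rw [intervalIntegral.integral_of_le zero_le_one, ofReal_integral_eq_lintegral_ofReal]
        · exact (Continuous.intervalIntegrable (by fun_prop) 0 1 :
            IntervalIntegrable (fun t : ℝ => ‖v‖ ^ 2 * gradNorm ξ (p + t • v) ^ 2) volume 0 1).1
        · exact Eventually.of_forall fun t => by positivity
    _ = ∫⁻ t in Set.Ioc (0 : ℝ) 1, ∫⁻ p in A,
          ENNReal.ofReal (‖v‖ ^ 2 * gradNorm ξ (p + t • v) ^ 2) :=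
        lintegral_lintegral_swap hcont.measurable.ennreal_ofReal.aemeasurable
    _ ≤ ∫⁻ _t in Set.Ioc (0 : ℝ) 1, ENNReal.ofReal (‖v‖ ^ 2) *
          ∫⁻ p in S, ENNReal.ofReal (gradNorm ξ p ^ 2) := by
        refine setLIntegral_mono' measurableSet_Ioc fun t ht => ?_
        simp only [ENNReal.ofReal_mul (sq_nonneg ‖v‖)]
        rw [lintegral_const_mul' _ _ ENNReal.ofReal_ne_top]
        refine mul_le_mul_right ?_ _
        have hmp : MeasurePreserving (fun p : E3 => p + t • v) volume volume :=
          measurePreserving_add_right volume (t • v)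
        calc ∫⁻ p in A, ENNReal.ofReal (gradNorm ξ (p + t • v) ^ 2)
            ≤ ∫⁻ p in (fun p : E3 => p + t • v) ⁻¹' S,
                ENNReal.ofReal (gradNorm ξ (p + t • v) ^ 2) :=
              lintegral_mono_set fun p hp => hAS p hp t ⟨ht.1.le, ht.2⟩
          _ = _ := hmp.setLIntegral_comp_preimage_emb
              (MeasurableEquiv.addRight (t • v)).measurableEmbedding
              (fun p => ENNReal.ofReal (gradNorm ξ p ^ 2)) S
    _ = _ := by simp

namespace SmoothBoundedDomain

variable (Ω : SmoothBoundedDomain)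

/-- On the set `s` the deviation from a constant is controlled by the deviation on `B` and the
Dirichlet integral. -/
def IsControlled (B s : Set E3) : Prop :=
  ∃ C : ℝ≥0∞, C ≠ ⊤ ∧ ∀ ξ : E3 → ℝ, ContDiff ℝ ∞ ξ → ∀ c : ℝ,
    ∫⁻ p in s, ENNReal.ofReal ((ξ p - c) ^ 2) ≤
      C * ((∫⁻ p in B, ENNReal.ofReal ((ξ p - c) ^ 2)) +
        ∫⁻ p in Ω.carrier, ENNReal.ofReal (gradNorm ξ p ^ 2))

variable {Ω} {B s t : Set E3}

theorem IsControlled.mono (h : Ω.IsControlled B t) (hst : s ⊆ t) : Ω.IsControlled B s := by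
  obtain ⟨C, hC, hCb⟩ := h
  exact ⟨C, hC, fun ξ hξ c => (lintegral_mono_set hst).trans (hCb ξ hξ c)⟩

theorem IsControlled.union (hs : Ω.IsControlled B s) (ht : Ω.IsControlled B t) :
    Ω.IsControlled B (s ∪ t) := by
  obtain ⟨C, hC, hCb⟩ := hs
  obtain ⟨D, hD, hDb⟩ := ht
  refine ⟨C + D, ENNReal.add_ne_top.2 ⟨hC, hD⟩, fun ξ hξ c => ?_⟩
  rw [add_mul]
  exact (lintegral_union_le _ _ _).trans (add_le_add (hCb ξ hξ c) (hDb ξ hξ c))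

theorem isControlled_self (B : Set E3) : Ω.IsControlled B B :=
  ⟨1, by simp, fun ξ _ c => by rw [one_mul]; exact le_self_add⟩

/-- The deviation at `p` is the deviation at `p + v` minus the increment along the segment. The
first is controlled on `t`, the second by the gradient on the segments, which stay in `Ω`. -/
theorem IsControlled.translate (ht : Ω.IsControlled B t) {v : E3}
    (hst : ∀ p ∈ s, p + v ∈ t)
    (hseg : ∀ p ∈ s, ∀ r ∈ Set.Icc (0 : ℝ) 1, p + r • v ∈ Ω.carrier) : Ω.IsControlled B s := by
  obtain ⟨C, hC, hCb⟩ := ht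
  refine ⟨2 * C + 2 * ENNReal.ofReal (‖v‖ ^ 2), by finiteness, fun ξ hξ c => ?_⟩
  have hξc := hξ.continuous
  set D := ∫⁻ p in Ω.carrier, ENNReal.ofReal (gradNorm ξ p ^ 2)
  set b := ∫⁻ p in B, ENNReal.ofReal ((ξ p - c) ^ 2)
  have h1 := lintegral_sq_sub_le hξ hseg
  have h2 : ∫⁻ p in s, ENNReal.ofReal ((ξ (p + v) - c) ^ 2) ≤ C * (b + D) := by
    have hmp : MeasurePreserving (fun p : E3 => p + v) volume volume :=
      measurePreserving_add_right volume v
    calc ∫⁻ p in s, ENNReal.ofReal ((ξ (p + v) - c) ^ 2)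
        ≤ ∫⁻ p in (fun p : E3 => p + v) ⁻¹' t, ENNReal.ofReal ((ξ (p + v) - c) ^ 2) :=
          lintegral_mono_set fun p hp => hst p hp
      _ = ∫⁻ p in t, ENNReal.ofReal ((ξ p - c) ^ 2) :=
          hmp.setLIntegral_comp_preimage_emb (MeasurableEquiv.addRight v).measurableEmbedding
            (fun p => ENNReal.ofReal ((ξ p - c) ^ 2)) t
      _ ≤ _ := hCb ξ hξ c
  calc ∫⁻ p in s, ENNReal.ofReal ((ξ p - c) ^ 2)
      ≤ ∫⁻ p in s, (2 * ENNReal.ofReal ((ξ (p + v) - c) ^ 2) +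
          2 * ENNReal.ofReal ((ξ (p + v) - ξ p) ^ 2)) := by
        refine lintegral_mono fun p => ?_
        have e2 : ∀ a : ℝ, 2 * ENNReal.ofReal a = ENNReal.ofReal (2 * a) := fun a => by
          rw [ENNReal.ofReal_mul two_pos.le]; simp
        rw [e2, e2, ← ENNReal.ofReal_add (by positivity) (by positivity)]
        refine ENNReal.ofReal_le_ofReal ?_
        nlinarith [sq_nonneg ((ξ (p + v) - c) + (ξ (p + v) - ξ p))]
    _ = 2 * (∫⁻ p in s, ENNReal.ofReal ((ξ (p + v) - c) ^ 2)) +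
          2 * ∫⁻ p in s, ENNReal.ofReal ((ξ (p + v) - ξ p) ^ 2) := by
        rw [lintegral_add_left (by fun_prop), lintegral_const_mul' _ _ (by simp),
          lintegral_const_mul' _ _ (by simp)]
    _ ≤ 2 * (C * (b + D)) + 2 * (ENNReal.ofReal (‖v‖ ^ 2) * D) := by gcongr
    _ ≤ 2 * (C * (b + D)) + 2 * (ENNReal.ofReal (‖v‖ ^ 2) * (b + D)) := by
        gcongr; exact le_add_self
    _ = _ := by ring

/-- Points with a controlled ball around them form an open set that is relatively closed in `Ω`, by
translating a small ball to a nearby controlled one; connectedness makes it all of `Ω`. A piece of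
`Ω` near a frontier point is translated inward into a controlled ball, and compactness of the
closure finishes. -/
theorem isControlled_carrier (Ω : SmoothBoundedDomain) {x₀ : E3} {r₀ : ℝ} (hr₀ : 0 < r₀)
    (hx₀ : x₀ ∈ Ω.carrier) : Ω.IsControlled (Metric.ball x₀ r₀) Ω.carrier := by
  set B := Metric.ball x₀ r₀ with hB
  set u : Set E3 := {x | ∃ r > 0, Ω.IsControlled B (Metric.ball x r)} with hu
  have huo : IsOpen u := by
    rw [Metric.isOpen_iff]
    rintro x ⟨r, hr, h⟩
    refine ⟨r, hr, fun y hy => ⟨r - dist y x, by simpa using hy, h.mono ?_⟩⟩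
    exact Metric.ball_subset_ball' (by linarith)
  have hsub : Ω.carrier ⊆ u := by
    refine Ω.isConnected.isPreconnected.subset_of_closure_inter_subset huo
      ⟨x₀, hx₀, r₀, hr₀, isControlled_self B⟩ ?_
    rintro x ⟨hxu, hxΩ⟩
    obtain ⟨R, hR, hRb⟩ := Metric.isOpen_iff.1 Ω.isOpen x hxΩ
    obtain ⟨z, ⟨r, hr, hz⟩, hzx⟩ := Metric.mem_closure_iff.1 hxu (R / 2) (half_pos hR)
    refine ⟨min r (R / 2), lt_min hr (half_pos hR),
      hz.translate (v := z - x) ?_ ?_⟩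
    · intro p hp
      rw [Metric.mem_ball, dist_eq_norm] at hp ⊢
      rw [show p + (z - x) - z = p - x by abel]
      exact hp.trans_le (min_le_left _ _)
    · intro p hp t ht
      refine hRb ?_
      rw [Metric.mem_ball, dist_eq_norm] at hp ⊢
      rw [dist_comm, dist_eq_norm] at hzx
      calc ‖p + t • (z - x) - x‖ = ‖(p - x) + t • (z - x)‖ := by congr 1; abel
        _ ≤ ‖p - x‖ + ‖t • (z - x)‖ := norm_add_le _ _
        _ ≤ ‖p - x‖ + 1 * ‖z - x‖ := by
          rw [norm_smul, Real.norm_eq_abs, abs_of_nonneg ht.1]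
          gcongr
          exact ht.2
        _ < R := by
          have := hp.trans_le (min_le_right _ _)
          linarith
  suffices H : Ω.IsControlled B (closure Ω.carrier ∩ Ω.carrier) by
    rwa [Set.inter_eq_self_of_subset_right subset_closure] at H
  refine Ω.isCompact_closure.induction_on (p := fun s => Ω.IsControlled B (s ∩ Ω.carrier))
    ?_ ?_ ?_ ?_
  · exact ⟨0, by simp, by simp⟩
  · exact fun s t hst h => h.mono (Set.inter_subset_inter_left _ hst)
  · intro s t hs ht
    rw [Set.union_inter_distrib_right]
    exact hs.union ht
  · intro x hx
    by_cases hxΩ : x ∈ Ω.carrier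
    · obtain ⟨r, hr, h⟩ := hsub hxΩ
      exact ⟨_, mem_nhdsWithin_of_mem_nhds (Metric.ball_mem_nhds x hr),
        h.mono Set.inter_subset_left⟩
    · have hxf : x ∈ frontier Ω.carrier := by
        rw [Ω.isOpen.frontier_eq]; exact ⟨hx, hxΩ⟩
      obtain ⟨ρ, hρ⟩ := Ω.exists_isGlobalDefiningFunction
      set e := - gradient ρ x with he
      have hv0 : 0 < ‖gradient ρ x‖ := norm_pos_iff.2 (hρ.gradient_ne_zero x hxf)
      have hneg : inner ℝ (gradient ρ x) e < 0 := by
        rw [he, inner_neg_right, real_inner_self_eq_norm_sq]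
        simp only [Left.neg_neg_iff]
        positivity
      have hneg' : fderiv ℝ ρ x e < 0 := by
        rwa [gradient, InnerProductSpace.toDual_symm_apply] at hneg
      obtain ⟨R, hR, hRb⟩ := Ω.exists_ball_forall_add_smul_mem hρ hneg'
      have h1 := eventually_neg_of_inner_neg hρ.contDiff (hρ.eq_zero hxf) hneg
      have h2 : ∀ᶠ t : ℝ in 𝓝[>] 0, t * ‖e‖ < R / 2 := by
        have : Tendsto (fun t : ℝ => t * ‖e‖) (𝓝 0) (𝓝 (0 * ‖e‖)) :=
          (continuous_id.mul continuous_const).tendsto 0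
        rw [zero_mul] at this
        exact (this.mono_left nhdsWithin_le_nhds).eventually (gt_mem_nhds (half_pos hR))
      -- A shift `t • e` large enough to put the boundary point inside `Ω`, yet small enough that
      -- the segments swept out remain in the ball where moving along `e` preserves `Ω`.
      obtain ⟨t, ⟨ht1, ht2⟩, ht0⟩ := ((h1.and h2).and self_mem_nhdsWithin).exists
      have ht0' : 0 < t := ht0
      obtain ⟨r, hr, hz⟩ := hsub ((hρ.mem_iff _).2 ht1)
      refine ⟨_, mem_nhdsWithin_of_mem_nhds (Metric.ball_mem_nhds x
        (lt_min hr (half_pos hR))), hz.translate (v := t • e) ?_ ?_⟩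
      · rintro p ⟨hp, -⟩
        rw [Metric.mem_ball, dist_add_right]
        exact (Metric.mem_ball.1 hp).trans_le (min_le_left _ _)
      · rintro p ⟨hp, hpΩ⟩ s hs
        have hpR : dist p x < R / 2 := (Metric.mem_ball.1 hp).trans_le (min_le_right _ _)
        rw [smul_smul]
        refine hRb p hpΩ (Metric.mem_ball.2 (by linarith)) _ (mul_nonneg hs.1 ht0'.le) ?_
        rw [Metric.mem_ball, dist_eq_norm]
        rw [dist_eq_norm] at hpR
        calc ‖p + (s * t) • e - x‖ = ‖(p - x) + (s * t) • e‖ := by congr 1; abel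
          _ ≤ ‖p - x‖ + ‖(s * t) • e‖ := norm_add_le _ _
          _ = ‖p - x‖ + s * (t * ‖e‖) := by
            rw [norm_smul, Real.norm_eq_abs, abs_of_nonneg (mul_nonneg hs.1 ht0'.le), mul_assoc]
          _ ≤ ‖p - x‖ + 1 * (t * ‖e‖) := by gcongr; exact hs.2
          _ < R := by linarith

/-- On a ball a smooth function is close to one of its values. -/
theorem exists_lintegral_ball_le (x₀ : E3) {r₀ : ℝ} (hr₀ : 0 < r₀) :
    ∃ C : ℝ≥0∞, C ≠ ⊤ ∧ ∀ ξ : E3 → ℝ, ContDiff ℝ ∞ ξ → ∃ c : ℝ,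
      ∫⁻ p in Metric.ball x₀ r₀, ENNReal.ofReal ((ξ p - c) ^ 2) ≤
        C * ∫⁻ p in Metric.ball x₀ r₀, ENNReal.ofReal (gradNorm ξ p ^ 2) := by
  set B := Metric.ball x₀ r₀ with hB
  set W := Metric.ball (0 : E3) (2 * r₀) with hW
  have hBm : MeasurableSet B := Metric.isOpen_ball.measurableSet
  have hWm : MeasurableSet W := Metric.isOpen_ball.measurableSet
  have hB0 : volume B ≠ 0 := (Metric.measure_ball_pos volume x₀ hr₀).ne'
  have hBt : volume B ≠ ⊤ := measure_ball_lt_top.ne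
  have hWt : volume W ≠ ⊤ := measure_ball_lt_top.ne
  refine ⟨(volume B)⁻¹ * (ENNReal.ofReal ((2 * r₀) ^ 2) * volume W), by finiteness,
    fun ξ hξ => ?_⟩
  have hξc := hξ.continuous
  set D := ∫⁻ p in B, ENNReal.ofReal (gradNorm ξ p ^ 2)
  -- The constant is found as a value `ξ y`: the deviation from `ξ y` is averaged over `y ∈ B`, and
  -- some `y` does no worse than the average.
  set Φ : E3 → ℝ≥0∞ := fun y => ∫⁻ p in B, ENNReal.ofReal ((ξ p - ξ y) ^ 2) with hΦ
  have hcont : Continuous fun z : E3 × E3 => (ξ z.2 - ξ z.1) ^ 2 := by fun_prop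
  have hmeas : Measurable fun z : E3 × E3 =>
      B.indicator (fun _ => ENNReal.ofReal ((ξ (z.1 + z.2) - ξ z.1) ^ 2)) (z.1 + z.2) := by
    have e : (fun z : E3 × E3 =>
      B.indicator (fun _ => ENNReal.ofReal ((ξ (z.1 + z.2) - ξ z.1) ^ 2)) (z.1 + z.2)) =
      ((fun z : E3 × E3 => z.1 + z.2) ⁻¹' B).indicator
        (fun z => ENNReal.ofReal ((ξ (z.1 + z.2) - ξ z.1) ^ 2)) := rfl
    rw [e]
    refine Measurable.indicator ?_ (measurable_add hBm)
    exact (by fun_prop : Continuous fun z : E3 × E3 =>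
      (ξ (z.1 + z.2) - ξ z.1) ^ 2).measurable.ennreal_ofReal
  -- With `p = y + h` the displacement `h` lies in the ball `W`, and for each fixed `h` convexity of
  -- `B` bounds the squared increments by the gradient on `B`.
  have hdouble : ∫⁻ y in B, Φ y ≤ ENNReal.ofReal ((2 * r₀) ^ 2) * volume W * D := by
    have e1 : ∀ y, Φ y = ∫⁻ h : E3,
        B.indicator (fun _ => ENNReal.ofReal ((ξ (y + h) - ξ y) ^ 2)) (y + h) := by
      intro y
      simp only [hΦ]
      rw [← lintegral_indicator hBm]
      have := lintegral_add_left_eq_self (μ := (volume : Measure E3))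
        (fun p => B.indicator (fun p => ENNReal.ofReal ((ξ p - ξ y) ^ 2)) p) y
      rw [← this]
      rfl
    calc ∫⁻ y in B, Φ y = ∫⁻ h : E3, ∫⁻ y in B,
          B.indicator (fun _ => ENNReal.ofReal ((ξ (y + h) - ξ y) ^ 2)) (y + h) := by
          simp only [e1]
          exact lintegral_lintegral_swap hmeas.aemeasurable
      _ ≤ ∫⁻ h : E3, W.indicator (fun _ => ENNReal.ofReal ((2 * r₀) ^ 2) * D) h := by
          refine lintegral_mono fun h => ?_
          have hpre : MeasurableSet ((fun y : E3 => y + h) ⁻¹' B) :=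
            (measurable_add_const h) hBm
          have e2 : ∫⁻ y in B, B.indicator
              (fun _ => ENNReal.ofReal ((ξ (y + h) - ξ y) ^ 2)) (y + h) =
              ∫⁻ y in B ∩ (fun y : E3 => y + h) ⁻¹' B, ENNReal.ofReal ((ξ (y + h) - ξ y) ^ 2) := by
            rw [Set.inter_comm, ← setLIntegral_indicator hpre]
            rfl
          simp only
          rw [e2]
          by_cases hh : h ∈ W
          · rw [Set.indicator_of_mem hh]
            refine (lintegral_sq_sub_le (S := B) hξ ?_).trans ?_
            · rintro p ⟨hp1, hp2⟩ t ht
              have := (convex_ball x₀ r₀) hp1 hp2 (a := 1 - t) (b := t) (by linarith [ht.2]) ht.1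
                (by ring)
              convert this using 1
              module
            · gcongr
              have : ‖h‖ < 2 * r₀ := by simpa [hW] using hh
              exact this.le
          · have hemp : B ∩ (fun y : E3 => y + h) ⁻¹' B = ∅ := by
              rw [Set.eq_empty_iff_forall_notMem]
              rintro p ⟨hp1, hp2⟩
              refine hh ?_
              have h1 : dist p x₀ < r₀ := hp1
              have h2 : dist (p + h) x₀ < r₀ := hp2
              rw [hW, Metric.mem_ball, dist_zero_right]
              rw [dist_eq_norm] at h1 h2
              calc ‖h‖ = ‖(p + h - x₀) - (p - x₀)‖ := by congr 1; abel
                _ ≤ ‖p + h - x₀‖ + ‖p - x₀‖ := norm_sub_le _ _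
                _ < 2 * r₀ := by linarith
            rw [hemp]
            simp
      _ = _ := by
          rw [lintegral_indicator hWm, setLIntegral_const]
          ring
  have hΦm : Measurable Φ :=
    Measurable.lintegral_prod_right' (f := fun z : E3 × E3 => ENNReal.ofReal ((ξ z.2 - ξ z.1) ^ 2))
      hcont.measurable.ennreal_ofReal
  obtain ⟨y, -, hy⟩ := exists_le_setLAverage (μ := volume) hB0 hBt hΦm.aemeasurable
  refine ⟨ξ y, hy.trans ?_⟩
  rw [setLAverage_eq, ENNReal.div_eq_inv_mul, mul_assoc]
  gcongr

/-- The Poincaré inequality. -/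
theorem exists_integral_sq_le (Ω : SmoothBoundedDomain) :
    ∃ C, 0 ≤ C ∧ ∀ ξ : E3 → ℝ, ContDiff ℝ ∞ ξ →
      ∫ p in Ω.carrier, ξ p ^ 2 ≤
        C * Ω.gradSq ξ + (∫ p in Ω.carrier, ξ p) ^ 2 / volume.real Ω.carrier := by
  obtain ⟨x₀, hx₀⟩ := Ω.isConnected.nonempty
  obtain ⟨r₀, hr₀, hb⟩ := Metric.isOpen_iff.1 Ω.isOpen x₀ hx₀
  obtain ⟨C₁, hC₁, h₁⟩ := Ω.isControlled_carrier hr₀ hx₀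
  obtain ⟨C₂, hC₂, h₂⟩ := exists_lintegral_ball_le x₀ hr₀
  set K := C₁ * (C₂ + 1) with hK
  have hKt : K ≠ ⊤ := by finiteness
  refine ⟨K.toReal, ENNReal.toReal_nonneg, fun ξ hξ => ?_⟩
  have hξc := hξ.continuous
  have hgc := continuous_gradNorm hξ
  obtain ⟨c, hc⟩ := h₂ ξ hξ
  have h3 : ∫⁻ p in Ω.carrier, ENNReal.ofReal ((ξ p - c) ^ 2) ≤
      K * ∫⁻ p in Ω.carrier, ENNReal.ofReal (gradNorm ξ p ^ 2) := by
    refine (h₁ ξ hξ c).trans ?_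
    rw [hK, mul_assoc, add_mul, one_mul]
    gcongr
    exact hc.trans (mul_le_mul_right (lintegral_mono_set hb) _)
  rw [← ofReal_integral_eq_lintegral_ofReal (Ω.integrable_of_continuous (by fun_prop))
    (Eventually.of_forall fun p => sq_nonneg _),
    ← ofReal_integral_eq_lintegral_ofReal (Ω.integrable_of_continuous (by fun_prop))
    (Eventually.of_forall fun p => sq_nonneg _), Ω.integral_sq_gradNorm,
    ← ENNReal.ofReal_toReal hKt, ← ENNReal.ofReal_mul ENNReal.toReal_nonneg,
    ENNReal.ofReal_le_ofReal_iff (mul_nonneg ENNReal.toReal_nonneg (Ω.gradSq_nonneg ξ))] at h3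
  set m := ∫ p in Ω.carrier, ξ p with hm
  set V := volume.real Ω.carrier with hV
  have hV0 : 0 < V := ENNReal.toReal_pos (Ω.isOpen.measure_pos volume ⟨x₀, hx₀⟩).ne'
    Ω.isBounded.measure_lt_top.ne
  have h4 : ∫ p in Ω.carrier, (ξ p - c) ^ 2 =
      (∫ p in Ω.carrier, ξ p ^ 2) - 2 * c * m + c ^ 2 * V := by
    have e : ∀ p, (ξ p - c) ^ 2 = ξ p ^ 2 - 2 * c * ξ p + c ^ 2 := fun p => by ring
    simp only [e]
    rw [integral_add, integral_sub, integral_const_mul, setIntegral_const, smul_eq_mul,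
      mul_comm (volume.real _)]
    all_goals exact Ω.integrable_of_continuous (by fun_prop)
  -- The mean minimizes the squared deviation, so the unspecified `c` may be replaced by it.
  have h5 : 2 * c * m - c ^ 2 * V ≤ m ^ 2 / V := by
    rw [le_div_iff₀ hV0]
    nlinarith [sq_nonneg (c * V - m)]
  linarith

end SmoothBoundedDomain

/-! ### Passing from smooth functions to `H²(Ω)` and `V`. -/

namespace SmoothBoundedDomain

variable {Ω : SmoothBoundedDomain}

theorem setIntegral_mul_eq_integral {η : E3 → ℝ} (hη : tsupport η ⊆ Ω.carrier) (g : E3 → ℝ) :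
    ∫ x in Ω.carrier, g x * η x = ∫ x, g x * η x :=
  setIntegral_eq_integral_of_forall_compl_eq_zero fun x hx => by
    rw [image_eq_zero_of_notMem_tsupport fun h => hx (hη h), mul_zero]

/-- The weak derivative of a smooth function is its classical derivative. -/
theorem HasWeakPartial.ae_eq_dcoord {i : Fin 3} {u g : Ω.L 2} {ξ : E3 → ℝ}
    (h : HasWeakPartial Ω.carrier i u g) (hξ : ContDiff ℝ ∞ ξ) (hu : u =ᵐ[Ω.vol] ξ) :
    g =ᵐ[Ω.vol] dcoord i ξ := by
  have hg : Integrable g Ω.vol := (Lp.memLp g).integrable (by norm_num)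
  have hd : Integrable (dcoord i ξ) Ω.vol := Ω.integrable_of_continuous (hξ.dcoord i).continuous
  have hloc : LocallyIntegrableOn (fun x => g x - dcoord i ξ x) Ω.carrier volume :=
    IntegrableOn.locallyIntegrableOn (hg.sub hd)
  have key := Ω.isOpen.ae_eq_zero_of_integral_contDiff_smul_eq_zero hloc fun η h1 h2 h3 => by
    have e1 := h η h1 h2 h3
    have e2 : ∫ x in Ω.carrier, u x * fderiv ℝ η x (EuclideanSpace.single i 1) =
        ∫ x, ξ x * fderiv ℝ η x (EuclideanSpace.single i 1) := by
      rw [← setIntegral_mul_eq_integral (Ω := Ω)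
        (η := fun x => fderiv ℝ η x (EuclideanSpace.single i 1))
        ((tsupport_fderiv_apply_subset ℝ _).trans h3)]
      refine integral_congr_ae ?_
      filter_upwards [hu] with x hx
      rw [hx]
    have e3 : ∫ x, ξ x * fderiv ℝ η x (EuclideanSpace.single i 1) =
        -∫ x, dcoord i ξ x * η x := by
      refine integral_mul_fderiv_eq_neg_fderiv_mul_of_integrable ?_ ?_ ?_
        (fun x _ => smooth_differentiable hξ x) (fun x _ => smooth_differentiable h1 x)
      · exact ((hξ.dcoord i).continuous.mul h1.continuous).integrable_of_hasCompactSupport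
          h2.mul_left
      · exact (hξ.continuous.mul (h1.dcoord i).continuous).integrable_of_hasCompactSupport
          (h2.dcoord i).mul_left
      · exact (hξ.continuous.mul h1.continuous).integrable_of_hasCompactSupport h2.mul_left
    have e4 : ∫ x in Ω.carrier, g x * η x = ∫ x in Ω.carrier, dcoord i ξ x * η x := by
      rw [setIntegral_mul_eq_integral h3 (dcoord i ξ)]
      rw [e2, e3] at e1
      linarith
    have e5 : ∫ x, η x • (g x - dcoord i ξ x) =
        ∫ x in Ω.carrier, (g x - dcoord i ξ x) * η x := by
      rw [setIntegral_mul_eq_integral h3]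
      exact integral_congr_ae (Eventually.of_forall fun x => by simp only [smul_eq_mul]; ring)
    have e6 : Integrable (fun x => dcoord i ξ x * η x) Ω.vol :=
      Ω.integrable_of_continuous ((hξ.dcoord i).continuous.mul h1.continuous)
    rw [e5]
    simp only [sub_mul]
    rw [integral_sub (Ω.integrable_mul_of_L2 g h1.continuous h2) e6, e4, sub_self]
  rw [Filter.EventuallyEq, ae_restrict_iff' Ω.isOpen.measurableSet]
  filter_upwards [key] with x hx hxΩ
  linarith [hx hxΩ]

section Smooth

variable {f : Ω.H2} {ξ : E3 → ℝ}

theorem pd_ae_eq (hξ : ContDiff ℝ ∞ ξ) (hf : Ω.fn f =ᵐ[Ω.vol] ξ) (i : Fin 3) :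
    Ω.pd f i =ᵐ[Ω.vol] dcoord i ξ :=
  HasWeakPartial.ae_eq_dcoord (f.2.1 i) hξ hf

theorem pdd_ae_eq (hξ : ContDiff ℝ ∞ ξ) (hf : Ω.fn f =ᵐ[Ω.vol] ξ) (i j : Fin 3) :
    Ω.pdd f i j =ᵐ[Ω.vol] dcoord j (dcoord i ξ) :=
  HasWeakPartial.ae_eq_dcoord (f.2.2 i j) (hξ.dcoord i) (pd_ae_eq hξ hf i)

theorem norm_sq_eq_integral (g : Ω.L 2) : ‖g‖ ^ 2 = ∫ x in Ω.carrier, g x ^ 2 := by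
  rw [← real_inner_self_eq_norm_sq, L2.inner_def]
  exact integral_congr_ae (Eventually.of_forall fun x => by
    simp only [real_inner_self_eq_norm_sq, Real.norm_eq_abs, sq_abs])

theorem norm_sq_eq_of_ae_eq {g : Ω.L 2} {ζ : E3 → ℝ} (h : g =ᵐ[Ω.vol] ζ) :
    ‖g‖ ^ 2 = ∫ x in Ω.carrier, ζ x ^ 2 := by
  rw [norm_sq_eq_integral]
  refine integral_congr_ae ?_
  filter_upwards [h] with x hx
  rw [hx]

theorem sum_norm_sq_pd (hξ : ContDiff ℝ ∞ ξ) (hf : Ω.fn f =ᵐ[Ω.vol] ξ) :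
    ∑ i, ‖Ω.pd f i‖ ^ 2 = Ω.gradSq ξ := by
  have hc : ∀ i, Continuous fun x => dcoord i ξ x ^ 2 := fun i => (hξ.dcoord i).continuous.pow 2
  rw [gradSq, integral_finsetSum _ fun i _ => Ω.integrable_of_continuous (hc i)]
  exact Finset.sum_congr rfl fun i _ => norm_sq_eq_of_ae_eq (pd_ae_eq hξ hf i)

theorem sum_norm_sq_pdd (hξ : ContDiff ℝ ∞ ξ) (hf : Ω.fn f =ᵐ[Ω.vol] ξ) :
    ∑ j, ∑ i, ‖Ω.pdd f i j‖ ^ 2 = Ω.hessSq ξ := by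
  have hc : ∀ j i, Continuous fun x => dcoord j (dcoord i ξ) x ^ 2 := fun j i =>
    ((hξ.dcoord i).dcoord j).continuous.pow 2
  rw [hessSq, integral_finsetSum _ fun j _ =>
    Ω.integrable_of_continuous (continuous_finsetSum _ fun i _ => hc j i)]
  refine Finset.sum_congr rfl fun j _ => ?_
  rw [integral_finsetSum _ fun i _ => Ω.integrable_of_continuous (hc j i)]
  exact Finset.sum_congr rfl fun i _ => norm_sq_eq_of_ae_eq (pdd_ae_eq hξ hf i j)

theorem norm_sq_lap (hξ : ContDiff ℝ ∞ ξ) (hf : Ω.fn f =ᵐ[Ω.vol] ξ) :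
    ‖Ω.lap f‖ ^ 2 = Ω.lapSq ξ := by
  refine norm_sq_eq_of_ae_eq ?_
  have h1 : Ω.lap f =ᵐ[Ω.vol] fun x => Ω.pdd f 0 0 x + Ω.pdd f 1 1 x + Ω.pdd f 2 2 x := by
    rw [lap, Fin.sum_univ_three]
    filter_upwards [Lp.coeFn_add (Ω.pdd f 0 0 + Ω.pdd f 1 1) (Ω.pdd f 2 2),
      Lp.coeFn_add (Ω.pdd f 0 0) (Ω.pdd f 1 1)] with x h1 h2
    rw [h1, Pi.add_apply, h2, Pi.add_apply]
  filter_upwards [h1, pdd_ae_eq hξ hf 0 0, pdd_ae_eq hξ hf 1 1, pdd_ae_eq hξ hf 2 2]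
    with x a b c d
  rw [a, b, c, d, Fin.sum_univ_three]

end Smooth

theorem norm_sq_H2 (u : Ω.H2) : ‖u‖ ^ 2 =
    ‖Ω.fn u‖ ^ 2 + (∑ i, ‖Ω.pd u i‖ ^ 2 + ∑ j, ∑ i, ‖Ω.pdd u i j‖ ^ 2) := by
  have h : ‖u‖ = ‖(u : Ω.JetSpace)‖ := rfl
  rw [h, PiLp.norm_sq_eq_of_L2, Fintype.sum_sum_type, Fintype.sum_sum_type, Fintype.sum_prod_type,
    Finset.sum_comm]
  simp
  rfl

variable (Ω)

/-- The component of a jet, as a continuous linear map on `H²(Ω)`. -/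
noncomputable def jetL (a : Jet) : Ω.H2 →L[ℝ] Ω.L 2 :=
  (PiLp.proj 2 (fun _ : Jet => Ω.L 2) a : Ω.JetSpace →L[ℝ] Ω.L 2).comp Ω.H2.subtypeL

theorem jetL_pd (u : Ω.H2) (i : Fin 3) : Ω.jetL (.inr (.inl i)) u = Ω.pd u i := rfl

theorem jetL_pdd (u : Ω.H2) (i j : Fin 3) : Ω.jetL (.inr (.inr (i, j))) u = Ω.pdd u i j := rfl

/-- The weak Laplacian as a continuous linear map. -/
noncomputable def lapL : Ω.H2 →L[ℝ] Ω.L 2 := ∑ i, Ω.jetL (.inr (.inr (i, i)))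

theorem lapL_apply (u : Ω.H2) : Ω.lapL u = Ω.lap u := by
  simp [lapL, lap, jetL_pdd]

theorem continuous_fn : Continuous Ω.fn := (Ω.jetL (.inl ())).continuous

theorem continuous_pd (i : Fin 3) : Continuous fun u => Ω.pd u i :=
  (Ω.jetL (.inr (.inl i))).continuous

theorem continuous_pdd (i j : Fin 3) : Continuous fun u => Ω.pdd u i j :=
  (Ω.jetL (.inr (.inr (i, j)))).continuous

theorem continuous_lap : Continuous Ω.lap := by
  have := Ω.lapL.continuous
  exact this.congr Ω.lapL_apply

/-- Integration against a square integrable function is continuous on `L²(Ω)`. -/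
theorem continuous_integral_mul {η : E3 → ℝ} (hη : MemLp η 2 Ω.vol) :
    Continuous fun u : Ω.L 2 => ∫ x in Ω.carrier, u x * η x := by
  have : (fun u : Ω.L 2 => ∫ x in Ω.carrier, u x * η x) = fun u => inner ℝ (hη.toLp η) u := by
    funext u
    rw [L2.inner_def]
    refine integral_congr_ae ?_
    filter_upwards [hη.coeFn_toLp] with x hx
    rw [hx]
    simp
  rw [this]
  exact continuous_const.inner continuous_id

theorem continuous_integral_L2 : Continuous fun u : Ω.L 2 => ∫ x in Ω.carrier, u x := by
  simpa using Ω.continuous_integral_mul (η := fun _ => 1) (memLp_const 1)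

/-- Each test function imposes one equation between functionals that are continuous on `L²`. -/
theorem isClosed_hasWeakPartial (i : Fin 3) (a b : Jet) :
    IsClosed {u : Ω.JetSpace | HasWeakPartial Ω.carrier i (u a) (u b)} := by
  have : {u : Ω.JetSpace | HasWeakPartial Ω.carrier i (u a) (u b)} =
      ⋂ (η : E3 → ℝ) (_ : ContDiff ℝ ∞ η) (_ : HasCompactSupport η) (_ : tsupport η ⊆ Ω.carrier),
        {u : Ω.JetSpace | ∫ x in Ω.carrier, u a x * dcoord i η x =
          -∫ x in Ω.carrier, u b x * η x} := by
    ext u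
    simp only [Set.mem_iInter, Set.mem_ofPred_eq]
    rfl
  rw [this]
  refine isClosed_iInter fun η => isClosed_iInter fun h1 => isClosed_iInter fun h2 =>
    isClosed_iInter fun _ => isClosed_eq ?_ ?_
  · exact (Ω.continuous_integral_mul (Ω.memLp_of_continuous (h1.dcoord i).continuous 2)).comp
      (PiLp.continuous_apply 2 (fun _ : Jet => Ω.L 2) a)
  · exact ((Ω.continuous_integral_mul (Ω.memLp_of_continuous h1.continuous 2)).comp
      (PiLp.continuous_apply 2 (fun _ : Jet => Ω.L 2) b)).neg

theorem isClosed_H2 : IsClosed (Ω.H2 : Set Ω.JetSpace) := by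
  have : (Ω.H2 : Set Ω.JetSpace) =
      (⋂ i, {u : Ω.JetSpace | HasWeakPartial Ω.carrier i (u (.inl ())) (u (.inr (.inl i)))}) ∩
      ⋂ (i) (j), {u : Ω.JetSpace |
        HasWeakPartial Ω.carrier j (u (.inr (.inl i))) (u (.inr (.inr (i, j))))} := by
    ext u
    simp only [Set.mem_inter_iff, Set.mem_iInter, Set.mem_ofPred_eq]
    rfl
  rw [this]
  exact (isClosed_iInter fun i => Ω.isClosed_hasWeakPartial i _ _).inter
    (isClosed_iInter fun i => isClosed_iInter fun j => Ω.isClosed_hasWeakPartial j _ _)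

instance : CompleteSpace Ω.H2 := Ω.isClosed_H2.completeSpace_coe

variable {Ω}

/-- Replacing the sequence by one approximation for each `ε` makes closedness of `V` a matter of the
triangle inequality. -/
theorem mem_V_iff {u : Ω.H2} : u ∈ Ω.V ↔ ∀ ε > 0, ∃ (ξ : E3 → ℝ) (f : Ω.H2), ContDiff ℝ ∞ ξ ∧
    Ω.fn f =ᵐ[Ω.vol] ξ ∧ dist f u < ε ∧
    eLpNorm (normalDeriv Ω.carrier ξ) 2 Ω.surface < ENNReal.ofReal ε := by
  constructor
  · rintro ⟨ξ, f, h1, h2, h3, h4⟩ ε hε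
    simp only [Pi.zero_apply, sub_zero] at h4
    obtain ⟨k, hk1, hk2⟩ := ((Metric.tendsto_nhds.1 h3 ε hε).and
      (h4.eventually (gt_mem_nhds (ENNReal.ofReal_pos.2 hε)))).exists
    exact ⟨ξ k, f k, h1 k, h2 k, hk1, hk2⟩
  · intro h
    choose ξ f h1 h2 h3 h4 using fun k : ℕ => h (1 / ((k : ℝ) + 1)) Nat.one_div_pos_of_nat
    refine ⟨ξ, f, h1, h2, ?_, ?_⟩
    · rw [tendsto_iff_dist_tendsto_zero]
      exact squeeze_zero (fun _ => dist_nonneg) (fun k => (h3 k).le)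
        tendsto_one_div_add_atTop_nhds_zero_nat
    · simp only [Pi.zero_apply, sub_zero]
      refine tendsto_of_tendsto_of_tendsto_of_le_of_le tendsto_const_nhds ?_ (fun _ => zero_le)
        fun k => (h4 k).le
      have := ENNReal.tendsto_ofReal (tendsto_one_div_add_atTop_nhds_zero_nat (𝕜 := ℝ))
      simpa using this

variable (Ω)

theorem isClosed_V : IsClosed (Ω.V : Set Ω.H2) := by
  refine isClosed_of_closure_subset fun u hu => mem_V_iff.2 fun ε hε => ?_
  obtain ⟨v, hv, huv⟩ := Metric.mem_closure_iff.1 hu (ε / 2) (half_pos hε)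
  obtain ⟨ξ, f, h1, h2, h3, h4⟩ := mem_V_iff.1 hv (ε / 2) (half_pos hε)
  refine ⟨ξ, f, h1, h2, ?_, h4.trans_le (ENNReal.ofReal_le_ofReal (by linarith))⟩
  have := dist_triangle f v u
  rw [dist_comm v u] at this
  linarith

theorem volume_real_pos : 0 < volume.real Ω.carrier :=
  ENNReal.toReal_pos (Ω.isOpen.measure_pos volume Ω.isConnected.nonempty).ne'
    Ω.isBounded.measure_lt_top.ne

theorem average_eq_zero_iff (f : E3 → ℝ) :
    ⨍ x in Ω.carrier, f x = 0 ↔ ∫ x in Ω.carrier, f x = 0 := by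
  rw [setAverage_eq, smul_eq_mul, mul_eq_zero]
  exact ⟨fun h => h.resolve_left (inv_ne_zero Ω.volume_real_pos.ne'), Or.inr⟩

theorem isClosed_Vtilde : IsClosed (Ω.Vtilde : Set Ω.H2) := by
  have : (Ω.Vtilde : Set Ω.H2) = (Ω.V : Set Ω.H2) ∩ {u | ∫ x in Ω.carrier, Ω.fn u x = 0} := by
    ext u
    exact and_congr_right fun _ => Ω.average_eq_zero_iff _
  rw [this]
  exact Ω.isClosed_V.inter
    (isClosed_eq (Ω.continuous_integral_L2.comp Ω.continuous_fn) continuous_const)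

instance : CompleteSpace Ω.Vtilde := Ω.isClosed_Vtilde.completeSpace_coe

/-- The second order a priori estimate on `V`. -/
theorem exists_sum_norm_sq_pdd_le : ∃ C, 0 ≤ C ∧ ∀ u ∈ Ω.V,
    ∑ j, ∑ i, ‖Ω.pdd u i j‖ ^ 2 ≤ C * (‖Ω.lap u‖ ^ 2 + ∑ i, ‖Ω.pd u i‖ ^ 2) := by
  obtain ⟨C, hC0, hC⟩ := Ω.exists_hessSq_le
  refine ⟨C, hC0, ?_⟩
  rintro u ⟨ξ, f, h1, h2, h3, h4⟩
  simp only [Pi.zero_apply, sub_zero] at h4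
  have hle : ∀ (g : Ω.H2) (ζ : E3 → ℝ), ContDiff ℝ ∞ ζ → Ω.fn g =ᵐ[Ω.vol] ζ →
      Ω.gradSq ζ + Ω.hessSq ζ ≤ ‖g‖ ^ 2 := by
    intro g ζ hζ hg
    rw [norm_sq_H2, sum_norm_sq_pd hζ hg, sum_norm_sq_pdd hζ hg]
    exact le_add_of_nonneg_left (sq_nonneg _)
  -- The convergent sequence in `H²` is bounded and Cauchy, and its norms dominate the gradient and
  -- Hessian integrals of the smooth representatives; these are the two side conditions.
  obtain ⟨s, hs, hsb⟩ := hC ξ h1 h4 (by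
    obtain ⟨B, hB⟩ := (Metric.isBounded_range_of_tendsto f h3).exists_norm_le
    refine ⟨B ^ 2, fun k => (hle (f k) (ξ k) (h1 k) (h2 k)).trans ?_⟩
    exact pow_le_pow_left₀ (norm_nonneg _) (hB _ (Set.mem_range_self k)) 2) (by
    intro ε hε
    obtain ⟨M, hM⟩ := Metric.cauchySeq_iff.1 h3.cauchySeq (√ε) (Real.sqrt_pos.2 hε)
    refine ⟨M, fun k hk m hm => ?_⟩
    have hfn : Ω.fn (f k - f m) =ᵐ[Ω.vol] fun x => ξ k x - ξ m x := by
      have e : Ω.fn (f k - f m) = Ω.fn (f k) - Ω.fn (f m) := rfl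
      rw [e]
      filter_upwards [Lp.coeFn_sub (Ω.fn (f k)) (Ω.fn (f m)), h2 k, h2 m] with x a b c
      rw [a, Pi.sub_apply, b, c]
    refine (hle _ _ ((h1 k).sub (h1 m)) hfn).trans_lt ?_
    have := hM k hk m hm
    rw [dist_eq_norm] at this
    rw [← Real.sq_sqrt hε.le]
    gcongr)
  have c1 : Continuous fun u => ∑ j, ∑ i, ‖Ω.pdd u i j‖ ^ 2 :=
    continuous_finsetSum _ fun j _ => continuous_finsetSum _ fun i _ =>
      (Ω.continuous_pdd i j).norm.pow 2
  have c2 : Continuous fun u => C * (‖Ω.lap u‖ ^ 2 + ∑ i, ‖Ω.pd u i‖ ^ 2) :=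
    continuous_const.mul ((Ω.continuous_lap.norm.pow 2).add
      (continuous_finsetSum _ fun i _ => (Ω.continuous_pd i).norm.pow 2))
  have t1 := (c1.tendsto u).comp h3
  have t2 := ((c2.tendsto u).comp h3).add hs
  rw [add_zero] at t2
  refine le_of_tendsto_of_tendsto' t1 t2 fun k => ?_
  simp only [Function.comp]
  rw [sum_norm_sq_pdd (h1 k) (h2 k), norm_sq_lap (h1 k) (h2 k), sum_norm_sq_pd (h1 k) (h2 k)]
  exact hsb k

/-- The Poincaré inequality on `V`. -/
theorem exists_norm_sq_fn_le : ∃ C, 0 ≤ C ∧ ∀ u ∈ Ω.V,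
    ‖Ω.fn u‖ ^ 2 ≤ C * ∑ i, ‖Ω.pd u i‖ ^ 2 +
      (∫ x in Ω.carrier, Ω.fn u x) ^ 2 / volume.real Ω.carrier := by
  obtain ⟨C, hC0, hC⟩ := Ω.exists_integral_sq_le
  refine ⟨C, hC0, ?_⟩
  rintro u ⟨ξ, f, h1, h2, h3, -⟩
  have c1 : Continuous fun u => ‖Ω.fn u‖ ^ 2 := Ω.continuous_fn.norm.pow 2
  have c2 : Continuous fun u => C * ∑ i, ‖Ω.pd u i‖ ^ 2 +
      (∫ x in Ω.carrier, Ω.fn u x) ^ 2 / volume.real Ω.carrier :=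
    (continuous_const.mul (continuous_finsetSum _ fun i _ => (Ω.continuous_pd i).norm.pow 2)).add
      (((Ω.continuous_integral_L2.comp Ω.continuous_fn).pow 2).div_const _)
  refine le_of_tendsto_of_tendsto' ((c1.tendsto u).comp h3) ((c2.tendsto u).comp h3) fun k => ?_
  simp only [Function.comp]
  rw [sum_norm_sq_pd (h1 k) (h2 k), norm_sq_eq_of_ae_eq (h2 k), integral_congr_ae (h2 k)]
  exact hC (ξ k) (h1 k)

/-- The Sobolev embedding on `V`. -/
theorem exists_eLpNorm_fn_le : ∃ C, 0 ≤ C ∧ ∀ u ∈ Ω.V,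
    eLpNorm (Ω.fn u) 6 Ω.vol ≤ ENNReal.ofReal (C * ‖u‖) := by
  obtain ⟨C, hC0, hC⟩ := Ω.exists_integral_pow_six_le
  refine ⟨C ^ (1 / 6 : ℝ), by positivity, ?_⟩
  rintro u ⟨ξ, f, h1, h2, h3, -⟩
  have hbound : ∀ k, eLpNorm (Ω.fn (f k)) 6 Ω.vol ≤ ENNReal.ofReal (C ^ (1 / 6 : ℝ) * ‖f k‖) := by
    intro k
    rw [eLpNorm_congr_ae (h2 k), eLpNorm_eq_lintegral_rpow_enorm_toReal (by norm_num) (by norm_num)]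
    have e : ∫⁻ x in Ω.carrier, ‖ξ k x‖ₑ ^ (6 : ℝ≥0∞).toReal =
        ENNReal.ofReal (∫ x in Ω.carrier, ξ k x ^ 6) := by
      have hc : Continuous fun x => ξ k x ^ 6 := (h1 k).continuous.pow 6
      rw [ofReal_integral_eq_lintegral_ofReal (Ω.integrable_of_continuous hc)
        (Eventually.of_forall fun x => (show Even 6 by decide).pow_nonneg _)]
      refine lintegral_congr fun x => ?_
      rw [Real.enorm_eq_ofReal_abs, ENNReal.ofReal_rpow_of_nonneg (abs_nonneg _) (by simp)]
      congr 1
      rw [show (6 : ℝ≥0∞).toReal = ((6 : ℕ) : ℝ) by simp, Real.rpow_natCast]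
      exact (show Even 6 by decide).pow_abs _
    have hle := hC (ξ k) (h1 k)
    rw [← norm_sq_eq_of_ae_eq (h2 k), ← sum_norm_sq_pd (h1 k) (h2 k)] at hle
    have hle2 : ‖Ω.fn (f k)‖ ^ 2 + ∑ i, ‖Ω.pd (f k) i‖ ^ 2 ≤ ‖f k‖ ^ 2 := by
      rw [norm_sq_H2, ← add_assoc]
      exact le_add_of_nonneg_right (by positivity)
    have hle3 : ∫ x in Ω.carrier, ξ k x ^ 6 ≤ (C ^ (1 / 6 : ℝ) * ‖f k‖) ^ 6 := by
      refine hle.trans ?_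
      rw [mul_pow, ← Real.rpow_natCast (C ^ (1 / 6 : ℝ)), ← Real.rpow_mul hC0]
      norm_num
      calc C * (‖Ω.fn (f k)‖ ^ 2 + ∑ i, ‖Ω.pd (f k) i‖ ^ 2) ^ 3 ≤ C * (‖f k‖ ^ 2) ^ 3 := by gcongr
        _ = C * ‖f k‖ ^ 6 := by ring
    rw [e]
    calc ENNReal.ofReal (∫ x in Ω.carrier, ξ k x ^ 6) ^ (1 / (6 : ℝ≥0∞).toReal)
        ≤ ENNReal.ofReal ((C ^ (1 / 6 : ℝ) * ‖f k‖) ^ 6) ^ (1 / (6 : ℝ≥0∞).toReal) := by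
          gcongr
      _ = _ := by
          rw [ENNReal.ofReal_pow (by positivity), ← ENNReal.rpow_natCast, ← ENNReal.rpow_mul]
          norm_num
  have htend : Tendsto (fun k => Ω.fn (f k)) atTop (𝓝 (Ω.fn u)) :=
    (Ω.continuous_fn.tendsto u).comp h3
  have hmeas : TendstoInMeasure Ω.vol (fun k => (Ω.fn (f k) : E3 → ℝ)) atTop (Ω.fn u) :=
    tendstoInMeasure_of_tendsto_Lp htend
  -- The approximations converge only in `L²` a priori; along an almost everywhere convergent
  -- subsequence Fatou's lemma carries the `L⁶` bound to the limit.
  obtain ⟨ns, hns, hae⟩ := hmeas.exists_seq_tendsto_ae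
  have hlim := Lp.eLpNorm_lim_le_liminf_eLpNorm (p := 6) (μ := Ω.vol)
    (f := fun k => (Ω.fn (f (ns k)) : E3 → ℝ)) (fun k => Lp.aestronglyMeasurable _) (Ω.fn u) hae
  refine hlim.trans ?_
  have ht : Tendsto (fun k => ENNReal.ofReal (C ^ (1 / 6 : ℝ) * ‖f (ns k)‖)) atTop
      (𝓝 (ENNReal.ofReal (C ^ (1 / 6 : ℝ) * ‖u‖))) :=
    ENNReal.tendsto_ofReal ((h3.norm.comp hns.tendsto_atTop).const_mul _)
  rw [← ht.liminf_eq]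
  exact liminf_le_liminf (Eventually.of_forall fun k => hbound (ns k))

end SmoothBoundedDomain

/-! ### Hölder, Lax–Milgram and the weak problem. -/

theorem holderConjugate_six_fifths_six : ENNReal.HolderConjugate (6 / 5) 6 := by
  rw [ENNReal.holderConjugate_iff, ENNReal.inv_div (by norm_num) (by norm_num),
    ENNReal.div_eq_inv_mul, ← mul_add_one, show (5 : ℝ≥0∞) + 1 = 6 by norm_num]
  exact ENNReal.inv_mul_cancel (by norm_num) (by norm_num)

/-- Hölder's inequality. -/
theorem integrable_and_abs_integral_mul_le {α : Type*} [MeasurableSpace α] {μ : Measure α}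
    {p q : ℝ≥0∞} (hpq : p.HolderConjugate q) {f g : α → ℝ} (hf : MemLp f p μ)
    (hg : MemLp g q μ) : Integrable (fun x => f x * g x) μ ∧
      |∫ x, f x * g x ∂μ| ≤ (eLpNorm f p μ).toReal * (eLpNorm g q μ).toReal := by
  have hi : Integrable (fun x => f x * g x) μ := hf.integrable_mul hg
  refine ⟨hi, ?_⟩
  have h1 : eLpNorm (fun x => f x * g x) 1 μ ≤ eLpNorm f p μ * eLpNorm g q μ := by
    simpa using eLpNorm_le_eLpNorm_mul_eLpNorm_of_nnnorm hf.1 hg.1 (fun a b => a * b) 1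
      (Eventually.of_forall fun x => by simp)
  rw [← Real.norm_eq_abs, ← ENNReal.toReal_mul]
  refine (norm_integral_le_integral_norm _).trans ?_
  rw [integral_norm_eq_lintegral_enorm hi.aestronglyMeasurable, ← eLpNorm_one_eq_lintegral_enorm]
  exact ENNReal.toReal_mono (ENNReal.mul_ne_top hf.2.ne hg.2.ne) h1

/-- The Lax–Milgram theorem on a complete subspace. -/
theorem Submodule.exists_forall_eq_of_coercive {H : Type*} [NormedAddCommGroup H]
    [InnerProductSpace ℝ H] {V : Submodule ℝ H} [CompleteSpace V] {B : H →L[ℝ] H →L[ℝ] ℝ} {K : ℝ}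
    (hK : 0 < K) (hB : ∀ u ∈ V, ‖u‖ ^ 2 ≤ K * B u u) {l : V → ℝ} (hl : IsLinearMap ℝ l) {M : ℝ}
    (hM : ∀ v, |l v| ≤ M * ‖(v : H)‖) : ∃ φ : V, ∀ v : V, B φ v = l v := by
  have hc : IsCoercive (B.bilinearComp V.subtypeL V.subtypeL) := by
    refine ⟨K⁻¹, inv_pos.2 hK, fun u => ?_⟩
    rw [mul_assoc, ← sq, inv_mul_le_iff₀ hK]
    exact hB u u.2
  refine ⟨hc.continuousLinearEquivOfBilin.symm
    ((InnerProductSpace.toDual ℝ V).symm ((hl.mk' l).mkContinuous M hM)), fun v => ?_⟩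
  have := hc.continuousLinearEquivOfBilin_apply (hc.continuousLinearEquivOfBilin.symm
    ((InnerProductSpace.toDual ℝ V).symm ((hl.mk' l).mkContinuous M hM))) v
  rw [ContinuousLinearEquiv.apply_symm_apply, InnerProductSpace.toDual_symm_apply] at this
  exact this.symm

theorem IsLinearMap.continuous_and_contDiff_of_bound {E F : Type*} [NormedAddCommGroup E]
    [NormedSpace ℝ E] [NormedAddCommGroup F] [NormedSpace ℝ F] {L : E → F} (h : IsLinearMap ℝ L)
    {C : ℝ} (hC : ∀ x, ‖L x‖ ≤ C * ‖x‖) : Continuous L ∧ ContDiff ℝ ∞ L :=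
  ⟨((h.mk' L).mkContinuous C hC).continuous, ((h.mk' L).mkContinuous C hC).contDiff⟩

namespace SmoothBoundedDomain

variable (Ω : SmoothBoundedDomain)

/-! ### The bilinear form -/

/-- The bilinear form `b` as a continuous bilinear map on `H²(Ω)`. -/
noncomputable def formL : Ω.H2 →L[ℝ] Ω.H2 →L[ℝ] ℝ :=
  (innerSL ℝ).bilinearComp Ω.lapL Ω.lapL +
    ∑ i, (innerSL ℝ).bilinearComp (Ω.jetL (.inr (.inl i))) (Ω.jetL (.inr (.inl i)))

variable {Ω}

theorem inner_eq_integral_mul (f g : Ω.L 2) : inner ℝ f g = ∫ x in Ω.carrier, f x * g x := by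
  rw [L2.inner_def]
  exact integral_congr_ae (Eventually.of_forall fun x => by simp [mul_comm])

theorem formL_apply (φ v : Ω.H2) : Ω.formL φ v = Ω.form φ v := by
  have hint : ∀ i, Integrable (fun x => Ω.pd φ i x * Ω.pd v i x) Ω.vol := fun i =>
    MemLp.integrable_mul (p := 2) (q := 2) (Lp.memLp _) (Lp.memLp _)
  rw [form, integral_finsetSum _ fun i _ => hint i, ← inner_eq_integral_mul]
  simp only [← inner_eq_integral_mul]
  simp [formL, lapL_apply, jetL_pd]

theorem form_self (u : Ω.H2) : Ω.form u u = ‖Ω.lap u‖ ^ 2 + ∑ i, ‖Ω.pd u i‖ ^ 2 := by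
  rw [← formL_apply]
  simp [formL, lapL_apply, jetL_pd]

variable (Ω)

/-- The form bounds the gradient directly, the Hessian by the second order estimate with constant
`C`, and the function itself by the Poincaré inequality with constant `D`, whose mean term vanishes
on `Ω.Vtilde`. -/
theorem exists_norm_sq_le_form : ∃ K, 0 < K ∧ ∀ u ∈ Ω.Vtilde, ‖u‖ ^ 2 ≤ K * Ω.form u u := by
  obtain ⟨C, hC0, hC⟩ := Ω.exists_sum_norm_sq_pdd_le
  obtain ⟨D, hD0, hD⟩ := Ω.exists_norm_sq_fn_le
  refine ⟨D + 1 + C, by positivity, fun u hu => ?_⟩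
  have h1 := hC u hu.1
  have h2 := hD u hu.1
  rw [(Ω.average_eq_zero_iff _).1 hu.2] at h2
  rw [norm_sq_H2, form_self]
  rw [zero_pow two_ne_zero, zero_div, add_zero] at h2
  have h3 : 0 ≤ (D + 1) * ‖Ω.lap u‖ ^ 2 := by positivity
  linarith

variable {Ω}

/-! ### The load -/

theorem memLp_six_fn {v : Ω.H2} (hv : v ∈ Ω.V) : MemLp (Ω.fn v) 6 Ω.vol := by
  obtain ⟨C, -, hC⟩ := Ω.exists_eLpNorm_fn_le
  exact ⟨Lp.aestronglyMeasurable _, (hC v hv).trans_lt ENNReal.ofReal_lt_top⟩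

theorem integrable_mul_fn (w : Ω.L (6 / 5)) {v : Ω.H2} (hv : v ∈ Ω.V) :
    Integrable (fun x => w x * Ω.fn v x) Ω.vol :=
  (integrable_and_abs_integral_mul_le holderConjugate_six_fifths_six (Lp.memLp w) (memLp_six_fn hv)).1

variable (Ω)

theorem exists_abs_integral_mul_fn_le : ∃ C, 0 ≤ C ∧ ∀ (w : Ω.L (6 / 5)), ∀ v ∈ Ω.V,
    |∫ x in Ω.carrier, w x * Ω.fn v x| ≤ C * ‖w‖ * ‖v‖ := by
  obtain ⟨C, hC0, hC⟩ := Ω.exists_eLpNorm_fn_le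
  refine ⟨C, hC0, fun w v hv => ?_⟩
  refine (integrable_and_abs_integral_mul_le holderConjugate_six_fifths_six (Lp.memLp w) (memLp_six_fn hv)).2.trans ?_
  rw [← Lp.norm_def, mul_comm C, mul_assoc]
  exact mul_le_mul_of_nonneg_left
    (ENNReal.toReal_le_of_le_ofReal (mul_nonneg hC0 (norm_nonneg v)) (hC v hv)) (norm_nonneg w)

variable {Ω}

theorem fn_add_ae (u v : Ω.H2) : Ω.fn (u + v) =ᵐ[Ω.vol] fun x => Ω.fn u x + Ω.fn v x :=
  Lp.coeFn_add (Ω.fn u) (Ω.fn v)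

theorem fn_smul_ae (c : ℝ) (u : Ω.H2) : Ω.fn (c • u) =ᵐ[Ω.vol] fun x => c * Ω.fn u x :=
  Lp.coeFn_smul c (Ω.fn u)

theorem isLinearMap_integral_mul_fn (w : Ω.L (6 / 5)) :
    IsLinearMap ℝ fun v : Ω.Vtilde => ∫ x in Ω.carrier, w x * Ω.fn v x := by
  refine ⟨fun u v => ?_, fun c u => ?_⟩
  · rw [← integral_add (integrable_mul_fn w u.2.1) (integrable_mul_fn w v.2.1)]
    refine integral_congr_ae ?_
    filter_upwards [fn_add_ae (u : Ω.H2) v] with x hx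
    rw [Submodule.coe_add, hx, mul_add]
  · rw [smul_eq_mul, ← integral_const_mul]
    refine integral_congr_ae ?_
    filter_upwards [fn_smul_ae c (u : Ω.H2)] with x hx
    rw [Submodule.coe_smul, hx]
    ring

/-! ### Weak solutions -/

theorem isWeakSolution_iff {w : Ω.L (6 / 5)} {φ : Ω.Vtilde} : Ω.IsWeakSolution w φ ↔
    ∀ v : Ω.Vtilde, Ω.formL φ v = ∫ x in Ω.carrier, w x * Ω.fn v x := by
  simp only [IsWeakSolution, formL_apply, sub_eq_zero]
  exact ⟨fun h v => (h v).2, fun h v => ⟨integrable_mul_fn w v.2.1, h v⟩⟩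

theorem exists_isWeakSolution (w : Ω.L (6 / 5)) : ∃ φ, Ω.IsWeakSolution w φ := by
  obtain ⟨C, -, hC⟩ := Ω.exists_abs_integral_mul_fn_le
  obtain ⟨K, hK0, hK⟩ := Ω.exists_norm_sq_le_form
  simp only [isWeakSolution_iff]
  exact Submodule.exists_forall_eq_of_coercive hK0
    (fun u hu => (hK u hu).trans_eq (by rw [formL_apply])) (isLinearMap_integral_mul_fn w)
    fun v => hC w v v.2.1

/-- The difference of two solutions is an admissible test function, and coercivity makes its norm
zero. -/
theorem IsWeakSolution.unique {w : Ω.L (6 / 5)} {φ ψ : Ω.Vtilde} (h : Ω.IsWeakSolution w φ)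
    (h' : Ω.IsWeakSolution w ψ) : φ = ψ := by
  obtain ⟨K, hK0, hK⟩ := Ω.exists_norm_sq_le_form
  have h1 := hK (φ - ψ : Ω.Vtilde) (φ - ψ).2
  have h2 : Ω.formL ((φ - ψ : Ω.Vtilde) : Ω.H2) (φ - ψ : Ω.Vtilde) =
      Ω.formL φ (φ - ψ : Ω.Vtilde) - Ω.formL ψ (φ - ψ : Ω.Vtilde) := by
    rw [← sub_apply, ← map_sub, ← Submodule.coe_sub]
  rw [← formL_apply, h2, isWeakSolution_iff.1 h, isWeakSolution_iff.1 h', sub_self,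
    mul_zero] at h1
  rw [← sub_eq_zero, ← Submodule.coe_eq_zero, ← norm_eq_zero]
  exact pow_eq_zero_iff two_ne_zero |>.1 (le_antisymm h1 (sq_nonneg _))

theorem IsWeakSolution.add {w z : Ω.L (6 / 5)} {φ ψ : Ω.Vtilde} (h : Ω.IsWeakSolution w φ)
    (h' : Ω.IsWeakSolution z ψ) : Ω.IsWeakSolution (w + z) (φ + ψ) := by
  refine isWeakSolution_iff.2 fun v => ?_
  rw [Submodule.coe_add, map_add, add_apply, isWeakSolution_iff.1 h, isWeakSolution_iff.1 h',
    ← integral_add (integrable_mul_fn w v.2.1) (integrable_mul_fn z v.2.1)]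
  refine integral_congr_ae ?_
  filter_upwards [Lp.coeFn_add w z] with x hx
  rw [hx, Pi.add_apply, add_mul]

theorem IsWeakSolution.smul {w : Ω.L (6 / 5)} {φ : Ω.Vtilde} (c : ℝ)
    (h : Ω.IsWeakSolution w φ) : Ω.IsWeakSolution (c • w) (c • φ) := by
  refine isWeakSolution_iff.2 fun v => ?_
  rw [Submodule.coe_smul, map_smul, smul_apply, isWeakSolution_iff.1 h, smul_eq_mul,
    ← integral_const_mul]
  refine integral_congr_ae ?_
  filter_upwards [Lp.coeFn_smul c w] with x hx
  rw [hx, Pi.smul_apply, smul_eq_mul, mul_assoc]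

variable (Ω)

/-- The solution is tested against itself; coercivity and the bound on the load leave one power of
`‖φ‖` to cancel. -/
theorem exists_norm_isWeakSolution_le : ∃ C, ∀ (w : Ω.L (6 / 5)) (φ : Ω.Vtilde),
    Ω.IsWeakSolution w φ → ‖φ‖ ≤ C * ‖w‖ := by
  obtain ⟨K, hK0, hK⟩ := Ω.exists_norm_sq_le_form
  obtain ⟨C, hC0, hC⟩ := Ω.exists_abs_integral_mul_fn_le
  refine ⟨K * C, fun w φ h => ?_⟩
  have h1 := hK φ φ.2
  rw [← formL_apply, isWeakSolution_iff.1 h] at h1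
  have h2 : ‖(φ : Ω.H2)‖ * ‖(φ : Ω.H2)‖ ≤ K * C * ‖w‖ * ‖(φ : Ω.H2)‖ := by
    calc ‖(φ : Ω.H2)‖ * ‖(φ : Ω.H2)‖ = ‖(φ : Ω.H2)‖ ^ 2 := (sq _).symm
      _ ≤ K * (C * ‖w‖ * ‖(φ : Ω.H2)‖) :=
        h1.trans (mul_le_mul_of_nonneg_left ((le_abs_self _).trans (hC w φ φ.2.1)) hK0.le)
      _ = _ := by ring
  have h3 : 0 ≤ K * C * ‖w‖ := mul_nonneg (mul_nonneg hK0.le hC0) (norm_nonneg w)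
  rcases (norm_nonneg (φ : Ω.H2)).eq_or_lt with h0 | h0
  · exact h0.symm.trans_le h3
  · exact le_of_mul_le_mul_right h2 h0

/-! ### Constants -/

/-- Constants lie in `V` and are invisible to the form. They carry test functions from `V` to
`Ω.Vtilde`. -/
theorem exists_const (c : ℝ) : ∃ u ∈ Ω.V, Ω.fn u =ᵐ[Ω.vol] (fun _ => c) ∧ Ω.lap u = 0 ∧
    ∀ i, Ω.pd u i = 0 := by
  have hc : MemLp (fun _ : E3 => c) 2 Ω.vol := memLp_const c
  let J : Ω.JetSpace := WithLp.toLp 2 (Sum.elim (fun _ => hc.toLp _) fun _ => 0)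
  have hJ : J ∈ Ω.H2 := by
    refine ⟨fun i η h1 h2 h3 => ?_, fun i j => Ω.hasWeakPartial_zero j⟩
    have e1 : ∫ x in Ω.carrier, J (.inl ()) x * fderiv ℝ η x (EuclideanSpace.single i 1) =
        ∫ x in Ω.carrier, c * dcoord i η x := by
      refine integral_congr_ae ?_
      filter_upwards [hc.coeFn_toLp] with x hx
      exact congrArg (· * _) hx
    have e2 : ∫ x in Ω.carrier, J (.inr (.inl i)) x * η x = 0 := by
      refine integral_eq_zero_of_ae ?_
      filter_upwards [Lp.coeFn_zero ℝ 2 Ω.vol] with x hx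
      exact (congrArg (· * η x) hx).trans (zero_mul _)
    rw [e1, e2, neg_zero, setIntegral_mul_eq_integral (η := dcoord i η)
      ((tsupport_fderiv_apply_subset ℝ _).trans h3), integral_const_mul,
      integral_dcoord_eq_zero h1 h2, mul_zero]
  have hfn : Ω.fn ⟨J, hJ⟩ =ᵐ[Ω.vol] (fun _ => c) := hc.coeFn_toLp
  have hpdd : ∀ i j, Ω.pdd ⟨J, hJ⟩ i j = 0 := fun _ _ => rfl
  refine ⟨⟨J, hJ⟩, ⟨fun _ _ => c, fun _ => ⟨J, hJ⟩, fun _ => contDiff_const, fun _ => hfn,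
    tendsto_const_nhds, ?_⟩, hfn, ?_, fun _ => rfl⟩
  · simp [normalDeriv]
  · simp [lap, hpdd]

variable {Ω}

/-- The equation is tested with `v` minus its mean. The form does not change, and in the load the
mean can be moved from `v` to `w`, since `∫ w (v - v̄) = ∫ (w - w̄) v`. -/
theorem IsWeakSolution.form_eq {w : Ω.L (6 / 5)} {φ : Ω.Vtilde} (h : Ω.IsWeakSolution w φ)
    {v : Ω.H2} (hv : v ∈ Ω.V) :
    IntegrableOn (fun x => (w x - ⨍ y in Ω.carrier, w y) * Ω.fn v x) Ω.carrier ∧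
      Ω.form φ v = ∫ x in Ω.carrier, (w x - ⨍ y in Ω.carrier, w y) * Ω.fn v x := by
  have hw : Integrable w Ω.vol := (Lp.memLp w).integrable Fact.out
  have hvi : Integrable (Ω.fn v) Ω.vol := (Lp.memLp (Ω.fn v)).integrable (by norm_num)
  have hwv := integrable_mul_fn w hv
  set a := ⨍ y in Ω.carrier, w y with ha
  set b := ⨍ y in Ω.carrier, Ω.fn v y with hb
  have e : (fun x => (w x - a) * Ω.fn v x) = fun x => w x * Ω.fn v x - a * Ω.fn v x := by
    funext x
    ring
  rw [e]
  refine ⟨hwv.sub (hvi.const_mul a), ?_⟩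
  have hm := Ω.volume_real_pos.ne'
  have ha' : ∫ y in Ω.carrier, w y = volume.real Ω.carrier * a := by
    rw [ha, setAverage_eq, smul_eq_mul, mul_inv_cancel_left₀ hm]
  have hb' : ∫ y in Ω.carrier, Ω.fn v y = volume.real Ω.carrier * b := by
    rw [hb, setAverage_eq, smul_eq_mul, mul_inv_cancel_left₀ hm]
  obtain ⟨u, huV, hu, hlap, hpd⟩ := Ω.exists_const (-b)
  have hfn : Ω.fn (v + u) =ᵐ[Ω.vol] fun x => Ω.fn v x - b := by
    filter_upwards [fn_add_ae v u, hu] with x h1 h2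
    rw [h1, h2, sub_eq_add_neg]
  have hmem : v + u ∈ Ω.Vtilde := by
    refine ⟨Ω.V.add_mem hv huV, (Ω.average_eq_zero_iff _).2 ?_⟩
    rw [integral_congr_ae hfn, integral_sub hvi (integrable_const b), hb']
    simp
  have hform : Ω.form φ (v + u) = Ω.form φ v := by
    rw [← formL_apply, ← formL_apply, map_add]
    simp [formL, lapL_apply, jetL_pd, hlap, hpd]
  have hint : ∫ x in Ω.carrier, w x * Ω.fn (v + u) x =
      ∫ x in Ω.carrier, (w x * Ω.fn v x - b * w x) := by
    refine integral_congr_ae ?_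
    filter_upwards [hfn] with x hx
    rw [hx]
    ring
  have key := isWeakSolution_iff.1 h ⟨v + u, hmem⟩
  rw [formL_apply] at key
  rw [← hform, key, hint, integral_sub hwv (hw.const_mul b), integral_sub hwv (hvi.const_mul a),
    integral_const_mul, integral_const_mul, ha', hb']
  ring

end SmoothBoundedDomain

theorem proposition4p2 (Ω : SmoothBoundedDomain) :
    (∀ w : Ω.L (6 / 5), ∃! φ : Ω.Vtilde, Ω.IsWeakSolution w φ) ∧
    (∀ (w : Ω.L (6 / 5)) (φ : Ω.Vtilde), Ω.IsWeakSolution w φ →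
      ∀ v : Ω.H2, v ∈ Ω.V →
        IntegrableOn (fun x => (w x - ⨍ y in Ω.carrier, w y) * Ω.fn v x) Ω.carrier ∧
        Ω.form φ v =
          ∫ x in Ω.carrier, (w x - ⨍ y in Ω.carrier, w y) * Ω.fn v x) ∧
    (∀ L : Ω.L (6 / 5) → Ω.Vtilde,
      (∀ w, Ω.IsWeakSolution w (L w)) →
        IsLinearMap ℝ L ∧ Continuous L ∧ ContDiff ℝ ∞ L) := by
  refine ⟨fun w => ?_, fun w φ h v hv => h.form_eq hv, fun L hL => ?_⟩
  · obtain ⟨φ, hφ⟩ := SmoothBoundedDomain.exists_isWeakSolution w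
    exact ⟨φ, hφ, fun ψ hψ => hψ.unique hφ⟩
  -- Sums and multiples of solutions solve the problem with the corresponding data, so uniqueness
  -- forces any choice of solutions to be linear.
  · have hlin : IsLinearMap ℝ L := ⟨fun w z => (hL _).unique ((hL w).add (hL z)),
      fun c w => (hL _).unique ((hL w).smul c)⟩
    obtain ⟨C, hC⟩ := Ω.exists_norm_isWeakSolution_le
    exact ⟨hlin, @IsLinearMap.continuous_and_contDiff_of_bound _ _ _ _ _ (_) L hlin C
      fun w => hC w (L w) (hL w)⟩
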